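/- Let $N\ge 1$, $0<s<1$, $T>0$, let $\Omega\subset\mathbb{R}^N$ be a bounded domain and $\omega\subset\Omega$ an open set; put $\omega_T:=\omega\times(0,T)$ and $Q:=\Omega\times(0,T)$. Let $\mathbb{V}:=H_0^s(\Omega)=\{w\in H^s(\mathbb{R}^N): w=0 \text{ a.e. in } \mathbb{R}^N\setminus\Omega\}$ with norm $\|w\|_{\mathbb V}=\mathcal F(w,w)^{1/2}$, where $$\mathcal F(u,w)=\frac{C_{N,s}}{2}\int_{\mathbb{R}^N}\int_{\mathbb{R}^N}\frac{(u(x)-u(y))(w(x)-w(y))}{|x-y|^{N+2s}}\,dx\,dy,\qquad C_{N,s}=\frac{s2^{2s}\Gamma(\frac{2s+N}{2})}{\pi^{N/2}\Gamma(1-s)},$$ let $\mathbb{V}^*$ be its dual with respect to the pivot space $L^2$, and let $W(0,T;\mathbb{V})=\{\psi\in L^2((0,T);\mathbb{V}):\psi_t\in L^2((0,T);\mathbb{V}^*)\}$, whose elements are identified with their representatives in $C([0,T];L^2(\Omega))$. Let $\rho^0\in L^\infty(\Omega)$ and $v\in L^\infty(\omega_T)$. A weak solution of $$\begin{cases}\rho_t+(-\Delta)^s\rho=v\rho\chi_\omega&\text{in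 }Q,\\ \rho=0&\text{in }(\mathbb{R}^N\setminus\Omega)\times(0,T),\\ \rho(\cdot,0)=\rho^0&\text{in }\Omega\end{cases}$$ is a function $\rho\in L^2((0,T);\mathbb{V})$ such that $$-\int_0^T\langle\phi_t,\rho\rangle_{\mathbb{V}^*,\mathbb{V}}\,dt+\int_0^T\mathcal F(\rho,\phi)\,dt-\int_{\omega_T}v\rho\phi\,dx\,dt=\int_\Omega\rho^0\phi(\cdot,0)\,dx$$ for every $\phi\in W(0,T;\mathbb{V})$ with $\phi(\cdot,T)=0$ a.e. in $\Omega$. Theorem. This problem has a weak solution $\rho$; it is unique (up to equality a.e. in $\mathbb{R}^N\times(0,T)$), it belongs to $W(0,T;\mathbb{V})\cap L^\infty(\mathbb{R}^N\times(0,T))$, and $$\|\rho\|_{L^\infty(\mathbb{R}^N\times(0,T))}\le e^{\|v\|_{L^\infty(\omega_T)}T}\,\|\rho^0\|_{L^\infty(\Omega)}.$$ -/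

import Mathlib

open MeasureTheory Set

noncomputable section

namespace FracDiff

/-- `ℝ^N` with its Euclidean norm. -/
abbrev Sp (N : ℕ) : Type := EuclideanSpace ℝ (Fin N)

/-- The normalization constant `C_{N,s} = s 2^{2s} Γ((2s+N)/2) / (π^{N/2} Γ(1-s))` of the
fractional Laplacian of order `s` on `ℝ^N`. -/
def fracConst (N : ℕ) (s : ℝ) : ℝ :=
  s * (2 : ℝ) ^ (2 * s) * Real.Gamma ((2 * s + N) / 2) /
    (Real.pi ^ ((N : ℝ) / 2) * Real.Gamma (1 - s))

/-- The integrand `(u(x) - u(y)) (w(x) - w(y)) / |x - y|^{N+2s}`. -/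
def gagliardoKernel {N : ℕ} (s : ℝ) (u w : Sp N → ℝ) (p : Sp N × Sp N) : ℝ :=
  (u p.1 - u p.2) * (w p.1 - w p.2) / ‖p.1 - p.2‖ ^ ((N : ℝ) + 2 * s)

/-- The bilinear form
`𝓕(u,w) = (C_{N,s}/2) ∫∫ (u(x) - u(y)) (w(x) - w(y)) / |x - y|^{N+2s} dx dy`. -/
def fracForm {N : ℕ} (s : ℝ) (u w : Sp N → ℝ) : ℝ :=
  fracConst N s / 2 *
    ∫ p, gagliardoKernel s u w p ∂((volume : Measure (Sp N)).prod volume)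

section Facts

variable {N : ℕ}

theorem fracConst_pos [NeZero N] (s : Ioo (0 : ℝ) 1) : 0 < fracConst N s := by
  have h0 := s.2.1
  have h1 := s.2.2
  have hN : (0 : ℝ) ≤ N := Nat.cast_nonneg N
  unfold fracConst
  have g1 : 0 < Real.Gamma ((2 * (s : ℝ) + N) / 2) := Real.Gamma_pos_of_pos (by linarith)
  have g2 : 0 < Real.Gamma (1 - (s : ℝ)) := Real.Gamma_pos_of_pos (by linarith)
  have := Real.pi_pos
  positivity

theorem gagliardoKernel_congr (s : ℝ) {u u' w w' : Sp N → ℝ}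
    (hu : u =ᵐ[volume] u') (hw : w =ᵐ[volume] w') :
    gagliardoKernel s u w =ᵐ[(volume : Measure (Sp N)).prod volume]
      gagliardoKernel s u' w' := by
  have q1 := Measure.quasiMeasurePreserving_fst
    (μ := (volume : Measure (Sp N))) (ν := (volume : Measure (Sp N)))
  have q2 := Measure.quasiMeasurePreserving_snd
    (μ := (volume : Measure (Sp N))) (ν := (volume : Measure (Sp N)))
  filter_upwards [q1.ae hu, q2.ae hu, q1.ae hw, q2.ae hw] with p a b c d
  simp [gagliardoKernel, a, b, c, d]

theorem gagliardoKernel_aesm (s : ℝ) {u w : Sp N → ℝ}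
    (hu : AEStronglyMeasurable u volume) (hw : AEStronglyMeasurable w volume) :
    AEStronglyMeasurable (gagliardoKernel s u w)
      ((volume : Measure (Sp N)).prod volume) := by
  have m : AEStronglyMeasurable
      (fun p : Sp N × Sp N => (‖p.1 - p.2‖ ^ ((N : ℝ) + 2 * s))⁻¹)
      ((volume : Measure (Sp N)).prod volume) := by
    apply Measurable.aestronglyMeasurable
    fun_prop
  have := ((hu.comp_fst (ν := volume)).sub (hu.comp_snd (μ := volume))).mul
    ((hw.comp_fst (ν := volume)).sub (hw.comp_snd (μ := volume)))
  exact (this.mul m).congr (Filter.Eventually.of_forall fun p => by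
    simp [gagliardoKernel, div_eq_mul_inv])

theorem gagliardoKernel_self_nonneg (s : ℝ) (u : Sp N → ℝ) (p : Sp N × Sp N) :
    0 ≤ gagliardoKernel s u u p :=
  div_nonneg (mul_self_nonneg _) (Real.rpow_nonneg (norm_nonneg _) _)

theorem integrable_gagliardoKernel (s : ℝ) {u w : Sp N → ℝ}
    (hu : AEStronglyMeasurable u volume) (hw : AEStronglyMeasurable w volume)
    (iu : Integrable (gagliardoKernel s u u) ((volume : Measure (Sp N)).prod volume))
    (iw : Integrable (gagliardoKernel s w w) ((volume : Measure (Sp N)).prod volume)) :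
    Integrable (gagliardoKernel s u w) ((volume : Measure (Sp N)).prod volume) := by
  refine (iu.add iw).mono' (gagliardoKernel_aesm s hu hw)
    (Filter.Eventually.of_forall fun p => ?_)
  have hd : 0 ≤ ‖p.1 - p.2‖ ^ ((N : ℝ) + 2 * s) := Real.rpow_nonneg (norm_nonneg _) _
  simp only [gagliardoKernel, Pi.add_apply, Real.norm_eq_abs]
  rw [abs_div, abs_of_nonneg hd, ← add_div]
  refine div_le_div_of_nonneg_right ?_ hd
  rw [abs_le]
  constructor <;>
    nlinarith [sq_nonneg ((u p.1 - u p.2) + (w p.1 - w p.2)),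
      sq_nonneg ((u p.1 - u p.2) - (w p.1 - w p.2)),
      sq_nonneg (u p.1 - u p.2), sq_nonneg (w p.1 - w p.2)]

end Facts

/-- `H_0^s(Ω)` as a linear subspace of `L²(ℝ^N)`: the functions in `H^s(ℝ^N)` that vanish
almost everywhere outside `Ω`. -/
def hZeroSubmodule {N : ℕ} (s : ℝ) (Ω : Set (Sp N)) :
    Submodule ℝ (Lp ℝ 2 (volume : Measure (Sp N))) where
  carrier := {u | Integrable (gagliardoKernel s u u) ((volume : Measure (Sp N)).prod volume) ∧
    ∀ᵐ x, x ∉ Ω → u x = 0}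
  zero_mem' := by
    have h0 := Lp.coeFn_zero ℝ 2 (volume : Measure (Sp N))
    refine ⟨?_, ?_⟩
    · refine (integrable_zero _ _ _).congr ?_
      refine Filter.EventuallyEq.trans ?_ (gagliardoKernel_congr s h0 h0).symm
      exact Filter.Eventually.of_forall fun p => by simp [gagliardoKernel]
    · filter_upwards [h0] with x hx _ using hx
  add_mem' := by
    rintro u w ⟨iu, zu⟩ ⟨iw, zw⟩
    have h := Lp.coeFn_add u w
    have hu := Lp.aestronglyMeasurable u
    have hw := Lp.aestronglyMeasurable w
    refine ⟨?_, ?_⟩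
    · have i := integrable_gagliardoKernel s hu hw iu iw
      refine ((iu.add iw).add (i.const_mul 2)).congr ?_
      refine Filter.EventuallyEq.trans ?_ (gagliardoKernel_congr s h h).symm
      exact Filter.Eventually.of_forall fun p => by
        simp only [gagliardoKernel, Pi.add_apply]; ring
    · filter_upwards [h, zu, zw] with x hx a b hΩ
      have := hx
      rw [Pi.add_apply, a hΩ, b hΩ, add_zero] at this
      exact this
  smul_mem' := by
    rintro c u ⟨iu, zu⟩
    have h := Lp.coeFn_smul c u
    refine ⟨?_, ?_⟩
    · refine (iu.const_mul (c ^ 2)).congr ?_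
      refine Filter.EventuallyEq.trans ?_ (gagliardoKernel_congr s h h).symm
      exact Filter.Eventually.of_forall fun p => by
        simp only [gagliardoKernel, Pi.smul_apply, smul_eq_mul]; ring
    · filter_upwards [h, zu] with x hx a hΩ
      have := hx
      rw [Pi.smul_apply, a hΩ, smul_zero] at this
      exact this

/-- The space `𝕍 = H_0^s(Ω)`. It is a new type because its norm is
`‖u‖ = 𝓕(u,u)^{1/2}`, not the norm of `L²`. -/
def HZero {N : ℕ} (s : Ioo (0 : ℝ) 1) (Ω : Set (Sp N)) : Type :=
  hZeroSubmodule (s : ℝ) Ω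

namespace HZero

variable {N : ℕ} {s : Ioo (0 : ℝ) 1} {Ω : Set (Sp N)}

instance : AddCommGroup (HZero s Ω) := inferInstanceAs (AddCommGroup (hZeroSubmodule (s : ℝ) Ω))

instance : Module ℝ (HZero s Ω) := inferInstanceAs (Module ℝ (hZeroSubmodule (s : ℝ) Ω))

/-- The inclusion `H_0^s(Ω) → L²(ℝ^N)`. -/
def toL2 : HZero s Ω →ₗ[ℝ] Lp ℝ 2 (volume : Measure (Sp N)) :=
  (hZeroSubmodule (s : ℝ) Ω).subtype

theorem toL2_injective : Function.Injective (toL2 : HZero s Ω → _) :=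
  Subtype.val_injective

theorem aesm (u : HZero s Ω) : AEStronglyMeasurable (toL2 u) volume :=
  Lp.aestronglyMeasurable (toL2 u)

theorem integrable_self (u : HZero s Ω) :
    Integrable (gagliardoKernel s (toL2 u) (toL2 u))
      ((volume : Measure (Sp N)).prod volume) :=
  u.2.1

theorem integrable (u w : HZero s Ω) :
    Integrable (gagliardoKernel s (toL2 u) (toL2 w))
      ((volume : Measure (Sp N)).prod volume) :=
  integrable_gagliardoKernel _ u.aesm w.aesm u.integrable_self w.integrable_self

/-- `𝓕` is a scalar product on `H_0^s(Ω)`. -/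
abbrev core [NeZero N] : InnerProductSpace.Core ℝ (HZero s Ω) where
  inner u w := fracForm s (toL2 u) (toL2 w)
  conj_inner_symm u w := by
    simp only [conj_trivial, fracForm, gagliardoKernel]
    congr 2
    ext p
    ring
  re_inner_nonneg u := by
    have hC := fracConst_pos (N := N) s
    exact mul_nonneg (by positivity)
      (integral_nonneg fun p => gagliardoKernel_self_nonneg _ _ p)
  add_left u w z := by
    simp only [fracForm]
    rw [← mul_add, ← integral_add (integrable u z) (integrable w z)]
    congr 1
    refine integral_congr_ae ?_
    have h : (toL2 (u + w) : Sp N → ℝ) =ᵐ[volume] toL2 u + toL2 w := by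
      rw [map_add]; exact Lp.coeFn_add _ _
    refine (gagliardoKernel_congr s h (Filter.EventuallyEq.refl _ _)).trans ?_
    exact Filter.Eventually.of_forall fun p => by
      simp only [gagliardoKernel, Pi.add_apply]; ring
  smul_left u w c := by
    simp only [fracForm, conj_trivial]
    rw [mul_left_comm, ← integral_const_mul (c : ℝ)]
    congr 1
    refine integral_congr_ae ?_
    have h : (toL2 (c • u) : Sp N → ℝ) =ᵐ[volume] c • toL2 u := by
      rw [map_smul]; exact Lp.coeFn_smul c (toL2 u)
    refine (gagliardoKernel_congr s h (Filter.EventuallyEq.refl _ _)).trans ?_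
    exact Filter.Eventually.of_forall fun p => by
      simp only [gagliardoKernel, Pi.smul_apply, smul_eq_mul]; ring
  definite u hu := by
    have hC := fracConst_pos (N := N) s
    have hI : ∫ p, gagliardoKernel s (toL2 u) (toL2 u) p
        ∂((volume : Measure (Sp N)).prod volume) = 0 := by
      have hu' : fracConst N s / 2 * _ = 0 := hu
      rcases mul_eq_zero.1 hu' with h | h
      · linarith
      · exact h
    rw [integral_eq_zero_iff_of_nonneg (fun p => gagliardoKernel_self_nonneg _ _ p)
      u.integrable_self] at hI
    have hxy : ∀ᵐ p ∂((volume : Measure (Sp N)).prod volume), toL2 u p.1 = toL2 u p.2 := by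
      filter_upwards [hI] with p hp
      by_contra hne
      have hp1 : p.1 - p.2 ≠ 0 := fun h => hne (by rw [sub_eq_zero.1 h])
      have hd : ‖p.1 - p.2‖ ^ ((N : ℝ) + 2 * s) ≠ 0 :=
        (Real.rpow_pos_of_pos (norm_pos_iff.2 hp1) _).ne'
      have hs : toL2 u p.1 - toL2 u p.2 ≠ 0 := sub_ne_zero.2 hne
      exact div_ne_zero (mul_ne_zero hs hs) hd hp
    obtain ⟨x, hx⟩ := (Measure.ae_ae_of_ae_prod hxy).exists
    have hconst : (toL2 u : Sp N → ℝ) =ᵐ[volume] fun _ => toL2 u x := by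
      filter_upwards [hx] with y hy using hy.symm
    have hm : MemLp (fun _ : Sp N => toL2 u x) 2 (volume : Measure (Sp N)) :=
      (memLp_congr_ae hconst).1 (Lp.memLp (toL2 u))
    have hinf : (volume : Measure (Sp N)) univ = ⊤ := by
      have : Nonempty (Fin N) := ⟨⟨0, Nat.pos_of_ne_zero (NeZero.ne N)⟩⟩
      have : Nontrivial (Sp N) := inferInstance
      have : NoncompactSpace (Sp N) := NormedSpace.noncompactSpace ℝ (Sp N)
      exact measure_univ_of_isAddLeftInvariant _
    rw [memLp_const_iff (by norm_num) (by norm_num)] at hm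
    have hc : toL2 u x = 0 := by
      rcases hm with h | h
      · exact h
      · simp [hinf] at h
    apply toL2_injective
    rw [map_zero]
    apply Lp.ext
    refine hconst.trans ?_
    rw [hc]
    exact (Lp.coeFn_zero ℝ 2 _).symm

instance [NeZero N] : NormedAddCommGroup (HZero s Ω) :=
  InnerProductSpace.Core.toNormedAddCommGroup (cd := core)

instance [NeZero N] : InnerProductSpace ℝ (HZero s Ω) :=
  InnerProductSpace.ofCore core.toCore

theorem inner_eq [NeZero N] (u w : HZero s Ω) :
    inner ℝ u w = fracForm s (toL2 u) (toL2 w) := rfl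

end HZero

/-- Lebesgue measure on the open time interval `(0,T)`. -/
abbrev timeMeasure (T : ℝ) : Measure ℝ := volume.restrict (Ioo 0 T)

/-- Lebesgue measure on the cylinder `A × (0,T)`. -/
abbrev cylMeasure {N : ℕ} (A : Set (Sp N)) (T : ℝ) : Measure (Sp N × ℝ) :=
  (volume.restrict A).prod (timeMeasure T)

variable {N : ℕ} [NeZero N] {s : Ioo (0 : ℝ) 1} {Ω : Set (Sp N)}

/-- The measurable function `ψ` of `(x,t)` belongs to `L²((0,T); 𝕍)`, where `Ψ` is `ψ` seen as a
square (Bochner) integrable function `t ↦ ψ(·,t)` with values in `𝕍`. -/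
structure IsL2V (T : ℝ) (ψ : Sp N × ℝ → ℝ) (Ψ : ℝ → HZero s Ω) : Prop where
  aestronglyMeasurable : AEStronglyMeasurable ψ (cylMeasure univ T)
  memLp : MemLp Ψ 2 (timeMeasure T)
  slice : ∀ᵐ t ∂(timeMeasure T), (fun x => ψ (x, t)) =ᵐ[volume] HZero.toL2 (Ψ t)

/-- `ψ` belongs to `W(0,T; 𝕍)`: it is in `L²((0,T); 𝕍)` and its time derivative in the sense of
distributions on `(0,T)` with values in the dual `𝕍*`, where `L²` is the pivot space
(`⟨u, w⟩ = ∫ u w dx` for `u, w ∈ 𝕍`), is the function `Ψ' ∈ L²((0,T); 𝕍*)`. -/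
structure IsW (T : ℝ) (ψ : Sp N × ℝ → ℝ) (Ψ : ℝ → HZero s Ω)
    (Ψ' : ℝ → StrongDual ℝ (HZero s Ω)) : Prop where
  isL2V : IsL2V T ψ Ψ
  deriv_memLp : MemLp Ψ' 2 (timeMeasure T)
  deriv_eq : ∀ η : ℝ → ℝ, ContDiff ℝ (⊤ : ℕ∞) η → HasCompactSupport η → tsupport η ⊆ Ioo 0 T →
    ∀ w : HZero s Ω,
      ∫ t, deriv η t * (∫ x, HZero.toL2 (Ψ t) x * HZero.toL2 w x) ∂(timeMeasure T)
        = - ∫ t, η t * Ψ' t w ∂(timeMeasure T)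

/-- Membership in the space `W(0,T; 𝕍)`, where `𝕍 = H_0^s(Ω)`. -/
def MemW (s : Ioo (0 : ℝ) 1) (Ω : Set (Sp N)) (T : ℝ) (ψ : Sp N × ℝ → ℝ) : Prop :=
  ∃ (Ψ : ℝ → HZero s Ω) (Ψ' : ℝ → StrongDual ℝ (HZero s Ω)), IsW T ψ Ψ Ψ'

/-- `φ` belongs to the space of test functions `H(Q) = {φ ∈ W(0,T; 𝕍) : φ(·,T) = 0}`.
Here `c` is the representative of `φ` in `C([0,T]; L²)`, through which
`φ(·,0)` and `φ(·,T)` are defined. -/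
structure IsTest (T : ℝ) (φ : Sp N × ℝ → ℝ) (Φ : ℝ → HZero s Ω)
    (Φ' : ℝ → StrongDual ℝ (HZero s Ω)) (c : ℝ → Lp ℝ 2 (volume : Measure (Sp N))) : Prop where
  isW : IsW T φ Φ Φ'
  continuousOn : ContinuousOn c (Icc 0 T)
  ae_eq : ∀ᵐ t ∂(timeMeasure T), c t = HZero.toL2 (Φ t)
  final : c T = 0

/-- `ρ` is a weak solution of `ρ_t + (-Δ)^s ρ = v ρ χ_ω` in `Ω × (0,T)`, `ρ = 0` in
`(ℝ^N ∖ Ω) × (0,T)`, `ρ(·,0) = ρ⁰` in `Ω`: `ρ ∈ L²((0,T); 𝕍)` and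
`-∫₀ᵀ ⟨φ_t, ρ⟩ dt + ∫₀ᵀ 𝓕(ρ,φ) dt - ∫_{ω×(0,T)} v ρ φ dx dt = ∫_Ω ρ⁰ φ(0) dx`
for all test functions `φ ∈ H(Q)`. -/
def IsWeakSolution (s : Ioo (0 : ℝ) 1) (Ω ω : Set (Sp N)) (T : ℝ) (v : Sp N × ℝ → ℝ)
    (ρ₀ : Sp N → ℝ) (ρ : Sp N × ℝ → ℝ) : Prop :=
  ∃ R : ℝ → HZero s Ω, IsL2V T ρ R ∧
    ∀ (φ : Sp N × ℝ → ℝ) (Φ : ℝ → HZero s Ω) (Φ' : ℝ → StrongDual ℝ (HZero s Ω))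
      (c : ℝ → Lp ℝ 2 (volume : Measure (Sp N))), IsTest T φ Φ Φ' c →
      - ∫ t, Φ' t (R t) ∂(timeMeasure T)
        + ∫ t, fracForm s (HZero.toL2 (R t)) (HZero.toL2 (Φ t)) ∂(timeMeasure T)
        - ∫ p, v p * ρ p * φ p ∂(cylMeasure ω T)
      = ∫ x in Ω, ρ₀ x * c 0 x

end FracDiff

end

/-! The equation is read as R' + A R = M R for a bounded map `ι : V → H`, where V is `HZero s Ω`, H
is L²(ℝ^N), A is the operator of the inner product 𝓕 of V, and M(t) is multiplication by v(·,t)χ_ω,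
a symmetric operator on H of norm at most L = ‖v‖_∞. The evolution argument is abstract; the
concrete input is that V is complete and embeds in H (`HZero.exists_poincare`,
`HZero.completeSpace`) and that paths in H are functions of (x,t) (`exists_function_of_path`).

Existence uses the semi-implicit Euler scheme u(t) + h A u(t) = u(t-h) + h M(t) u(t-h), with u = u₀
for t ≤ 0, imposed for every real t in (0,T] and not only at grid points, so that no interpolation
is needed (`exists_euler_path`). The energy estimate `euler_energy` bounds u in L²(V) and makes the
increments u(t) - u(t-h) of size √h in L²(H). The problem is linear, so a weak limit is enough: the
time difference is moved to the test path (`euler_identity`), where the difference quotients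
converge strongly (`exists_steklov_estimate`).

The sup bound is an invariant of the scheme. The explicit half step multiplies the sup norm by at
most 1 + hL, and the resolvent of A does not increase it, by testing with the truncation `excess`
(`toL2_mem_boundedBy`). Over all the steps the factor is at most exp(LT). Written as linear
inequalities, the bound survives the weak limit (`ae_abs_le_of_forall_integral_inner_le`).

Uniqueness tests the equation of a difference R with Φ(t) = ∫_t^T e^{-λr} R(r) dr
(`ae_eq_zero_of_isTestPath_identity`). This requires no time regularity of R. The derivative of a
weak solution is then read off from the equation (`SolvesWeakly.exists_deriv`). -/

noncomputable section

namespace FracDiff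

open Filter Topology

/-! ### Weak and strong measurability in separable Hilbert spaces -/

section Measurability

variable {H : Type*} [NormedAddCommGroup H] [InnerProductSpace ℝ H]

/-- Distinct orthonormal vectors are at distance √2, so the balls of radius 1/2 around them are
disjoint. Countability of a Hilbert basis makes its finite partial sums a countably generated limit,
which preserves measurability. -/
theorem countable_of_orthonormal [TopologicalSpace.SeparableSpace H] {ι : Type*} {b : ι → H}
    (hb : Orthonormal ℝ b) : Countable ι := by
  refine Pairwise.countable_of_isOpen_disjoint (s := fun i => Metric.ball (b i) (1 / 2)) ?_
    (fun _ => Metric.isOpen_ball) (fun i => Metric.nonempty_ball.2 (by norm_num))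
  intro i j hij
  refine Metric.ball_disjoint_ball ?_
  have h2 : ‖b i - b j‖ ^ 2 = 2 := by
    rw [norm_sub_sq_real, hb.1 i, hb.1 j, hb.2 hij]
    norm_num
  rw [dist_eq_norm]
  nlinarith [norm_nonneg (b i - b j)]

/-- In a separable Hilbert space, weak measurability implies strong measurability. -/
theorem aestronglyMeasurable_of_inner [CompleteSpace H] [TopologicalSpace.SeparableSpace H]
    {α : Type*} [MeasurableSpace α] {μ : Measure α} {f : α → H}
    (hf : ∀ w, AEStronglyMeasurable (fun a => inner ℝ w (f a)) μ) :
    AEStronglyMeasurable f μ := by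
  obtain ⟨w, b, hb⟩ := exists_hilbertBasis ℝ H
  have : Countable w := countable_of_orthonormal b.orthonormal
  refine aestronglyMeasurable_of_tendsto_ae (Filter.atTop : Filter (Finset w))
    (f := fun S a => ∑ i ∈ S, inner ℝ (b i) (f a) • b i) (fun S => ?_)
    (Eventually.of_forall fun a => ?_)
  · exact Finset.aestronglyMeasurable_fun_sum _ fun i _ => (hf (b i)).smul_const _
  · have := b.hasSum_repr (f a)
    simp only [b.repr_apply_apply] at this
    exact this

theorem stronglyMeasurable_of_inner [CompleteSpace H] [TopologicalSpace.SeparableSpace H]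
    {α : Type*} [MeasurableSpace α] {f : α → H}
    (hf : ∀ w, StronglyMeasurable (fun a => inner ℝ w (f a))) :
    StronglyMeasurable f := by
  obtain ⟨w, b, hb⟩ := exists_hilbertBasis ℝ H
  have : Countable w := countable_of_orthonormal b.orthonormal
  refine stronglyMeasurable_of_tendsto (Filter.atTop : Filter (Finset w))
    (f := fun S a => ∑ i ∈ S, inner ℝ (b i) (f a) • b i) (fun S => ?_)
    (tendsto_pi_nhds.2 fun a => ?_)
  · exact Finset.stronglyMeasurable_fun_sum _ fun i _ => (hf (b i)).smul_const _
  · have := b.hasSum_repr (f a)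
    simp only [b.repr_apply_apply] at this
    exact this

/-- Two elements of a separable Hilbert space valued function space agree a.e. as soon as all
their coordinates do. -/
theorem ae_eq_of_forall_inner [CompleteSpace H] [TopologicalSpace.SeparableSpace H]
    {α : Type*} [MeasurableSpace α] {μ : Measure α} {f g : α → H}
    (h : ∀ w, (fun a => inner ℝ w (f a)) =ᵐ[μ] fun a => inner ℝ w (g a)) : f =ᵐ[μ] g := by
  obtain ⟨w, b, hb⟩ := exists_hilbertBasis ℝ H
  have : Countable w := countable_of_orthonormal b.orthonormal
  have h' : ∀ᵐ a ∂μ, ∀ i : w, inner ℝ (b i) (f a) = inner ℝ (b i) (g a) :=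
    ae_all_iff.2 fun i => h (b i)
  filter_upwards [h'] with a ha
  apply b.repr.injective
  ext i
  simpa only [b.repr_apply_apply] using ha i

end Measurability

/-! ### Calculus on the time interval and the du Bois-Reymond lemma -/

section Time

theorem integral_timeMeasure {E : Type*} [NormedAddCommGroup E] [NormedSpace ℝ E] {T : ℝ}
    (hT : 0 ≤ T) (f : ℝ → E) :
    ∫ t, f t ∂(timeMeasure T) = ∫ t in (0 : ℝ)..T, f t := by
  rw [intervalIntegral.integral_of_le hT, integral_Ioc_eq_integral_Ioo]

theorem integrable_timeMeasure_iff {E : Type*} [NormedAddCommGroup E] {T : ℝ}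
    (hT : 0 ≤ T) {f : ℝ → E} :
    Integrable f (timeMeasure T) ↔ IntervalIntegrable f volume 0 T := by
  rw [intervalIntegrable_iff_integrableOn_Ioo_of_le hT, IntegrableOn]

/-- Integration by parts against the primitive of an integrable function. -/
theorem integral_deriv_mul_primitive {a b : ℝ} {η k : ℝ → ℝ} (hη : ContDiff ℝ 1 η)
    (hk : IntervalIntegrable k volume a b) :
    ∫ t in a..b, deriv η t * (∫ r in a..t, k r) =
      η b * (∫ r in a..b, k r) - ∫ t in a..b, η t * k t := by
  have hG := hk.absolutelyContinuousOnInterval_intervalIntegral (c := a) (by simp)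
  have hA : AbsolutelyContinuousOnInterval η a b :=
    hη.contDiffOn.absolutelyContinuousOnInterval
  have h := hA.integral_mul_deriv_eq_deriv_mul hG
  have h' : ∫ t in a..b, η t * deriv (fun x => ∫ r in a..x, k r) t = ∫ t in a..b, η t * k t := by
    apply intervalIntegral.integral_congr_ae
    filter_upwards [hk.ae_hasDerivAt_integral] with t ht hmem
    rw [(ht (uIoc_subset_uIcc hmem) a (by simp)).deriv]
  rw [h'] at h
  simp only [intervalIntegral.integral_same, mul_zero, sub_zero] at h
  linarith

/-- A smooth function with compact support in `(0,T)` and vanishing integral is the derivative of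
a smooth function with compact support in `(0,T)`. -/
theorem exists_primitive_tsupport_subset {T : ℝ} (hT : 0 < T) {g : ℝ → ℝ}
    (hg : ContDiff ℝ (⊤ : ℕ∞) g) (hc : HasCompactSupport g) (hs : tsupport g ⊆ Ioo 0 T)
    (hi : ∫ t, g t = 0) :
    ∃ η : ℝ → ℝ, ContDiff ℝ (⊤ : ℕ∞) η ∧ HasCompactSupport η ∧ tsupport η ⊆ Ioo 0 T ∧
      deriv η = g := by
  set η : ℝ → ℝ := fun t => ∫ r in (0 : ℝ)..t, g r with hηdef
  have hd : ∀ t, HasDerivAt η (g t) t := fun t =>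
    hg.continuous.integral_hasStrictDerivAt 0 t |>.hasDerivAt
  have hderiv : deriv η = g := funext fun t => (hd t).deriv
  obtain ⟨a, b, ha, hb, hab, hsub⟩ : ∃ a b, 0 < a ∧ b < T ∧ a ≤ b ∧ tsupport g ⊆ Icc a b := by
    rcases (tsupport g).eq_empty_or_nonempty with h | h
    · exact ⟨T / 2, T / 2, by linarith, by linarith, le_rfl, by simp [h]⟩
    · have h1 := hc.isCompact.sInf_mem h
      have h2 := hc.isCompact.sSup_mem h
      exact ⟨sInf (tsupport g), sSup (tsupport g), (hs h1).1, (hs h2).2,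
        csInf_le hc.isCompact.bddBelow h2,
        fun x hx => ⟨csInf_le hc.isCompact.bddBelow hx, le_csSup hc.isCompact.bddAbove hx⟩⟩
  have hz : ∀ t, t ∉ Icc a b → g t = 0 := fun t ht =>
    image_eq_zero_of_notMem_tsupport fun h => ht (hsub h)
  -- Left of a, g vanishes between 0 and t; right of b the whole integral of g has been collected,
  -- and it is zero by `hi`.
  have hηz : ∀ t, t ∉ Icc a b → η t = 0 := by
    intro t ht
    rw [mem_Icc, not_and_or, not_le, not_le] at ht
    rcases ht with ht | ht
    · apply intervalIntegral.integral_zero_ae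
      refine Eventually.of_forall fun r hr => hz r fun h => ?_
      rcases le_total 0 t with h0 | h0
      · rw [uIoc_of_le h0] at hr; linarith [hr.2, h.1]
      · rw [uIoc_of_ge h0] at hr; linarith [hr.2, h.1]
    · have h0t : (0 : ℝ) ≤ t := by linarith
      rw [hηdef]
      simp only
      rw [intervalIntegral.integral_of_le h0t, ← hi]
      apply setIntegral_eq_integral_of_forall_compl_eq_zero
      intro r hr
      refine hz r fun h => hr ⟨by linarith [h.1], by linarith [h.2]⟩
  have hts : tsupport η ⊆ Icc a b :=
    closure_minimal (fun t ht => by by_contra h; exact ht (hηz t h)) isClosed_Icc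
  refine ⟨η, ?_, ?_, hts.trans (Icc_subset_Ioo ha hb), hderiv⟩
  · rw [contDiff_infty_iff_deriv, hderiv]
    exact ⟨fun t => (hd t).differentiableAt, hg⟩
  · exact HasCompactSupport.of_support_subset_isCompact isCompact_Icc ((subset_tsupport _).trans hts)

/-- The du Bois-Reymond lemma: a continuous function with zero distributional derivative is
constant. -/
theorem eq_left_of_integral_deriv_mul_eq_zero {T : ℝ} (hT : 0 < T) {d : ℝ → ℝ}
    (hd : ContinuousOn d (Icc 0 T))
    (h : ∀ η : ℝ → ℝ, ContDiff ℝ (⊤ : ℕ∞) η → HasCompactSupport η → tsupport η ⊆ Ioo 0 T →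
      ∫ t, deriv η t * d t ∂(timeMeasure T) = 0) :
    ∀ t ∈ Icc 0 T, d t = d 0 := by
  have hdi : IntegrableOn d (Icc 0 T) := hd.integrableOn_Icc
  have hdo : IntegrableOn d (Ioo 0 T) := hdi.mono_set Ioo_subset_Icc_self
  obtain ⟨θ, hθs, hθc, hθd, hθr, hθ1⟩ := exists_contDiff_tsupport_subset (n := (⊤ : ℕ∞))
    (Ioo_mem_nhds (a := (0 : ℝ)) (b := T) (x := T / 2) (by linarith) (by linarith))
  set m := ∫ t, θ t with hmdef
  have hm : 0 < m := hθd.continuous.integral_pos_of_hasCompactSupport_nonneg_nonzero hθc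
    (fun x => (hθr ⟨x, rfl⟩).1) (x := T / 2) (by rw [hθ1]; norm_num)
  have hint : ∀ g : ℝ → ℝ, ContDiff ℝ (⊤ : ℕ∞) g → Integrable (fun t => g t * d t)
      (timeMeasure T) := by
    intro g hg
    have := (hg.continuous.continuousOn.mul hd).integrableOn_Icc (μ := volume)
    exact this.mono_set Ioo_subset_Icc_self
  -- The θ-weighted mean of d is the candidate for the constant value. For any test function g, the
  -- combination g - (∫g / m) θ has zero integral, hence is some η', and the hypothesis gives ∫ g d
  -- = κ ∫ g.
  set κ := (∫ t, θ t * d t ∂(timeMeasure T)) / m with hκ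
  have key : ∀ g : ℝ → ℝ, ContDiff ℝ (⊤ : ℕ∞) g → HasCompactSupport g → tsupport g ⊆ Ioo 0 T →
      ∫ t, g t * d t ∂(timeMeasure T) = (∫ t, g t) * κ := by
    intro g hg hgc hgs
    set q := (∫ t, g t) / m with hq
    have hqθ : ContDiff ℝ (⊤ : ℕ∞) (fun t => q * θ t) := contDiff_const.mul hθd
    have hts : tsupport (fun t => g t - q * θ t) ⊆ tsupport g ∪ tsupport θ :=
      closure_minimal (fun t ht => by
        by_contra hcon
        rw [mem_union, not_or] at hcon
        apply ht
        simp [image_eq_zero_of_notMem_tsupport hcon.1,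
          image_eq_zero_of_notMem_tsupport hcon.2])
        ((isClosed_tsupport _).union (isClosed_tsupport _))
    have hgi : Integrable g := hg.continuous.integrable_of_hasCompactSupport hgc
    have hθi : Integrable θ := hθd.continuous.integrable_of_hasCompactSupport hθc
    obtain ⟨η, h1, h2, h3, h4⟩ := exists_primitive_tsupport_subset hT (hg.sub hqθ)
      ((hgc.isCompact.union hθc.isCompact).of_isClosed_subset (isClosed_tsupport _) hts)
      (hts.trans (union_subset hgs hθs)) (by
        rw [integral_sub hgi (hθi.const_mul q), integral_const_mul, ← hmdef, hq]
        field_simp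
        simp)
    have := h η h1 h2 h3
    rw [h4] at this
    simp only [sub_mul] at this
    rw [integral_sub (hint g hg) (hint _ hqθ)] at this
    simp only [mul_assoc] at this
    rw [integral_const_mul] at this
    rw [hκ, sub_eq_zero.1 this, hq]
    ring
  have hae : ∀ᵐ t, t ∈ Ioo 0 T → d t - κ = 0 := by
    refine isOpen_Ioo.ae_eq_zero_of_integral_contDiff_smul_eq_zero
      ((hdo.sub (integrableOn_const (by simp))).locallyIntegrableOn) fun g hg hgc hgs => ?_
    have hgi : Integrable g := hg.continuous.integrable_of_hasCompactSupport hgc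
    have hk := key g hg hgc hgs
    have h1 : ∫ t, g t • (d t - κ) = ∫ t, g t • (d t - κ) ∂(timeMeasure T) := by
      refine (setIntegral_eq_integral_of_forall_compl_eq_zero fun t ht => ?_).symm
      rw [image_eq_zero_of_notMem_tsupport fun h => ht (hgs h), zero_smul]
    have h2 : ∫ t, g t ∂(timeMeasure T) = ∫ t, g t := by
      refine setIntegral_eq_integral_of_forall_compl_eq_zero fun t ht => ?_
      rw [image_eq_zero_of_notMem_tsupport fun h => ht (hgs h)]
    rw [h1]
    simp only [smul_eq_mul, mul_sub]
    rw [integral_sub (hint g hg) (hgi.restrict.mul_const κ), hk, integral_mul_const, h2, sub_self]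
  have heq : EqOn d (fun _ => κ) (Icc 0 T) := by
    have hae' : d =ᵐ[volume.restrict (Ioo 0 T)] fun _ => κ := by
      rw [Filter.EventuallyEq, ae_restrict_iff' measurableSet_Ioo]
      filter_upwards [hae] with t ht hmem using sub_eq_zero.1 (ht hmem)
    have h1 : EqOn d (fun _ => κ) (Ioo 0 T) :=
      Measure.eqOn_open_of_ae_eq hae' isOpen_Ioo (hd.mono Ioo_subset_Icc_self) continuousOn_const
    refine h1.of_subset_closure hd continuousOn_const Ioo_subset_Icc_self ?_
    rw [closure_Ioo hT.ne]
  intro t ht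
  rw [heq ht, heq (left_mem_Icc.2 hT.le)]

end Time

/-! ### Abstract test paths -/

section TestPath

variable {V H : Type*} [NormedAddCommGroup V] [InnerProductSpace ℝ V]
  [NormedAddCommGroup H] [InnerProductSpace ℝ H]

/-- The path `Φ ∈ L²((0,T); V)` has the distributional derivative `Φ' ∈ L²((0,T); V*)`, with
respect to the pivot space `H` in which `V` is mapped by `ι`; moreover `Φ` has the continuous
representative `c` in `H`, and `c` vanishes at time `T`. -/
structure IsTestPath (ι : V →L[ℝ] H) (T : ℝ) (Φ : ℝ → V) (Φ' : ℝ → StrongDual ℝ V)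
    (c : ℝ → H) : Prop where
  memLp : MemLp Φ 2 (timeMeasure T)
  deriv_memLp : MemLp Φ' 2 (timeMeasure T)
  deriv_eq : ∀ η : ℝ → ℝ, ContDiff ℝ (⊤ : ℕ∞) η → HasCompactSupport η → tsupport η ⊆ Ioo 0 T →
    ∀ w : V, ∫ t, deriv η t * inner ℝ (ι (Φ t)) (ι w) ∂(timeMeasure T)
      = - ∫ t, η t * Φ' t w ∂(timeMeasure T)
  continuousOn : ContinuousOn c (Icc 0 T)
  ae_eq : ∀ᵐ t ∂(timeMeasure T), c t = ι (Φ t)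
  final : c T = 0

theorem IsTestPath.integrable_deriv_apply {ι : V →L[ℝ] H} {T : ℝ} {Φ : ℝ → V}
    {Φ' : ℝ → StrongDual ℝ V} {c : ℝ → H} (h : IsTestPath ι T Φ Φ' c) (w : V) :
    Integrable (fun t => Φ' t w) (timeMeasure T) := by
  have h1 : Integrable Φ' (timeMeasure T) := h.deriv_memLp.integrable (by norm_num)
  exact (ContinuousLinearMap.apply ℝ ℝ w).integrable_comp h1

/-- The scalar functions `t ↦ ⟪c t, ι w⟫` are the primitives of `t ↦ Φ' t w`. -/
theorem IsTestPath.inner_eq {ι : V →L[ℝ] H} {T : ℝ} (hT : 0 < T) {Φ : ℝ → V}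
    {Φ' : ℝ → StrongDual ℝ V} {c : ℝ → H} (h : IsTestPath ι T Φ Φ' c) (w : V) :
    ∀ t ∈ Icc 0 T, inner ℝ (c t) (ι w) = inner ℝ (c 0) (ι w) + ∫ r in (0 : ℝ)..t, Φ' r w := by
  have hk := (integrable_timeMeasure_iff hT.le).1 (h.integrable_deriv_apply w)
  have hcont : ContinuousOn (fun t => ∫ r in (0 : ℝ)..t, Φ' r w) (Icc 0 T) := by
    have := intervalIntegral.continuousOn_primitive_interval' hk (left_mem_uIcc)
    rwa [uIcc_of_le hT.le] at this
  have hc : ContinuousOn (fun t => inner ℝ (c t) (ι w)) (Icc 0 T) :=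
    h.continuousOn.inner continuousOn_const
  -- The pairing minus the primitive of t ↦ Φ' t w is continuous with zero distributional
  -- derivative, hence constant.
  have key := eq_left_of_integral_deriv_mul_eq_zero hT (hc.sub hcont) ?_
  · intro t ht
    have := key t ht
    simp only [Pi.sub_apply, intervalIntegral.integral_same, sub_zero] at this
    linarith
  · intro η h1 h2 h3
    have hd : Continuous (deriv η) := h1.continuous_deriv (by simp)
    have hi1 : Integrable (fun t => deriv η t * inner ℝ (c t) (ι w)) (timeMeasure T) :=
      ((hd.continuousOn.mul hc).integrableOn_Icc (μ := volume)).mono_set Ioo_subset_Icc_self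
    have hi2 : Integrable (fun t => deriv η t * ∫ r in (0 : ℝ)..t, Φ' r w) (timeMeasure T) :=
      ((hd.continuousOn.mul hcont).integrableOn_Icc (μ := volume)).mono_set Ioo_subset_Icc_self
    simp only [Pi.sub_apply, mul_sub]
    rw [integral_sub hi1 hi2, integral_timeMeasure hT.le (fun t => deriv η t * ∫ r in _..t, _),
      integral_deriv_mul_primitive (h1.of_le (by simp)) hk,
      image_eq_zero_of_notMem_tsupport (f := η) (fun hmem => absurd (h3 hmem).2 (lt_irrefl _))]
    have : ∫ t, deriv η t * inner ℝ (c t) (ι w) ∂(timeMeasure T) =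
        ∫ t, deriv η t * inner ℝ (ι (Φ t)) (ι w) ∂(timeMeasure T) := by
      refine integral_congr_ae ?_
      filter_upwards [h.ae_eq] with t ht
      rw [ht]
    rw [this, h.deriv_eq η h1 h2 h3 w, integral_timeMeasure hT.le (fun t => η t * Φ' t w)]
    ring

end TestPath

/-- Increments of F are dominated by those of G, so the ε-δ condition is inherited. It serves for t
↦ ‖Φ t‖², whose increments are dominated by those of a primitive of 2K‖f‖. -/
theorem _root_.AbsolutelyContinuousOnInterval.of_dist_le {X : Type*} [PseudoMetricSpace X]
    {F : ℝ → X} {G : ℝ → ℝ} {a b : ℝ} (hG : AbsolutelyContinuousOnInterval G a b)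
    (h : ∀ x ∈ uIcc a b, ∀ y ∈ uIcc a b, dist (F x) (F y) ≤ dist (G x) (G y)) :
    AbsolutelyContinuousOnInterval F a b := by
  rw [absolutelyContinuousOnInterval_iff] at hG ⊢
  intro ε hε
  obtain ⟨δ, hδ, hd⟩ := hG ε hε
  refine ⟨δ, hδ, fun E hE hlt => lt_of_le_of_lt (Finset.sum_le_sum fun i hi => ?_) (hd E hE hlt)⟩
  exact h _ (hE.1 i hi).1 _ (hE.1 i hi).2

theorem memLp_timeMeasure_of_continuousOn {E : Type*} [NormedAddCommGroup E]
    {T : ℝ} {f : ℝ → E} (hf : ContinuousOn f (Icc 0 T)) (p : ENNReal) :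
    MemLp f p (timeMeasure T) := by
  obtain ⟨C, hC⟩ := isCompact_Icc.exists_bound_of_continuousOn hf
  refine MemLp.of_bound ((hf.aestronglyMeasurable_of_isCompact isCompact_Icc
    measurableSet_Icc).mono_measure (Measure.restrict_mono Ioo_subset_Icc_self le_rfl)) C ?_
  rw [ae_restrict_iff' measurableSet_Ioo]
  exact Eventually.of_forall fun t ht => hC t (Ioo_subset_Icc_self ht)

theorem integrable_inner_of_memLp_two {α E : Type*} [MeasurableSpace α] {μ : Measure α}
    [NormedAddCommGroup E] [InnerProductSpace ℝ E] {f g : α → E} (hf : MemLp f 2 μ)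
    (hg : MemLp g 2 μ) : Integrable (fun a => inner ℝ (f a) (g a)) μ := by
  refine (L2.integrable_inner (𝕜 := ℝ) (hf.toLp f) (hg.toLp g)).congr ?_
  filter_upwards [hf.coeFn_toLp, hg.coeFn_toLp] with a h1 h2
  rw [h1, h2]

/-! ### Energy inequality for backward primitives -/

section Energy

variable {V : Type*} [NormedAddCommGroup V] [InnerProductSpace ℝ V] [CompleteSpace V]

/-- Energy inequality for a backward primitive `∫_t^T f` in a Hilbert space. -/
theorem energy_backward_primitive {T lam : ℝ} (hT : 0 < T) {f : ℝ → V}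
    (hf : Integrable f) :
    lam / 2 * ∫ t, Real.exp (lam * t) * ‖∫ r in t..T, f r‖ ^ 2 ∂(timeMeasure T) ≤
      ∫ t, Real.exp (lam * t) * inner ℝ (f t) (∫ r in t..T, f r) ∂(timeMeasure T) := by
  set Φ : ℝ → V := fun t => ∫ r in t..T, f r with hΦ
  have hii : ∀ a b, IntervalIntegrable f volume a b := fun a b => hf.intervalIntegrable
  have hΦ' : ∀ t, Φ t = (∫ r in (0 : ℝ)..T, f r) - ∫ r in (0 : ℝ)..t, f r := fun t =>
    (intervalIntegral.integral_interval_sub_left (hii _ _) (hii _ _)).symm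
  have hcont : Continuous Φ := by
    simp only [funext hΦ']
    exact continuous_const.sub (intervalIntegral.continuous_primitive hii 0)
  obtain ⟨K, hK⟩ := isCompact_Icc.exists_bound_of_continuousOn (hcont.continuousOn (s := Icc 0 T))
  have hK0 : 0 ≤ K := (norm_nonneg _).trans (hK 0 (left_mem_Icc.2 hT.le))
  have hg : IntervalIntegrable (fun r => 2 * K * ‖f r‖) volume 0 T :=
    (hf.norm.const_mul _).intervalIntegrable
  have hgi : ∀ a b, IntervalIntegrable (fun r => 2 * K * ‖f r‖) volume a b :=
    fun a b => (hf.norm.const_mul _).intervalIntegrable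
  have hG := hg.absolutelyContinuousOnInterval_intervalIntegral (c := 0) (by simp)
  have hac : AbsolutelyContinuousOnInterval (fun t => ‖Φ t‖ ^ 2) 0 T := by
    refine hG.of_dist_le fun x hx y hy => ?_
    rw [uIcc_of_le hT.le] at hx hy
    rw [Real.dist_eq, Real.dist_eq, intervalIntegral.integral_interval_sub_left (hgi _ _) (hgi _ _)]
    have h1 : ‖Φ x‖ ^ 2 - ‖Φ y‖ ^ 2 = (‖Φ x‖ + ‖Φ y‖) * (‖Φ x‖ - ‖Φ y‖) := by ring
    have h2 : |‖Φ x‖ - ‖Φ y‖| ≤ |∫ r in y..x, ‖f r‖| := by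
      refine (abs_norm_sub_norm_le _ _).trans ?_
      have : Φ x - Φ y = - ∫ r in y..x, f r := by
        rw [hΦ', hΦ', sub_sub_sub_cancel_left,
          intervalIntegral.integral_interval_sub_left (hii _ _) (hii _ _),
          intervalIntegral.integral_symm]
      rw [this, norm_neg]
      exact intervalIntegral.norm_integral_le_abs_integral_norm
    rw [h1, abs_mul, intervalIntegral.integral_const_mul, abs_mul,
      abs_of_nonneg (show 0 ≤ ‖Φ x‖ + ‖Φ y‖ by positivity), abs_of_nonneg (by positivity : 0 ≤ 2 * K)]
    gcongr
    linarith [hK x hx, hK y hy]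
  have hexp : AbsolutelyContinuousOnInterval (fun t : ℝ => Real.exp (lam * t)) 0 T :=
    (ContDiff.contDiffOn (by fun_prop)).absolutelyContinuousOnInterval
  -- Fundamental theorem of calculus for e^{λt}‖Φ(t)‖². Since Φ' = -f almost everywhere, the
  -- derivative is λ e^{λt}‖Φ‖² - 2 e^{λt}⟪f, Φ⟫; since Φ(T) = 0, its integral is -‖Φ(0)‖² ≤ 0.
  have h := hexp.integral_deriv_mul_eq_sub hac
  have hT0 : Φ T = 0 := by simp [hΦ]
  have hd : ∀ t, deriv (fun t : ℝ => Real.exp (lam * t)) t = lam * Real.exp (lam * t) := by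
    intro t
    have : HasDerivAt (fun t : ℝ => Real.exp (lam * t)) (Real.exp (lam * t) * (lam * 1)) t :=
      ((hasDerivAt_id t).const_mul lam).exp
    rw [this.deriv]; ring
  have hie1 : Integrable (fun t => Real.exp (lam * t) * ‖Φ t‖ ^ 2) (timeMeasure T) :=
    (memLp_timeMeasure_of_continuousOn (by fun_prop) 1).integrable le_rfl
  have hie2 : Integrable (fun t => Real.exp (lam * t) * inner ℝ (f t) (Φ t)) (timeMeasure T) := by
    obtain ⟨C, hC⟩ := isCompact_Icc.exists_bound_of_continuousOn
      (by fun_prop : ContinuousOn (fun t => Real.exp (lam * t) • Φ t) (Icc 0 T))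
    refine (hf.norm.restrict.mul_const C).mono'
      (AEStronglyMeasurable.mul (by fun_prop : Continuous fun t =>
        Real.exp (lam * t)).aestronglyMeasurable
        (hf.aestronglyMeasurable.restrict.inner hcont.aestronglyMeasurable)) ?_
    rw [ae_restrict_iff' measurableSet_Ioo]
    refine Eventually.of_forall fun t ht => ?_
    rw [← real_inner_smul_right]
    exact (norm_inner_le_norm _ _).trans
      (mul_le_mul_of_nonneg_left (hC t (Ioo_subset_Icc_self ht)) (norm_nonneg _))
  rw [intervalIntegral.integral_congr_ae (g := fun t => lam * (Real.exp (lam * t) * ‖Φ t‖ ^ 2)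
      - 2 * (Real.exp (lam * t) * inner ℝ (f t) (Φ t))), ← integral_timeMeasure hT.le,
      integral_sub (hie1.const_mul _) (hie2.const_mul _), integral_const_mul,
      integral_const_mul, hT0] at h
  · have : 0 ≤ Real.exp (lam * 0) * ‖Φ 0‖ ^ 2 := by positivity
    simp only [norm_zero, ne_eq, OfNat.ofNat_ne_zero, not_false_eq_true, zero_pow, mul_zero] at h this
    linarith
  · filter_upwards [(hii 0 T).ae_hasDerivAt_integral] with t ht hmem
    have h1 := ht (uIoc_subset_uIcc hmem) 0 (by simp)
    have h2 : HasDerivAt Φ (- f t) t := by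
      have := h1.const_sub (∫ r in (0 : ℝ)..T, f r)
      rwa [← funext hΦ'] at this
    rw [hd, h2.norm_sq.deriv, inner_neg_right, real_inner_comm]
    ring

end Energy

/-! ### Uniqueness by testing with a backward primitive -/

section Uniqueness

variable {V H : Type*} [NormedAddCommGroup V] [InnerProductSpace ℝ V]
  [NormedAddCommGroup H] [InnerProductSpace ℝ H]

/-- The functional `w ↦ ⟪x, ι w⟫` on `V`. -/
def pivot (ι : V →L[ℝ] H) : H →L[ℝ] StrongDual ℝ V :=
  ((ContinuousLinearMap.compL ℝ V H ℝ).flip ι).comp (innerSL ℝ)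

@[simp]
theorem pivot_apply (ι : V →L[ℝ] H) (x : H) (w : V) : pivot ι x w = inner ℝ x (ι w) := rfl

/-- The derivative -f takes values in V, which sits in its dual through `pivot`, and the primitive
vanishes at T. A solution can thus be integrated in time and used as its own test function, although
it is not known to have a derivative or a final value. -/
theorem isTestPath_backward_primitive [CompleteSpace V] (ι : V →L[ℝ] H) {T : ℝ} (hT : 0 < T) {f : ℝ → V}
    (hf : Integrable f) (hf2 : MemLp f 2 (timeMeasure T)) :
    IsTestPath ι T (fun t => ∫ r in t..T, f r) (fun t => - pivot ι (ι (f t)))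
      (fun t => ι (∫ r in t..T, f r)) := by
  have hii : ∀ a b, IntervalIntegrable f volume a b := fun a b => hf.intervalIntegrable
  have hΦ' : ∀ t, ∫ r in t..T, f r = (∫ r in (0 : ℝ)..T, f r) - ∫ r in (0 : ℝ)..t, f r := fun t =>
    (intervalIntegral.integral_interval_sub_left (hii _ _) (hii _ _)).symm
  have hcont : Continuous fun t => ∫ r in t..T, f r := by
    rw [funext hΦ']
    exact continuous_const.sub (intervalIntegral.continuous_primitive hii 0)
  refine ⟨memLp_timeMeasure_of_continuousOn hcont.continuousOn 2,
    ((pivot ι).comp_memLp' (ι.comp_memLp' hf2)).neg, ?_, (ι.continuous.comp hcont).continuousOn,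
    Eventually.of_forall fun t => rfl, by simp⟩
  intro η h1 h2 h3 w
  have hk : ∀ a b, IntervalIntegrable (fun t => inner ℝ (ι (f t)) (ι w)) volume a b := fun a b =>
    ((pivot ι).flip w |>.comp ι |>.integrable_comp hf).intervalIntegrable
  set A := ∫ r in (0 : ℝ)..T, inner ℝ (ι (f r)) (ι w)
  have h4 : ∀ t, inner ℝ (ι (∫ r in t..T, f r)) (ι w) =
      A - ∫ r in (0 : ℝ)..t, inner ℝ (ι (f r)) (ι w) := fun t =>
    ((((pivot ι).flip w).comp ι).intervalIntegral_comp_comm (hii t T)).symm.trans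
      (intervalIntegral.integral_interval_sub_left (hk _ _) (hk _ _)).symm
  have hη0 : η 0 = 0 :=
    image_eq_zero_of_notMem_tsupport fun hmem => absurd (h3 hmem).1 (lt_irrefl _)
  have hηT : η T = 0 :=
    image_eq_zero_of_notMem_tsupport fun hmem => absurd (h3 hmem).2 (lt_irrefl _)
  have hdc : Continuous (deriv η) := h1.continuous_deriv (by simp)
  simp only [h4, mul_sub, integral_timeMeasure hT.le]
  rw [intervalIntegral.integral_sub, integral_deriv_mul_primitive (h1.of_le (by simp)) (hk _ _), hηT,
    intervalIntegral.integral_mul_const, intervalIntegral.integral_deriv_eq_sub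
      (fun t _ => (h1.differentiable (by simp)) t) (hdc.intervalIntegrable _ _), hη0, hηT]
  · simp [intervalIntegral.integral_neg]
  · exact (hdc.intervalIntegrable _ _).mul_const _
  · exact (hdc.mul (intervalIntegral.continuous_primitive hk 0)).intervalIntegrable _ _

/-- Uniqueness for the linear evolution problem: a path in `L²((0,T); V)` solving the weak
equation with zero initial value and a right-hand side dominated by itself vanishes. -/
theorem ae_eq_zero_of_isTestPath_identity [CompleteSpace V] (ι : V →L[ℝ] H) {T : ℝ} (hT : 0 < T)
    {L : ℝ} (hL : 0 ≤ L) {R : ℝ → V} {y : ℝ → H}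
    (hR : MemLp R 2 (timeMeasure T)) (hy : AEStronglyMeasurable y (timeMeasure T))
    (hyR : ∀ᵐ t ∂(timeMeasure T), ‖y t‖ ≤ L * ‖ι (R t)‖)
    (h : ∀ (Φ : ℝ → V) (Φ' : ℝ → StrongDual ℝ V) (c : ℝ → H), IsTestPath ι T Φ Φ' c →
      - ∫ t, Φ' t (R t) ∂(timeMeasure T) + ∫ t, inner ℝ (R t) (Φ t) ∂(timeMeasure T)
        - ∫ t, inner ℝ (y t) (ι (Φ t)) ∂(timeMeasure T) = 0) :
    ∀ᵐ t ∂(timeMeasure T), ι (R t) = 0 := by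
  -- With this λ, Young's inequality bounds ⟪y, ιΦ⟫ by e^{-λt}‖ιR‖²/2 plus exactly the term (λ/2)
  -- e^{λt}‖Φ‖² that the energy inequality provides.
  set lam : ℝ := L ^ 2 * ‖ι‖ ^ 2 with hlam
  have hRi : Integrable R (timeMeasure T) := hR.integrable (by norm_num)
  have hιR : MemLp (fun t => ι (R t)) 2 (timeMeasure T) := ι.comp_memLp' hR
  have hy2 : MemLp y 2 (timeMeasure T) := hιR.of_le_mul hy hyR
  set e : ℝ → ℝ := fun t => Real.exp (-(lam * t)) with he
  have hec : Continuous e := by fun_prop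
  -- The weight makes R = e^{λt} f on (0,T), so that ∫⟪R, Φ⟫ becomes the weighted integral in
  -- `energy_backward_primitive`.
  set f : ℝ → V := (Ioo 0 T).indicator fun t => e t • R t with hf
  have heb : ∀ᵐ t ∂(timeMeasure T), ‖e t‖ ≤ 1 := by
    rw [ae_restrict_iff' measurableSet_Ioo]
    refine Eventually.of_forall fun t ht => ?_
    rw [he, Real.norm_of_nonneg (Real.exp_pos _).le, Real.exp_le_one_iff, neg_nonpos]
    exact mul_nonneg (by positivity) ht.1.le
  have heR : MemLp (fun t => e t • R t) 2 (timeMeasure T) :=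
    hR.of_le_mul (c := 1) (hec.aestronglyMeasurable.smul hR.aestronglyMeasurable) (by
      filter_upwards [heb] with t ht
      rw [norm_smul]
      exact mul_le_mul_of_nonneg_right ht (norm_nonneg _))
  have hfR : f =ᵐ[timeMeasure T] fun t => e t • R t := indicator_ae_eq_restrict measurableSet_Ioo
  have hfi : Integrable f := by
    rw [hf, integrable_indicator_iff measurableSet_Ioo]
    exact heR.integrable (by norm_num)
  have hf2 : MemLp f 2 (timeMeasure T) := heR.ae_eq hfR.symm
  set Φ : ℝ → V := fun t => ∫ r in t..T, f r with hΦ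
  have hP := isTestPath_backward_primitive ι hT hfi hf2
  have hΦ2 : MemLp Φ 2 (timeMeasure T) := hP.memLp
  have key := h _ _ _ hP
  have hen := energy_backward_primitive hT (lam := lam) hfi
  have e1 : ∫ t, (- pivot ι (ι (f t))) (R t) ∂(timeMeasure T) =
      - ∫ t, e t * ‖ι (R t)‖ ^ 2 ∂(timeMeasure T) := by
    rw [← integral_neg]
    refine integral_congr_ae ?_
    filter_upwards [hfR] with t ht
    simp [ht]
  have e2 : ∫ t, Real.exp (lam * t) * inner ℝ (f t) (∫ r in t..T, f r) ∂(timeMeasure T) =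
      ∫ t, inner ℝ (R t) (Φ t) ∂(timeMeasure T) := by
    refine integral_congr_ae ?_
    filter_upwards [hfR] with t ht
    rw [ht, real_inner_smul_left, ← mul_assoc, he, ← Real.exp_add]
    simp [hΦ]
  have i1 : Integrable (fun t => e t * ‖ι (R t)‖ ^ 2) (timeMeasure T) :=
    (hιR.integrable_norm_pow (by norm_num)).bdd_mul hec.aestronglyMeasurable heb
  obtain ⟨K, hK⟩ := isCompact_Icc.exists_bound_of_continuousOn
    (by fun_prop : ContinuousOn (fun t => Real.exp (lam * t)) (Icc 0 T))
  have i2 : Integrable (fun t => Real.exp (lam * t) * ‖Φ t‖ ^ 2) (timeMeasure T) :=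
    (hΦ2.integrable_norm_pow (by norm_num)).bdd_mul
      (by fun_prop : Continuous fun t => Real.exp (lam * t)).aestronglyMeasurable (c := K) (by
        rw [ae_restrict_iff' measurableSet_Ioo]
        exact Eventually.of_forall fun t ht => hK t (Ioo_subset_Icc_self ht))
  have e3 : ∫ t, inner ℝ (y t) (ι (Φ t)) ∂(timeMeasure T) ≤
      ∫ t, (1 / 2 * (e t * ‖ι (R t)‖ ^ 2) + lam / 2 * (Real.exp (lam * t) * ‖Φ t‖ ^ 2))
        ∂(timeMeasure T) := by
    refine integral_mono_ae (integrable_inner_of_memLp_two hy2 (ι.comp_memLp' hΦ2))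
      ((i1.const_mul _).add (i2.const_mul _)) ?_
    filter_upwards [hyR] with t ht
    set x := Real.exp (lam * t / 2) with hx
    have hx0 : 0 < x := Real.exp_pos _
    have hx2 : Real.exp (lam * t) = x ^ 2 := by rw [hx, ← Real.exp_nat_mul]; congr 1; push_cast; ring
    have hxe : e t = (x⁻¹) ^ 2 := by
      rw [he, inv_pow, ← hx2, ← Real.exp_neg]
    have h1 : inner ℝ (y t) (ι (Φ t)) ≤ (L * ‖ι (R t)‖) * (‖ι‖ * ‖Φ t‖) :=
      (real_inner_le_norm _ _).trans (mul_le_mul ht (ι.le_opNorm _) (norm_nonneg _) (by positivity))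
    have h2 : (L * ‖ι (R t)‖) * (‖ι‖ * ‖Φ t‖) =
        (x⁻¹ * ‖ι (R t)‖) * (L * ‖ι‖ * x * ‖Φ t‖) := by
      field_simp
    rw [hx2, hxe, hlam]
    refine h1.trans (h2.trans_le ?_)
    nlinarith [sq_nonneg (x⁻¹ * ‖ι (R t)‖ - L * ‖ι‖ * x * ‖Φ t‖)]
  rw [integral_add (i1.const_mul _) (i2.const_mul _), integral_const_mul, integral_const_mul] at e3
  rw [e1, ← e2] at key
  -- The terms in ‖Φ‖² cancel between `hen` and `e3`, leaving the integral at most half of itself.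
  have hle : ∫ t, e t * ‖ι (R t)‖ ^ 2 ∂(timeMeasure T) ≤ 0 := by linarith
  have hnn : 0 ≤ᵐ[timeMeasure T] fun t => e t * ‖ι (R t)‖ ^ 2 :=
    Eventually.of_forall fun t => mul_nonneg (Real.exp_pos _).le (by positivity)
  have := (integral_eq_zero_iff_of_nonneg_ae hnn i1).1 (le_antisymm hle (integral_nonneg_of_ae hnn))
  filter_upwards [this] with t ht
  simpa [he, (Real.exp_pos _).ne'] using ht

end Uniqueness

/-! ### Weak limits of bounded sequences -/

section WeakCompactness

variable {E : Type*} [NormedAddCommGroup E] [InnerProductSpace ℝ E] [CompleteSpace E]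

/-- Bounded sequences in a Hilbert space converge weakly along a free ultrafilter. -/
theorem exists_weak_limit_hyperfilter {x : ℕ → E} {C : ℝ} (hx : ∀ n, ‖x n‖ ≤ C) :
    ∃ a : E, ∀ g, Tendsto (fun n => inner ℝ (x n) g) (hyperfilter ℕ : Filter ℕ)
      (𝓝 (inner ℝ a g)) := by
  have hb : ∀ g n, |inner ℝ (x n) g| ≤ C * ‖g‖ := fun g n =>
    (abs_real_inner_le_norm _ _).trans (mul_le_mul_of_nonneg_right (hx n) (norm_nonneg _))
  -- Along an ultrafilter every bounded real sequence converges, so one filter serves all g at once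
  -- and no diagonal extraction is needed. The limits are linear and bounded in g, and the Riesz
  -- theorem gives a.
  have hex : ∀ g, ∃ l : ℝ, |l| ≤ C * ‖g‖ ∧
      Tendsto (fun n => inner ℝ (x n) g) (hyperfilter ℕ : Filter ℕ) (𝓝 l) := by
    intro g
    obtain ⟨l, hl, hl'⟩ := (isCompact_Icc (a := -(C * ‖g‖)) (b := C * ‖g‖)).ultrafilter_le_nhds
      ((hyperfilter ℕ).map fun n => inner ℝ (x n) g) (by
        rw [le_principal_iff]
        exact Eventually.of_forall (p := fun n => inner ℝ (x n) g ∈ Icc _ _)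
          fun n => abs_le.1 (hb g n))
    exact ⟨l, abs_le.2 hl, hl'⟩
  choose l hl hlt using hex
  let ℓ : E →ₗ[ℝ] ℝ :=
    { toFun := l
      map_add' := fun a b => tendsto_nhds_unique (hlt (a + b)) (by
        simpa only [inner_add_right] using (hlt a).add (hlt b))
      map_smul' := fun c a => tendsto_nhds_unique (hlt (c • a)) (by
        simpa only [inner_smul_right, RingHom.id_apply, smul_eq_mul] using (hlt a).const_mul c) }
  refine ⟨(InnerProductSpace.toDual ℝ E).symm (ℓ.mkContinuous C hl), fun g => ?_⟩
  rw [InnerProductSpace.toDual_symm_apply]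
  exact hlt g

end WeakCompactness

/-! ### The resolvent by Lax-Milgram -/

section Resolvent

variable {V H : Type*} [NormedAddCommGroup V] [InnerProductSpace ℝ V] [CompleteSpace V]
  [NormedAddCommGroup H] [InnerProductSpace ℝ H]

/-- The adjoint of `ι`. -/
def coPivot (ι : V →L[ℝ] H) : H →L[ℝ] V :=
  LinearMap.mkContinuous
    { toFun := fun f => (InnerProductSpace.toDual ℝ V).symm (pivot ι f)
      map_add' := fun a b => by simp
      map_smul' := fun c a => by simp }
    ‖pivot ι‖ fun f => by
      simpa using (pivot ι).le_opNorm f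

theorem inner_coPivot (ι : V →L[ℝ] H) (f : H) (w : V) :
    inner ℝ (coPivot ι f) w = inner ℝ f (ι w) :=
  InnerProductSpace.toDual_symm_apply

/-- The resolvent `f ↦ u`, `u + h A u = f`, of the operator `A` associated with the inner product
of `V`. -/
theorem exists_resolvent (ι : V →L[ℝ] H) {h : ℝ} (hh : 0 < h) :
    ∃ J : H →L[ℝ] V, ∀ f w,
      inner ℝ (ι (J f)) (ι w) + h * inner ℝ (J f) w = inner ℝ f (ι w) := by
  let B : V →L[ℝ] V →L[ℝ] ℝ := (pivot ι).comp ι + h • pivot (ContinuousLinearMap.id ℝ V)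
  have hB : ∀ v w, B v w = inner ℝ (ι v) (ι w) + h * inner ℝ v w := fun v w => rfl
  have hco : IsCoercive B := ⟨h, hh, fun u => by
    rw [hB, real_inner_self_eq_norm_sq, real_inner_self_eq_norm_sq]
    nlinarith [sq_nonneg ‖ι u‖]⟩
  refine ⟨(hco.continuousLinearEquivOfBilin.symm : V →L[ℝ] V).comp (coPivot ι), fun f w => ?_⟩
  rw [← hB, ← hco.continuousLinearEquivOfBilin_apply]
  simp [inner_coPivot]

end Resolvent

/-! ### Translations in L² of the line -/

section Translation

variable {E : Type*} [NormedAddCommGroup E] [InnerProductSpace ℝ E]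

theorem integral_norm_sq_eq_norm_toLp_sq {α : Type*} [MeasurableSpace α] {μ : Measure α} {f : α → E}
    (hf : MemLp f 2 μ) : ∫ a, ‖f a‖ ^ 2 ∂μ = ‖hf.toLp f‖ ^ 2 := by
  rw [← real_inner_self_eq_norm_sq, L2.inner_def]
  refine integral_congr_ae ?_
  filter_upwards [hf.coeFn_toLp] with a ha
  rw [ha, real_inner_self_eq_norm_sq]

/-- Continuity of translations in `L²(ℝ)`. -/
theorem tendsto_integral_norm_sub_translate_sq {g : ℝ → E} (hg : MemLp g 2 volume) :
    Tendsto (fun σ : ℝ => ∫ t, ‖g (t + σ) - g t‖ ^ 2) (𝓝 0) (𝓝 0) := by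
  have hmp : ∀ σ : ℝ, MeasurePreserving (fun t : ℝ => t + σ) volume volume := fun σ =>
    measurePreserving_add_right volume σ
  let F : ℝ → C(ℝ, ℝ) := fun σ => ⟨fun t => t + σ, by fun_prop⟩
  have hF : Continuous F := by
    apply ContinuousMap.continuous_of_continuous_uncurry
    simp only [F, Function.uncurry_def, ContinuousMap.coe_mk]
    fun_prop
  have hc : Continuous fun σ => Lp.compMeasurePreserving (F σ) (hmp σ) (hg.toLp g) :=
    (continuous_const (y := hg.toLp g)).compMeasurePreservingLp hF hmp (by norm_num)
  have h0 : ∀ σ, ∫ t, ‖g (t + σ) - g t‖ ^ 2 =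
      ‖Lp.compMeasurePreserving (F σ) (hmp σ) (hg.toLp g) - hg.toLp g‖ ^ 2 := by
    intro σ
    have h1 : MemLp (fun t => g (t + σ)) 2 volume := hg.comp_measurePreserving (hmp σ)
    refine (integral_norm_sq_eq_norm_toLp_sq (h1.sub hg)).trans ?_
    rw [MemLp.toLp_sub h1 hg]
    congr 3
  simp only [h0]
  have h2 : Lp.compMeasurePreserving (F 0) (hmp 0) (hg.toLp g) = hg.toLp g := by
    apply Lp.ext
    filter_upwards [Lp.coeFn_compMeasurePreserving (hg.toLp g) (hmp 0)] with t ht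
    refine ht.trans ?_
    simp
  have h3 : Tendsto (fun σ => ‖Lp.compMeasurePreserving (F σ) (hmp σ) (hg.toLp g) - hg.toLp g‖ ^ 2)
      (𝓝 0) (𝓝 (‖Lp.compMeasurePreserving (F 0) (hmp 0) (hg.toLp g) - hg.toLp g‖ ^ 2)) :=
    ((hc.sub continuous_const).norm.pow 2).tendsto 0
  rw [h2] at h3
  simpa using h3

end Translation

/-! ### Difference quotients of primitives -/

section Steklov

variable {E : Type*} [NormedAddCommGroup E] [InnerProductSpace ℝ E]

/-- Justifies Fubini in `exists_steklov_estimate`; the pairing is dominated by (‖g(t+σ)‖² + 1) C. -/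
theorem integrable_inner_translate {T h : ℝ} {g w : ℝ → E} (hgm : StronglyMeasurable g)
    (hg : MemLp g 2 volume) (hw : StronglyMeasurable w) {C : ℝ} (hwC : ∀ t, ‖w t‖ ≤ C) :
    Integrable (fun p : ℝ × ℝ => inner ℝ (g (p.1 + p.2)) (w p.1))
      ((timeMeasure T).prod (volume.restrict (Ioc 0 h))) := by
  have hk : Integrable (fun t => ‖g t‖ ^ 2) := hg.integrable_norm_pow (by norm_num)
  have hC : 0 ≤ C := (norm_nonneg _).trans (hwC 0)
  have hm : StronglyMeasurable fun p : ℝ × ℝ => ‖g (p.1 + p.2)‖ ^ 2 :=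
    (hgm.comp_measurable (by fun_prop : Measurable fun p : ℝ × ℝ => p.1 + p.2)).norm.pow 2
  have h2 : Integrable (fun p : ℝ × ℝ => ‖g (p.1 + p.2)‖ ^ 2)
      ((timeMeasure T).prod (volume.restrict (Ioc 0 h))) := by
    rw [integrable_prod_iff' hm.aestronglyMeasurable]
    refine ⟨Eventually.of_forall fun σ => (hk.comp_add_right σ).restrict, ?_⟩
    refine Integrable.of_bound (C := ∫ t, ‖g t‖ ^ 2)
      (hm.norm.aestronglyMeasurable.prod_swap.integral_prod_right') (Eventually.of_forall fun σ => ?_)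
    rw [Real.norm_of_nonneg (integral_nonneg fun _ => norm_nonneg _),
      ← integral_add_right_eq_self (fun t => ‖g t‖ ^ 2) σ]
    simp only [norm_pow, norm_norm]
    exact setIntegral_le_integral (hk.comp_add_right σ) (Eventually.of_forall fun _ => by positivity)
  refine ((h2.add (integrable_const 1)).mul_const C).mono'
    ((hgm.comp_measurable (by fun_prop : Measurable fun p : ℝ × ℝ => p.1 + p.2)).inner
      (hw.comp_measurable measurable_fst)).aestronglyMeasurable (Eventually.of_forall fun p => ?_)
  refine (norm_inner_le_norm _ _).trans ?_
  refine mul_le_mul ?_ (hwC _) (norm_nonneg _) (by simp only [Pi.add_apply]; positivity)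
  simp only [Pi.add_apply]
  nlinarith [sq_nonneg (‖g (p.1 + p.2)‖ - 1)]

/-- The Steklov averages of `g ∈ L²` converge to `g`, uniformly when paired with bounded sets. -/
theorem exists_steklov_estimate (T : ℝ) {g : ℝ → E} (hgm : StronglyMeasurable g)
    (hg : MemLp g 2 volume) {ε : ℝ} (hε : 0 < ε) :
    ∃ δ > 0, ∀ h, 0 < h → h < δ → ∀ w : ℝ → E, StronglyMeasurable w → (∃ C, ∀ t, ‖w t‖ ≤ C) →
      |∫ t, (∫ r in t..t + h, inner ℝ (g r) (w t)) ∂(timeMeasure T)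
        - h * ∫ t, inner ℝ (g t) (w t) ∂(timeMeasure T)| ≤
        ε * (1 + ∫ t, ‖w t‖ ^ 2 ∂(timeMeasure T)) * h := by
  obtain ⟨δ, hδ, hd⟩ := Metric.tendsto_nhds_nhds.1 (tendsto_integral_norm_sub_translate_sq hg)
    (ε ^ 2) (by positivity)
  refine ⟨δ, hδ, fun h hh hhδ w hw ⟨C, hwC⟩ => ?_⟩
  have hC : 0 ≤ C := (norm_nonneg _).trans (hwC 0)
  have hw2 : MemLp w 2 (timeMeasure T) :=
    MemLp.of_bound hw.aestronglyMeasurable C (Eventually.of_forall hwC)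
  have hσ : ∀ σ, MemLp (fun t => g (t + σ)) 2 volume := fun σ =>
    hg.comp_measurePreserving (measurePreserving_add_right volume σ)
  have hi := integrable_inner_translate (T := T) (h := h) hgm hg hw hwC
  -- Substituting r = t + σ turns the window integral into an integral over the shifts σ ∈ (0,h),
  -- each compared separately with the unshifted pairing.
  have e1 : ∫ t, (∫ r in t..t + h, inner ℝ (g r) (w t)) ∂(timeMeasure T) =
      ∫ σ in (0 : ℝ)..h, ∫ t, inner ℝ (g (t + σ)) (w t) ∂(timeMeasure T) := by
    rw [intervalIntegral.integral_of_le hh.le, ← integral_integral_swap hi]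
    refine integral_congr_ae (Eventually.of_forall fun t => ?_)
    simp only
    rw [← intervalIntegral.integral_of_le hh.le,
      intervalIntegral.integral_comp_add_left (fun r => inner ℝ (g r) (w t)) t, add_zero]
  have e2 : h * ∫ t, inner ℝ (g t) (w t) ∂(timeMeasure T) =
      ∫ σ in (0 : ℝ)..h, ∫ t, inner ℝ (g t) (w t) ∂(timeMeasure T) := by
    simp
  have hii : IntervalIntegrable (fun σ => ∫ t, inner ℝ (g (t + σ)) (w t) ∂(timeMeasure T))
      volume 0 h := by
    rw [intervalIntegrable_iff_integrableOn_Ioc_of_le hh.le]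
    exact hi.integral_prod_right
  rw [e1, e2, ← intervalIntegral.integral_sub hii (by simp)]
  have key : ∀ σ ∈ uIoc (0 : ℝ) h, ‖(∫ t, inner ℝ (g (t + σ)) (w t) ∂(timeMeasure T))
      - ∫ t, inner ℝ (g t) (w t) ∂(timeMeasure T)‖ ≤
        ε * (1 + ∫ t, ‖w t‖ ^ 2 ∂(timeMeasure T)) := by
    intro σ hσ'
    rw [uIoc_of_le hh.le] at hσ'
    have hdσ := hd (x := σ) (by
      rw [Real.dist_eq, sub_zero, abs_of_pos hσ'.1]; linarith [hσ'.2])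
    rw [Real.dist_eq, sub_zero, abs_of_nonneg (integral_nonneg fun _ => by positivity)] at hdσ
    have hsub : MemLp (fun t => g (t + σ) - g t) 2 volume := (hσ σ).sub hg
    rw [← integral_sub (integrable_inner_of_memLp_two ((hσ σ).restrict _) hw2)
      (integrable_inner_of_memLp_two (hg.restrict _) hw2)]
    have hs2 : Integrable (fun t => ‖g (t + σ) - g t‖ ^ 2) := hsub.integrable_norm_pow (by norm_num)
    have hw2' : Integrable (fun t => ‖w t‖ ^ 2) (timeMeasure T) :=
      hw2.integrable_norm_pow (by norm_num)
    -- Young's inequality with weights ε⁻¹ and ε. The translation error was made smaller than ε², so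
    -- its share is at most ε, uniformly in w.
    calc _ ≤ ∫ t, (ε⁻¹ * ‖g (t + σ) - g t‖ ^ 2 + ε * ‖w t‖ ^ 2) ∂(timeMeasure T) := by
          refine norm_integral_le_of_norm_le ((hs2.restrict.const_mul _).add (hw2'.const_mul _))
            (Eventually.of_forall fun t => ?_)
          rw [← inner_sub_left]
          refine (norm_inner_le_norm _ _).trans ?_
          have h1 : ε⁻¹ * ‖g (t + σ) - g t‖ ^ 2 + ε * ‖w t‖ ^ 2 - ‖g (t + σ) - g t‖ * ‖w t‖ =
            ε⁻¹ * ((‖g (t + σ) - g t‖ - ε * ‖w t‖ / 2) ^ 2 + 3 / 4 * (ε * ‖w t‖) ^ 2) := by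
            field_simp; ring
          have h2 : 0 ≤ ε⁻¹ * ((‖g (t + σ) - g t‖ - ε * ‖w t‖ / 2) ^ 2 +
            3 / 4 * (ε * ‖w t‖) ^ 2) := by positivity
          linarith
      _ = ε⁻¹ * ∫ t, ‖g (t + σ) - g t‖ ^ 2 ∂(timeMeasure T) +
          ε * ∫ t, ‖w t‖ ^ 2 ∂(timeMeasure T) := by
          rw [integral_add (hs2.restrict.const_mul _) (hw2'.const_mul _), integral_const_mul,
            integral_const_mul]
      _ ≤ ε⁻¹ * ε ^ 2 + ε * ∫ t, ‖w t‖ ^ 2 ∂(timeMeasure T) := by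
          gcongr
          exact (setIntegral_le_integral hs2 (Eventually.of_forall fun _ => by positivity)).trans
            hdσ.le
      _ = ε * (1 + ∫ t, ‖w t‖ ^ 2 ∂(timeMeasure T)) := by
          field_simp
  have := intervalIntegral.norm_integral_le_of_norm_le_const key
  rwa [sub_zero, abs_of_pos hh, Real.norm_eq_abs] at this

end Steklov

/-! ### The semi-implicit Euler scheme -/

section Euler

variable {V H : Type*} [NormedAddCommGroup V] [InnerProductSpace ℝ V] [CompleteSpace V]
  [NormedAddCommGroup H] [InnerProductSpace ℝ H]

/-- The map (x, t) ↦ M t x is a Carathéodory function, continuous in x and measurable in t, hence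
jointly measurable when H is second countable. -/
theorem stronglyMeasurable_operator_apply [SecondCountableTopology H] {F : Type*}
    [NormedAddCommGroup F] [NormedSpace ℝ F]
    {M : ℝ → H →L[ℝ] F} (hM : ∀ x, StronglyMeasurable fun t => M t x) {f : ℝ → H}
    (hf : StronglyMeasurable f) : StronglyMeasurable fun t => M t (f t) := by
  borelize H
  exact (stronglyMeasurable_uncurry_of_continuous_of_stronglyMeasurable
    (u := fun x t => M t x) (fun t => (M t).continuous) hM).comp_measurable
      (hf.measurable.prodMk measurable_id)

/-- The semi-implicit Euler scheme with a continuous time variable. -/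
theorem exists_euler_path [SecondCountableTopology H] (ι : V →L[ℝ] H) {T h : ℝ} (hh : 0 < h)
    {n : ℕ} (hn : n * h = T)
    {M : ℝ → H →L[ℝ] H} (hM : ∀ x, StronglyMeasurable fun t => M t x) {L : ℝ} (hL : 0 ≤ L)
    {S : ℝ → Set H}
    (hSM : ∀ r f t, f ∈ S r → f + h • M t f ∈ S ((1 + h * L) * r))
    (hSmono : ∀ r r' f, 0 ≤ r → r ≤ r' → f ∈ S r → f ∈ S r')
    (hSJ : ∀ r f v, 0 ≤ r → f ∈ S r →
      (∀ w, inner ℝ (ι v) (ι w) + h * inner ℝ v w = inner ℝ f (ι w)) → ι v ∈ S r)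
    {K : ℝ} (hSK : ∀ r f, f ∈ S r → ‖f‖ ≤ K * r) {r : ℝ} (hr : 0 ≤ r) {u₀ : H} (hu₀ : u₀ ∈ S r) :
    ∃ (u : ℝ → H) (w : ℝ → V), StronglyMeasurable u ∧ StronglyMeasurable w ∧
      (∀ t ≤ 0, u t = u₀) ∧ (∀ t ∈ Ioc 0 T, u t = ι (w t)) ∧
      (∀ t, u t ∈ S ((1 + h * L) ^ n * r)) ∧
      (∀ t ∈ Ioc 0 T, ∀ z, inner ℝ (u t - u (t - h)) (ι z) + h * inner ℝ (w t) z =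
        h * inner ℝ (M t (u (t - h))) (ι z)) ∧
      ∃ C, ∀ t, ‖w t‖ ≤ C := by
  obtain ⟨J, hJ⟩ := exists_resolvent ι hh
  -- Picard iterates of the delay equation u(t) = ι J(u(t-h) + h M(t) u(t-h)): implicit in A,
  -- explicit in M, with history u₀ for t ≤ 0.
  let U : ℕ → ℝ → H := fun k => Nat.rec (fun _ => u₀)
    (fun _ f t => if t ≤ 0 then u₀ else ι (J (f (t - h) + h • M t (f (t - h))))) k
  have hU0 : ∀ t, U 0 t = u₀ := fun t => rfl
  have hUs : ∀ k t, U (k + 1) t =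
    if t ≤ 0 then u₀ else ι (J (U k (t - h) + h • M t (U k (t - h)))) := fun k t => rfl
  have hstep : ∀ {f : ℝ → H}, StronglyMeasurable f →
      StronglyMeasurable fun t => J (f (t - h) + h • M t (f (t - h))) := by
    intro f hf
    have h1 : StronglyMeasurable fun t => f (t - h) :=
      hf.comp_measurable (by fun_prop : Measurable fun t : ℝ => t - h)
    exact J.continuous.comp_stronglyMeasurable
      (h1.add ((stronglyMeasurable_operator_apply hM h1).const_smul h))
  have hUm : ∀ k, StronglyMeasurable (U k) := by
    intro k
    induction k with
    | zero => exact stronglyMeasurable_const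
    | succ k ih =>
      exact StronglyMeasurable.ite measurableSet_Iic stronglyMeasurable_const
        (ι.continuous.comp_stronglyMeasurable (hstep ih))
  have hle1 : ∀ k : ℕ, 1 ≤ (1 + h * L) ^ k := fun k =>
    one_le_pow₀ (by linarith [mul_nonneg hh.le hL])
  have hmonok : ∀ k, ∀ f, f ∈ S r → f ∈ S ((1 + h * L) ^ k * r) := fun k f =>
    hSmono _ _ f hr (le_mul_of_one_le_left hr (hle1 k))
  have hUS : ∀ k t, U k t ∈ S ((1 + h * L) ^ k * r) := by
    intro k
    induction k with
    | zero => intro t; simpa [hU0] using hu₀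
    | succ k ih =>
      intro t
      rw [hUs]
      split_ifs with ht
      · exact hmonok _ _ hu₀
      · refine hSJ _ _ _ (mul_nonneg (zero_le_one.trans (hle1 _)) hr) ?_ (hJ _)
        have := hSM _ _ t (ih (t - h))
        rwa [← mul_assoc, ← pow_succ'] at this
  -- Computing an iterate at t only uses the previous one at t - h, so the iterates stabilise over
  -- one more window of length h at each step. Since n h = T, `U n` is a fixed point up to time T.
  have hUstab : ∀ k : ℕ, ∀ t ≤ k * h, U (k + 1) t = U k t := by
    intro k
    induction k with
    | zero =>
      intro t ht
      rw [hUs, if_pos (by simpa using ht)]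
      rfl
    | succ k ih =>
      intro t ht
      rw [hUs (k + 1), ih (t - h) (by push_cast at ht; linarith), ← hUs k]
  -- One further application of J, before ι, provides the V-valued lift w of u on (0,T].
  refine ⟨U n, fun t => J (U n (t - h) + h • M t (U n (t - h))), hUm n, hstep (hUm n), ?_, ?_,
    hUS n, ?_, ?_⟩
  · intro t ht
    cases n with
    | zero => rfl
    | succ k => rw [hUs, if_pos ht]
  · intro t ht
    rw [← hUstab n t (by rw [hn]; exact ht.2), hUs, if_neg (not_le.2 ht.1)]
  · intro t ht z
    rw [← hUstab n t (by rw [hn]; exact ht.2), hUs, if_neg (not_le.2 ht.1), inner_sub_left,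
      sub_add_eq_add_sub, hJ, inner_add_left, real_inner_smul_left]
    ring
  · refine ⟨‖J‖ * (K * ((1 + h * L) * ((1 + h * L) ^ n * r))), fun t => ?_⟩
    exact J.le_opNorm_of_le (hSK _ _ (hSM _ _ t (hUS n (t - h))))

end Euler

theorem abs_integral_inner_le {α E : Type*} [MeasurableSpace α] {μ : Measure α}
    [NormedAddCommGroup E] [InnerProductSpace ℝ E] {f g : α → E} (hf : MemLp f 2 μ)
    (hg : MemLp g 2 μ) : |∫ a, inner ℝ (f a) (g a) ∂μ| ≤
      √(∫ a, ‖f a‖ ^ 2 ∂μ) * √(∫ a, ‖g a‖ ^ 2 ∂μ) := by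
  rw [integral_norm_sq_eq_norm_toLp_sq hf, integral_norm_sq_eq_norm_toLp_sq hg,
    Real.sqrt_sq (norm_nonneg _), Real.sqrt_sq (norm_nonneg _)]
  refine le_trans (le_of_eq ?_) (abs_real_inner_le_norm (hf.toLp f) (hg.toLp g))
  rw [L2.inner_def]
  congr 1
  refine integral_congr_ae ?_
  filter_upwards [hf.coeFn_toLp, hg.coeFn_toLp] with a h1 h2
  rw [h1, h2]

/-! ### Energy estimate and weak identity for the scheme -/

section EulerEstimates

variable {V H : Type*} [NormedAddCommGroup V] [InnerProductSpace ℝ V]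
  [NormedAddCommGroup H] [InnerProductSpace ℝ H]

/-- The scheme is tested with w(t) itself, using 2⟪a - b, a⟫ = ‖a‖² - ‖b‖² + ‖a - b‖². After
integration the difference of ‖u(t-h)‖² and ‖u(t)‖² reduces to the end windows (-h,0) and (T-h,T);
the second has a good sign and the first costs h K². The bound on increments later allows u(t-h) to
be replaced by u(t). -/
theorem euler_energy (ι : V →L[ℝ] H) {T h : ℝ} (hT : 0 < T) (hh : 0 < h)
    {M : ℝ → H →L[ℝ] H} {L : ℝ} (hML : ∀ t, ‖M t‖ ≤ L)
    {u : ℝ → H} {w : ℝ → V} (hu : StronglyMeasurable u) (hw : StronglyMeasurable w)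
    (huw : ∀ t ∈ Ioc 0 T, u t = ι (w t)) {K : ℝ} (hK : ∀ t, ‖u t‖ ≤ K) (hC : ∃ C, ∀ t, ‖w t‖ ≤ C)
    (hid : ∀ t ∈ Ioc 0 T, ∀ z, inner ℝ (u t - u (t - h)) (ι z) + h * inner ℝ (w t) z =
        h * inner ℝ (M t (u (t - h))) (ι z)) :
    ∫ t, ‖w t‖ ^ 2 ∂(timeMeasure T) ≤ K ^ 2 * (1 / 2 + L * T) ∧
      ∫ t, ‖u t - u (t - h)‖ ^ 2 ∂(timeMeasure T) ≤ h * (K ^ 2 * (1 + 2 * L * T)) := by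
  obtain ⟨C, hC⟩ := hC
  have hK0 : 0 ≤ K := (norm_nonneg _).trans (hK 0)
  have hL0 : 0 ≤ L := (norm_nonneg _).trans (hML 0)
  have hp : StronglyMeasurable fun t => u (t - h) :=
    hu.comp_measurable (by fun_prop : Measurable fun t : ℝ => t - h)
  have hsq : ∀ {x : ℝ → H}, StronglyMeasurable x → (∀ t, ‖x t‖ ≤ K) → ∀ a b : ℝ,
      IntervalIntegrable (fun t => ‖x t‖ ^ 2) volume a b := by
    intro x hx hxK a b
    rw [intervalIntegrable_iff, uIoc]
    exact Integrable.of_bound (hx.norm.pow 2).aestronglyMeasurable (K ^ 2)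
      (Eventually.of_forall fun t => by
        rw [Real.norm_of_nonneg (by positivity)]
        exact pow_le_pow_left₀ (norm_nonneg _) (hxK t) 2)
  have iu := (integrable_timeMeasure_iff hT.le).2 (hsq hu hK 0 T)
  have ip := (integrable_timeMeasure_iff hT.le).2 (hsq hp (fun t => hK _) 0 T)
  have iw : Integrable (fun t => ‖w t‖ ^ 2) (timeMeasure T) :=
    (MemLp.of_bound hw.aestronglyMeasurable C (Eventually.of_forall hC) :
      MemLp w 2 (timeMeasure T)).integrable_norm_pow (by norm_num)
  have id : Integrable (fun t => ‖u t - u (t - h)‖ ^ 2) (timeMeasure T) :=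
    (MemLp.of_bound (hu.sub hp).aestronglyMeasurable (K + K) (Eventually.of_forall fun t =>
      (norm_sub_le _ _).trans (add_le_add (hK _) (hK _))) :
      MemLp (fun t => u t - u (t - h)) 2 (timeMeasure T)).integrable_norm_pow (by norm_num)
  have hpt : ∀ t ∈ Ioc 0 T, h * ‖w t‖ ^ 2 + 1 / 2 * ‖u t - u (t - h)‖ ^ 2 ≤
      1 / 2 * (‖u (t - h)‖ ^ 2 - ‖u t‖ ^ 2) + h * L * K ^ 2 := by
    intro t ht
    have h1 := hid t ht (w t)
    rw [← huw t ht, real_inner_self_eq_norm_sq] at h1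
    have h2 : inner ℝ (u t - u (t - h)) (u t) =
        1 / 2 * (‖u t‖ ^ 2 - ‖u (t - h)‖ ^ 2 + ‖u t - u (t - h)‖ ^ 2) := by
      rw [norm_sub_sq_real, inner_sub_left, real_inner_self_eq_norm_sq,
        real_inner_comm]
      ring
    have h3 : inner ℝ (M t (u (t - h))) (u t) ≤ L * K * K :=
      (real_inner_le_norm _ _).trans (mul_le_mul ((M t).le_of_opNorm_le_of_le (hML t) (hK _))
        (hK _) (norm_nonneg _) (by positivity))
    have h4 := mul_le_mul_of_nonneg_left h3 hh.le
    rw [h2] at h1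
    nlinarith
  have hshift : ∫ t, ‖u (t - h)‖ ^ 2 ∂(timeMeasure T) - ∫ t, ‖u t‖ ^ 2 ∂(timeMeasure T) ≤
      h * K ^ 2 := by
    rw [integral_timeMeasure hT.le, integral_timeMeasure hT.le,
      intervalIntegral.integral_comp_sub_right (fun t => ‖u t‖ ^ 2), zero_sub,
      ← intervalIntegral.integral_add_adjacent_intervals (hsq hu hK (-h) 0) (hsq hu hK 0 (T - h)),
      ← intervalIntegral.integral_add_adjacent_intervals (hsq hu hK 0 (T - h)) (hsq hu hK (T - h) T)]
    have h1 : 0 ≤ ∫ t in (T - h)..T, ‖u t‖ ^ 2 :=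
      intervalIntegral.integral_nonneg (by linarith) fun _ _ => by positivity
    have h2 : ∫ t in (-h)..0, ‖u t‖ ^ 2 ≤ ∫ t in (-h)..0, K ^ 2 :=
      intervalIntegral.integral_mono_on (by linarith) (hsq hu hK _ _) (by simp) fun t _ =>
        pow_le_pow_left₀ (norm_nonneg _) (hK t) 2
    simp only [intervalIntegral.integral_const, smul_eq_mul, sub_neg_eq_add, zero_add] at h2
    linarith
  have isub : Integrable (fun t => ‖u (t - h)‖ ^ 2 - ‖u t‖ ^ 2) (timeMeasure T) := ip.sub iu
  have hmain : h * ∫ t, ‖w t‖ ^ 2 ∂(timeMeasure T) +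
      1 / 2 * ∫ t, ‖u t - u (t - h)‖ ^ 2 ∂(timeMeasure T) ≤
      1 / 2 * (∫ t, ‖u (t - h)‖ ^ 2 ∂(timeMeasure T) - ∫ t, ‖u t‖ ^ 2 ∂(timeMeasure T)) +
        T * (h * L * K ^ 2) := by
    have hconst : ∫ t, h * L * K ^ 2 ∂(timeMeasure T) = T * (h * L * K ^ 2) := by
      rw [integral_timeMeasure hT.le]; simp; ring
    rw [← hconst, ← integral_const_mul, ← integral_const_mul, ← integral_sub ip iu,
      ← integral_const_mul, ← integral_add (iw.const_mul _) (id.const_mul _),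
      ← integral_add (isub.const_mul _) (integrable_const _)]
    refine integral_mono_ae ((iw.const_mul _).add (id.const_mul _))
      ((isub.const_mul _).add (integrable_const _)) ?_
    rw [Filter.EventuallyLE, ae_restrict_iff' measurableSet_Ioo]
    exact Eventually.of_forall fun t ht => hpt t (Ioo_subset_Ioc_self ht)
  have nw : 0 ≤ ∫ t, ‖w t‖ ^ 2 ∂(timeMeasure T) := integral_nonneg fun _ => by positivity
  have nd : 0 ≤ ∫ t, ‖u t - u (t - h)‖ ^ 2 ∂(timeMeasure T) :=
    integral_nonneg fun _ => by positivity
  constructor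
  · refine le_of_mul_le_mul_left ?_ hh
    nlinarith
  · nlinarith [mul_nonneg hh.le nw]

/-- The continuous representative of a test path, extended to `ℝ` by constants. -/
theorem IsTestPath.exists_extension [CompleteSpace V] {ι : V →L[ℝ] H} {T : ℝ} (hT : 0 < T)
    {Φ : ℝ → V} {Φ' : ℝ → StrongDual ℝ V} {c : ℝ → H} (h : IsTestPath ι T Φ Φ' c) :
    ∃ (b : ℝ → H) (g : ℝ → V), Continuous b ∧ (∀ t ∈ Icc 0 T, b t = c t) ∧ (∀ t, T ≤ t → b t = 0) ∧
      StronglyMeasurable g ∧ MemLp g 2 volume ∧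
      (∀ᵐ t ∂(timeMeasure T), ∀ z, Φ' t z = inner ℝ (g t) z) ∧
      ∀ z t τ, 0 ≤ t → 0 ≤ τ → inner ℝ (b τ - b t) (ι z) = ∫ r in t..τ, inner ℝ (g r) z := by
  -- The extension to times beyond T is needed because the scheme is paired with b(t + h). Past T
  -- both b and the Riesz representative g of the derivative are zero, so b stays a primitive of g
  -- on [0,∞).
  let D : StrongDual ℝ V → V := (InnerProductSpace.toDual ℝ V).symm
  have hD : MemLp (fun t => D (Φ' t)) 2 (timeMeasure T) := by
    refine h.deriv_memLp.of_le ((InnerProductSpace.toDual ℝ V).symm.continuous.comp_aestronglyMeasurable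
      h.deriv_memLp.aestronglyMeasurable) (Eventually.of_forall fun t => ?_)
    exact ((InnerProductSpace.toDual ℝ V).symm.norm_map _).le
  have hI : MemLp ((Ioo 0 T).indicator fun t => D (Φ' t)) 2 volume :=
    (memLp_indicator_iff_restrict measurableSet_Ioo).2 hD
  set g := hI.aestronglyMeasurable.mk with hg
  have hgI : ((Ioo 0 T).indicator fun t => D (Φ' t)) =ᵐ[volume] g := hI.aestronglyMeasurable.ae_eq_mk
  have hg2 : MemLp g 2 volume := hI.ae_eq hgI
  set b : ℝ → H := IccExtend hT.le ((Icc 0 T).domRestrict c) with hb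
  have hbc : Continuous b := h.continuousOn.domRestrict.Icc_extend'
  have hbe : ∀ t ∈ Icc 0 T, b t = c t := fun t ht => by
    rw [hb, IccExtend_of_mem _ _ ht]; rfl
  have hbT : ∀ t, T ≤ t → b t = 0 := fun t ht => by
    rw [hb, IccExtend_of_right_le _ _ ht]; exact h.final
  have hgi : ∀ z a b, IntervalIntegrable (fun r => inner ℝ (g r) z) volume a b := fun z a b => by
    rw [intervalIntegrable_iff, uIoc]
    exact ((hg2.restrict _).integrable (by norm_num)).inner_const z
  have hgΦ : ∀ᵐ t, t ∈ Ioo 0 T → ∀ z, Φ' t z = inner ℝ (g t) z := by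
    filter_upwards [hgI] with t ht hmem z
    rw [← ht, indicator_of_mem hmem]
    exact InnerProductSpace.toDual_symm_apply.symm
  have hg0 : ∀ᵐ t, t ∉ Ioo 0 T → g t = 0 := by
    filter_upwards [hgI] with t ht hmem
    rw [← ht, indicator_of_notMem hmem]
  have h1 : ∀ z, ∀ t ∈ Icc 0 T, inner ℝ (b t) (ι z) =
      inner ℝ (c 0) (ι z) + ∫ r in (0 : ℝ)..t, inner ℝ (g r) z := by
    intro z t ht
    rw [hbe t ht, h.inner_eq hT z t ht]
    congr 1
    apply intervalIntegral.integral_congr_ae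
    have hne : ∀ᵐ r : ℝ, r ≠ T := by simp [ae_iff, measure_singleton]
    filter_upwards [hgΦ, hne] with r hr hrT hmem
    rw [uIoc_of_le ht.1] at hmem
    exact hr ⟨hmem.1, lt_of_le_of_ne (hmem.2.trans ht.2) hrT⟩ z
  have h2 : ∀ z t, 0 ≤ t → inner ℝ (b t) (ι z) =
      inner ℝ (c 0) (ι z) + ∫ r in (0 : ℝ)..t, inner ℝ (g r) z := by
    intro z t ht
    rcases le_total t T with htT | htT
    · exact h1 z t ⟨ht, htT⟩
    · have h3 : ∫ r in T..t, inner ℝ (g r) z = 0 := by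
        apply intervalIntegral.integral_zero_ae
        filter_upwards [hg0] with r hr hmem
        rw [uIoc_of_le htT] at hmem
        rw [hr fun hmem' => absurd hmem'.2 (not_lt.2 hmem.1.le), inner_zero_left]
      rw [hbT t htT, ← intervalIntegral.integral_add_adjacent_intervals (hgi z 0 T) (hgi z T t), h3,
        add_zero, ← h1 z T (right_mem_Icc.2 hT.le), hbT T le_rfl]
  refine ⟨b, g, hbc, hbe, hbT, hI.aestronglyMeasurable.stronglyMeasurable_mk, hg2, ?_, ?_⟩
  · rw [ae_restrict_iff' measurableSet_Ioo]
    exact hgΦ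
  · intro z t τ ht hτ
    rw [inner_sub_left, h2 z t ht, h2 z τ hτ,
      ← intervalIntegral.integral_interval_sub_left (hgi z 0 τ) (hgi z 0 t)]
    ring

/-- The Euler scheme tested with a test path, after a discrete integration by parts. -/
theorem euler_identity (ι : V →L[ℝ] H) {T h : ℝ} (hT : 0 < T) (hh : 0 < h)
    {M : ℝ → H →L[ℝ] H} {L : ℝ} (hML : ∀ t, ‖M t‖ ≤ L)
    {u : ℝ → H} {w : ℝ → V} (hu : StronglyMeasurable u) (hw : StronglyMeasurable w)
    (hMu : StronglyMeasurable fun t => M t (u (t - h)))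
    {u₀ : H} (hu0 : ∀ t ≤ 0, u t = u₀)
    (huw : ∀ t ∈ Ioc 0 T, u t = ι (w t)) {K : ℝ} (hK : ∀ t, ‖u t‖ ≤ K) (hC : ∃ C, ∀ t, ‖w t‖ ≤ C)
    (hid : ∀ t ∈ Ioc 0 T, ∀ z, inner ℝ (u t - u (t - h)) (ι z) + h * inner ℝ (w t) z =
        h * inner ℝ (M t (u (t - h))) (ι z))
    {Φ : ℝ → V} (hΦ : MemLp Φ 2 (timeMeasure T)) {b : ℝ → H} {g : ℝ → V} (hb : Continuous b)
    (hbΦ : ∀ᵐ t ∂(timeMeasure T), b t = ι (Φ t)) (hbT : ∀ t, T ≤ t → b t = 0)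
    (hbg : ∀ z t τ, 0 ≤ t → 0 ≤ τ → inner ℝ (b τ - b t) (ι z) = ∫ r in t..τ, inner ℝ (g r) z) :
    - (∫ t, (∫ r in t..t + h, inner ℝ (g r) (w t)) ∂(timeMeasure T))
      - (∫ t in (0 : ℝ)..h, inner ℝ u₀ (b t)) + h * ∫ t, inner ℝ (w t) (Φ t) ∂(timeMeasure T) =
      h * ∫ t, inner ℝ (M t (u (t - h))) (ι (Φ t)) ∂(timeMeasure T) := by
  obtain ⟨C, hC⟩ := hC
  have hp : StronglyMeasurable fun t => u (t - h) :=
    hu.comp_measurable (by fun_prop : Measurable fun t : ℝ => t - h)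
  have hub : ∀ {x : ℝ → H}, StronglyMeasurable x → (∀ t, ‖x t‖ ≤ K) → ∀ {y : ℝ → H}, Continuous y →
      ∀ p q, IntervalIntegrable (fun t => inner ℝ (x t) (y t)) volume p q := by
    intro x hx hxK y hy p q
    rw [intervalIntegrable_iff]
    have h1 : IntegrableOn (fun t => K * ‖y t‖) (uIoc p q) :=
      intervalIntegrable_iff.1 ((continuous_const.mul hy.norm).intervalIntegrable p q)
    refine h1.mono' (hx.aestronglyMeasurable.inner hy.aestronglyMeasurable)
      (Eventually.of_forall fun t => (norm_inner_le_norm _ _).trans ?_)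
    exact mul_le_mul_of_nonneg_right (hxK t) (norm_nonneg _)
  have hbh : Continuous fun t => b (t + h) := hb.comp (by fun_prop)
  have iwΦ : Integrable (fun t => inner ℝ (w t) (Φ t)) (timeMeasure T) :=
    integrable_inner_of_memLp_two (MemLp.of_bound hw.aestronglyMeasurable C
      (Eventually.of_forall hC)) hΦ
  have iMΦ : Integrable (fun t => inner ℝ (M t (u (t - h))) (ι (Φ t))) (timeMeasure T) :=
    integrable_inner_of_memLp_two (MemLp.of_bound hMu.aestronglyMeasurable (L * K)
      (Eventually.of_forall fun t => (M t).le_of_opNorm_le_of_le (hML t) (hK _))) (ι.comp_memLp' hΦ)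
  have iub : Integrable (fun t => inner ℝ (u t) (b t)) (timeMeasure T) :=
    (integrable_timeMeasure_iff hT.le).2 (hub hu hK hb 0 T)
  have ipb : Integrable (fun t => inner ℝ (u (t - h)) (b t)) (timeMeasure T) :=
    (integrable_timeMeasure_iff hT.le).2 (hub hp (fun t => hK _) hb 0 T)
  have isub : Integrable (fun t => inner ℝ (u t) (b t) - inner ℝ (u (t - h)) (b t))
      (timeMeasure T) := iub.sub ipb
  have e1 : ∫ t, inner ℝ (u t) (b t) ∂(timeMeasure T) - ∫ t, inner ℝ (u (t - h)) (b t) ∂(timeMeasure T)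
      + h * ∫ t, inner ℝ (w t) (Φ t) ∂(timeMeasure T) =
      h * ∫ t, inner ℝ (M t (u (t - h))) (ι (Φ t)) ∂(timeMeasure T) := by
    rw [← integral_sub iub ipb, ← integral_const_mul, ← integral_const_mul,
      ← integral_add isub (iwΦ.const_mul _)]
    refine integral_congr_ae ?_
    filter_upwards [hbΦ, ae_restrict_mem measurableSet_Ioo] with t ht hmem
    simp only [← hid t (Ioo_subset_Ioc_self hmem), inner_sub_left, ht]
  -- Shifting the variable moves the delay from u to b. The window (-h,0) yields the initial datum,
  -- and the window (T-h,T) contributes nothing because b vanishes after T.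
  have e2 : ∫ t, inner ℝ (u (t - h)) (b t) ∂(timeMeasure T) =
      (∫ t in (0 : ℝ)..h, inner ℝ u₀ (b t)) + ∫ t, inner ℝ (u t) (b (t + h)) ∂(timeMeasure T) := by
    rw [integral_timeMeasure hT.le, integral_timeMeasure hT.le]
    have h1 : ∫ t in (0 : ℝ)..T, inner ℝ (u (t - h)) (b t) =
        ∫ t in (-h)..(T - h), inner ℝ (u t) (b (t + h)) := by
      rw [← zero_sub, ← intervalIntegral.integral_comp_sub_right
        (fun t => inner ℝ (u t) (b (t + h)))]
      simp
    have h2 : ∫ t in (T - h)..T, inner ℝ (u t) (b (t + h)) = 0 := by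
      apply intervalIntegral.integral_zero_ae
      refine Eventually.of_forall fun t ht => ?_
      rw [uIoc_of_le (by linarith)] at ht
      rw [hbT _ (by linarith [ht.1]), inner_zero_right]
    have h3 : ∫ t in (-h)..0, inner ℝ (u t) (b (t + h)) = ∫ t in (0 : ℝ)..h, inner ℝ u₀ (b t) := by
      have : ∫ t in (0 : ℝ)..h, inner ℝ u₀ (b t) = ∫ t in (-h)..0, inner ℝ u₀ (b (t + h)) := by
        rw [intervalIntegral.integral_comp_add_right (fun t => inner ℝ u₀ (b t))]
        simp
      rw [this]
      refine intervalIntegral.integral_congr fun t ht => ?_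
      rw [uIcc_of_le (by linarith)] at ht
      simp only [hu0 t ht.2]
    rw [h1, ← intervalIntegral.integral_add_adjacent_intervals (hub hu hK hbh (-h) 0)
      (hub hu hK hbh 0 (T - h)), h3, ← intervalIntegral.integral_add_adjacent_intervals
      (hub hu hK hbh 0 (T - h)) (hub hu hK hbh (T - h) T), h2, add_zero]
  have e3 : ∫ t, (∫ r in t..t + h, inner ℝ (g r) (w t)) ∂(timeMeasure T) =
      ∫ t, inner ℝ (u t) (b (t + h)) ∂(timeMeasure T) - ∫ t, inner ℝ (u t) (b t) ∂(timeMeasure T) := by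
    rw [← integral_sub ((integrable_timeMeasure_iff hT.le).2 (hub hu hK hbh 0 T)) iub]
    refine integral_congr_ae ?_
    filter_upwards [ae_restrict_mem measurableSet_Ioo] with t hmem
    rw [← hbg (w t) t (t + h) hmem.1.le (by linarith [hmem.1]), ← inner_sub_right,
      huw t (Ioo_subset_Ioc_self hmem), real_inner_comm]
  rw [e3, ← e1, e2]
  ring

end EulerEstimates

/-! ### Passage to the limit in the scheme -/

section Existence

variable {V H : Type*} [NormedAddCommGroup V] [InnerProductSpace ℝ V] [CompleteSpace V]
  [NormedAddCommGroup H] [InnerProductSpace ℝ H]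

/-- Existence for the linear evolution problem, with the invariant region `S` of the Euler scheme
inherited in the form of linear inequalities. -/
theorem exists_solution_isTestPath_identity [SecondCountableTopology H] (ι : V →L[ℝ] H) {T : ℝ}
    (hT : 0 < T) {M : ℝ → H →L[ℝ] H} (hM : ∀ x, StronglyMeasurable fun t => M t x)
    (hMsymm : ∀ t x y, inner ℝ (M t x) y = inner ℝ x (M t y))
    {L : ℝ} (hL : 0 ≤ L) (hML : ∀ t, ‖M t‖ ≤ L) {S : ℝ → Set H}
    (hSM : ∀ h r f t, 0 < h → f ∈ S r → f + h • M t f ∈ S ((1 + h * L) * r))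
    (hSmono : ∀ r r' f, 0 ≤ r → r ≤ r' → f ∈ S r → f ∈ S r')
    (hSJ : ∀ h r f v, 0 < h → 0 ≤ r → f ∈ S r →
      (∀ w, inner ℝ (ι v) (ι w) + h * inner ℝ v w = inner ℝ f (ι w)) → ι v ∈ S r)
    {K : ℝ} (hSK : ∀ r f, f ∈ S r → ‖f‖ ≤ K * r) {r : ℝ} (hr : 0 ≤ r)
    {u₀ : H} (hu₀ : u₀ ∈ S r) :
    ∃ R : ℝ → V, MemLp R 2 (timeMeasure T) ∧
      (∀ (Φ : ℝ → V) (Φ' : ℝ → StrongDual ℝ V) (c : ℝ → H), IsTestPath ι T Φ Φ' c →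
        - ∫ t, Φ' t (R t) ∂(timeMeasure T) + ∫ t, inner ℝ (R t) (Φ t) ∂(timeMeasure T)
          - ∫ t, inner ℝ (M t (ι (R t))) (ι (Φ t)) ∂(timeMeasure T) = inner ℝ u₀ (c 0)) ∧
      ∀ (G : ℝ → H) (κ : ℝ), MemLp G 2 (timeMeasure T) →
        (∀ f : ℝ → H, AEStronglyMeasurable f (timeMeasure T) →
          (∀ᵐ t ∂(timeMeasure T), f t ∈ S (Real.exp (L * T) * r)) →
          ∫ t, inner ℝ (f t) (G t) ∂(timeMeasure T) ≤ κ) →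
        ∫ t, inner ℝ (ι (R t)) (G t) ∂(timeMeasure T) ≤ κ := by
  -- With n + 1 steps the step size is defined for every n and divides T exactly.
  set h : ℕ → ℝ := fun n => T / (n + 1) with hh
  have hpos : ∀ n, 0 < h n := fun n => by positivity
  have hlim0 : Tendsto h atTop (𝓝 0) := by
    have := (tendsto_one_div_add_atTop_nhds_zero_nat (𝕜 := ℝ)).const_mul T
    simpa [hh, div_eq_mul_inv] using this
  have hexp : ∀ n, (1 + h n * L) ^ (n + 1) ≤ Real.exp (L * T) := by
    intro n
    calc (1 + h n * L) ^ (n + 1) ≤ (Real.exp (h n * L)) ^ (n + 1) := by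
          have : 0 ≤ h n * L := mul_nonneg (hpos n).le hL
          gcongr
          linarith [Real.add_one_le_exp (h n * L)]
      _ = Real.exp (L * T) := by
          rw [← Real.exp_nat_mul]
          congr 1
          simp only [hh]
          push_cast
          field_simp
  have hbase : ∀ n, 0 ≤ (1 + h n * L) ^ (n + 1) * r := fun n => by
    have := mul_nonneg (hpos n).le hL
    positivity
  have hex := fun n => exists_euler_path ι (hpos n) (n := n + 1) (T := T)
    (by simp only [hh]; push_cast; field_simp) hM hL (fun r f t => hSM (h n) r f t (hpos n)) hSmono
    (fun r f v => hSJ (h n) r f v (hpos n)) hSK hr hu₀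
  choose u w hu hw hu0 huw huS hid hC using hex
  set rT := Real.exp (L * T) * r with hrT
  have huS' : ∀ n t, u n t ∈ S rT := fun n t =>
    hSmono _ _ _ (hbase n) (mul_le_mul_of_nonneg_right (hexp n) hr) (huS n t)
  have huK : ∀ n t, ‖u n t‖ ≤ K * rT := fun n t => hSK _ _ (huS' n t)
  have hen := fun n => euler_energy ι hT (hpos n) hML (hu n) (hw n) (huw n) (huK n) (hC n) (hid n)
  set A := (K * rT) ^ 2 * (1 / 2 + L * T) with hA
  have hA0 : 0 ≤ A := by positivity
  have hw2 : ∀ n, MemLp (w n) 2 (timeMeasure T) := fun n => by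
    obtain ⟨C, hC⟩ := hC n
    exact MemLp.of_bound (hw n).aestronglyMeasurable C (Eventually.of_forall hC)
  obtain ⟨R, hR⟩ := exists_weak_limit_hyperfilter (x := fun n => (hw2 n).toLp (w n)) (C := √A)
    (fun n => Real.le_sqrt_of_sq_le (by
      rw [← integral_norm_sq_eq_norm_toLp_sq]; exact (hen n).1))
  have hR2 : MemLp R 2 (timeMeasure T) := Lp.memLp R
  have hlim : ∀ g : ℝ → V, MemLp g 2 (timeMeasure T) →
      Tendsto (fun n => ∫ t, inner ℝ (w n t) (g t) ∂(timeMeasure T)) (hyperfilter ℕ : Filter ℕ)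
        (𝓝 (∫ t, inner ℝ (R t) (g t) ∂(timeMeasure T))) := by
    intro g hg
    have h1 := hR (hg.toLp g)
    have h2 : inner ℝ R (hg.toLp g) = ∫ t, inner ℝ (R t) (g t) ∂(timeMeasure T) := by
      rw [L2.inner_def]
      refine integral_congr_ae ?_
      filter_upwards [hg.coeFn_toLp] with t ht
      rw [ht]
    have h3 : ∀ n, inner ℝ ((hw2 n).toLp (w n)) (hg.toLp g) =
        ∫ t, inner ℝ (w n t) (g t) ∂(timeMeasure T) := by
      intro n
      rw [L2.inner_def]
      refine integral_congr_ae ?_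
      filter_upwards [hg.coeFn_toLp, (hw2 n).coeFn_toLp] with t ht ht'
      rw [ht, ht']
    simpa only [h2, h3] using h1
  have hle : (hyperfilter ℕ : Filter ℕ) ≤ atTop := Nat.hyperfilter_le_atTop
  have huwae : ∀ n, ∀ᵐ t ∂(timeMeasure T), u n t = ι (w n t) := fun n => by
    filter_upwards [ae_restrict_mem measurableSet_Ioo] with t ht
    exact huw n t (Ioo_subset_Ioc_self ht)
  refine ⟨R, hR2, ?_, ?_⟩
  · intro Φ Φ' c hΦ
    obtain ⟨b, g, hb, hbc, hbT, hgm, hg2, hgΦ, hbg⟩ := hΦ.exists_extension hT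
    have hbΦ : ∀ᵐ t ∂(timeMeasure T), b t = ι (Φ t) := by
      filter_upwards [hΦ.ae_eq, ae_restrict_mem measurableSet_Ioo] with t ht hmem
      rw [hbc t (Ioo_subset_Icc_self hmem), ht]
    have hp : ∀ n, StronglyMeasurable fun t => u n (t - h n) := fun n =>
      (hu n).comp_measurable (by fun_prop : Measurable fun t : ℝ => t - h n)
    have hMp : ∀ n, StronglyMeasurable fun t => M t (u n (t - h n)) := fun n =>
      stronglyMeasurable_operator_apply hM (hp n)
    have hident := fun n => euler_identity ι hT (hpos n) hML (hu n) (hw n) (hMp n) (hu0 n) (huw n)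
      (huK n) (hC n) (hid n) hΦ.memLp hb hbΦ hbT hbg
    -- the difference quotient of the test path
    have l1 : Tendsto (fun n => (h n)⁻¹ *
        ∫ t, (∫ r in t..t + h n, inner ℝ (g r) (w n t)) ∂(timeMeasure T))
        (hyperfilter ℕ : Filter ℕ) (𝓝 (∫ t, Φ' t (R t) ∂(timeMeasure T))) := by
      have e1 : ∫ t, Φ' t (R t) ∂(timeMeasure T) = ∫ t, inner ℝ (R t) (g t) ∂(timeMeasure T) := by
        refine integral_congr_ae ?_
        filter_upwards [hgΦ] with t ht
        rw [ht, real_inner_comm]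
      rw [e1]
      -- Both factors vary with n and w n converges only weakly; hence the need for an estimate
      -- uniform over paths of bounded L² norm.
      have hdiff : Tendsto (fun n => (h n)⁻¹ *
          (∫ t, (∫ r in t..t + h n, inner ℝ (g r) (w n t)) ∂(timeMeasure T)) -
            ∫ t, inner ℝ (w n t) (g t) ∂(timeMeasure T)) atTop (𝓝 0) := by
        rw [Metric.tendsto_atTop]
        intro ε hε
        -- The estimate carries the factor 1 + ∫‖w n‖² ≤ 1 + A, so this tolerance leaves an error of
        -- at most ε/2.
        obtain ⟨δ, hδ, hst⟩ := exists_steklov_estimate T hgm hg2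
          (show 0 < ε / (2 * (1 + A)) by positivity)
        obtain ⟨N, hN⟩ := Metric.tendsto_atTop.1 hlim0 δ hδ
        refine ⟨N, fun n hn => ?_⟩
        have h1 := hN n hn
        rw [Real.dist_eq, sub_zero, abs_of_pos (hpos n)] at h1
        have h2 := hst (h n) (hpos n) h1 (w n) (hw n) (hC n)
        rw [Real.dist_eq, sub_zero]
        simp only [real_inner_comm (g _)] at h2 ⊢
        have h3 : ∀ a c : ℝ, (h n)⁻¹ * a - c = (h n)⁻¹ * (a - h n * c) := fun a c => by
          have := (hpos n).ne'
          field_simp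
        rw [h3, abs_mul, abs_of_pos (inv_pos.2 (hpos n)), inv_mul_lt_iff₀ (hpos n)]
        refine h2.trans_lt ?_
        have h4 : ε / (2 * (1 + A)) * (1 + ∫ t, ‖w n t‖ ^ 2 ∂(timeMeasure T)) ≤
            ε / (2 * (1 + A)) * (1 + A) := by
          gcongr
          exact (hen n).1
        have h5 : ε / (2 * (1 + A)) * (1 + A) = ε / 2 := by field_simp
        rw [mul_comm (h n)]
        refine mul_lt_mul_of_pos_right ?_ (hpos n)
        linarith
      have := (hdiff.mono_left hle).add (hlim g (hg2.restrict _))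
      simpa using this
    have l2 : Tendsto (fun n => (h n)⁻¹ * ∫ t in (0 : ℝ)..h n, inner ℝ u₀ (b t))
        (hyperfilter ℕ : Filter ℕ) (𝓝 (inner ℝ u₀ (c 0))) := by
      have hcb : Continuous fun t => inner ℝ u₀ (b t) := continuous_const.inner hb
      have hd := (hcb.integral_hasStrictDerivAt 0 0).hasDerivAt.tendsto_slope_zero
      rw [hbc 0 (left_mem_Icc.2 hT.le)] at hd
      have h1 : Tendsto h (hyperfilter ℕ : Filter ℕ) (𝓝[≠] 0) :=
        tendsto_nhdsWithin_iff.2 ⟨hlim0.mono_left hle,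
          Eventually.of_forall fun n => (hpos n).ne'⟩
      simpa [Function.comp_def] using hd.comp h1
    have hMΦ : MemLp (fun t => M t (ι (Φ t))) 2 (timeMeasure T) := by
      have hιΦ : MemLp (fun t => ι (Φ t)) 2 (timeMeasure T) := ι.comp_memLp' hΦ.memLp
      have hbΦ' : (fun t => M t (b t)) =ᵐ[timeMeasure T] fun t => M t (ι (Φ t)) := by
        filter_upwards [hbΦ] with t ht
        rw [ht]
      refine hιΦ.of_le_mul (c := L) ((stronglyMeasurable_operator_apply hM
        hb.stronglyMeasurable).aestronglyMeasurable.congr hbΦ') (Eventually.of_forall fun t => ?_)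
      exact (M t).le_of_opNorm_le (hML t) _
    have l4 : Tendsto (fun n => ∫ t, inner ℝ (M t (u n (t - h n))) (ι (Φ t)) ∂(timeMeasure T))
        (hyperfilter ℕ : Filter ℕ)
        (𝓝 (∫ t, inner ℝ (M t (ι (R t))) (ι (Φ t)) ∂(timeMeasure T))) := by
      have hco : MemLp (fun t => coPivot ι (M t (ι (Φ t)))) 2 (timeMeasure T) :=
        (coPivot ι).comp_memLp' hMΦ
      have e1 : ∀ x t, inner ℝ (M t (ι x)) (ι (Φ t)) =
          inner ℝ x (coPivot ι (M t (ι (Φ t)))) := fun x t => by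
        rw [hMsymm, real_inner_comm, ← inner_coPivot, real_inner_comm]
      simp only [e1]
      have hd2 : ∀ n, MemLp (fun t => u n (t - h n) - u n t) 2 (timeMeasure T) := fun n =>
        MemLp.of_bound ((hp n).sub (hu n)).aestronglyMeasurable (K * rT + K * rT)
          (Eventually.of_forall fun t => (norm_sub_le _ _).trans (add_le_add (huK n _) (huK n _)))
      -- The delayed value is split into the increment, which tends to zero strongly by
      -- `euler_energy`, and ι(w n t), which is paired with a fixed path once M and ι have been
      -- moved to the test side.
      have e2 : ∀ n, ∫ t, inner ℝ (M t (u n (t - h n))) (ι (Φ t)) ∂(timeMeasure T) =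
          ∫ t, inner ℝ (u n (t - h n) - u n t) (M t (ι (Φ t))) ∂(timeMeasure T) +
          ∫ t, inner ℝ (w n t) (coPivot ι (M t (ι (Φ t)))) ∂(timeMeasure T) := by
        intro n
        rw [← integral_add (integrable_inner_of_memLp_two (hd2 n) hMΦ)
          (integrable_inner_of_memLp_two (hw2 n) hco)]
        refine integral_congr_ae ?_
        filter_upwards [huwae n] with t ht
        rw [← e1, ← ht, hMsymm, hMsymm, ← inner_add_left, sub_add_cancel]
      simp only [e2]
      have l5 : Tendsto (fun n => ∫ t, inner ℝ (u n (t - h n) - u n t) (M t (ι (Φ t)))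
          ∂(timeMeasure T)) atTop (𝓝 0) := by
        refine squeeze_zero_norm (a := fun n => √(h n * ((K * rT) ^ 2 * (1 + 2 * L * T))) *
          √(∫ t, ‖M t (ι (Φ t))‖ ^ 2 ∂(timeMeasure T))) (fun n => ?_) ?_
        · refine (abs_integral_inner_le (hd2 n) hMΦ).trans ?_
          gcongr
          simp only [norm_sub_rev (u n (_ - h n))]
          exact (hen n).2
        · have := ((Real.continuous_sqrt.tendsto 0).comp (by
            simpa using hlim0.mul_const ((K * rT) ^ 2 * (1 + 2 * L * T)))).mul_const
              (√(∫ t, ‖M t (ι (Φ t))‖ ^ 2 ∂(timeMeasure T)))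
          simpa [Function.comp_def] using this
      simpa using (l5.mono_left hle).add (hlim _ hco)
    have l3 := hlim Φ hΦ.memLp
    have hfin : ∀ n, - ((h n)⁻¹ *
          ∫ t, (∫ r in t..t + h n, inner ℝ (g r) (w n t)) ∂(timeMeasure T)) -
          (h n)⁻¹ * (∫ t in (0 : ℝ)..h n, inner ℝ u₀ (b t)) +
          ∫ t, inner ℝ (w n t) (Φ t) ∂(timeMeasure T) =
        ∫ t, inner ℝ (M t (u n (t - h n))) (ι (Φ t)) ∂(timeMeasure T) := by
      intro n
      have h1 := hident n
      have h2 := (hpos n).ne'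
      field_simp
      linarith
    have hl := ((l1.neg.sub l2).add l3)
    simp only [hfin] at hl
    have := tendsto_nhds_unique hl l4
    linarith
  -- Each Euler path takes values in the invariant region, so it satisfies the inequality, and a
  -- single linear inequality is stable under weak convergence.
  · intro G κ hG hGκ
    have hco : MemLp (fun t => coPivot ι (G t)) 2 (timeMeasure T) := (coPivot ι).comp_memLp' hG
    have e1 : ∀ x t, inner ℝ (ι x) (G t) = inner ℝ x (coPivot ι (G t)) := fun x t => by
      rw [real_inner_comm, ← inner_coPivot, real_inner_comm]
    simp only [e1]
    refine le_of_tendsto (hlim _ hco) (Eventually.of_forall fun n => ?_)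
    simp only [← e1]
    refine hGκ _ (ι.continuous.comp_aestronglyMeasurable (hw n).aestronglyMeasurable) ?_
    filter_upwards [huwae n] with t ht
    rw [← ht]
    exact huS' n t

end Existence

theorem norm_sq_eq_integral_sq {N : ℕ} (f : Lp ℝ 2 (volume : Measure (Sp N))) :
    ‖f‖ ^ 2 = ∫ x, f x ^ 2 := by
  rw [← real_inner_self_eq_norm_sq, L2.inner_def]
  simp [pow_two]

/-! ### Poincaré inequality and completeness of the fractional Sobolev space -/

namespace HZero

variable {N : ℕ} {s : Ioo (0 : ℝ) 1} {Ω : Set (Sp N)}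

theorem ae_eq_zero (u : HZero s Ω) : ∀ᵐ x, x ∉ Ω → toL2 u x = 0 := u.2.2

theorem norm_sq_eq [NeZero N] (u : HZero s Ω) : ‖u‖ ^ 2 = fracConst N s / 2 *
    ∫ p, gagliardoKernel s (toL2 u) (toL2 u) p ∂((volume : Measure (Sp N)).prod volume) := by
  rw [← real_inner_self_eq_norm_sq, inner_eq]
  rfl

/-- Constructor of elements of `H_0^s(Ω)` from functions. -/
theorem exists_of_memLp {f : Sp N → ℝ} (hf : MemLp f 2 volume)
    (hk : Integrable (gagliardoKernel s f f) ((volume : Measure (Sp N)).prod volume))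
    (h0 : ∀ᵐ x, x ∉ Ω → f x = 0) : ∃ u : HZero s Ω, toL2 u =ᵐ[volume] f := by
  refine ⟨⟨hf.toLp f, ?_, ?_⟩, hf.coeFn_toLp⟩
  · exact hk.congr (gagliardoKernel_congr s hf.coeFn_toLp.symm hf.coeFn_toLp.symm)
  · filter_upwards [hf.coeFn_toLp, h0] with x hx h hmem
    rw [hx, h hmem]

/-- The fractional Poincaré inequality on bounded sets. -/
theorem exists_poincare [NeZero N] (hΩ : Bornology.IsBounded Ω) :
    ∃ C, ∀ u : HZero s Ω, ‖toL2 u‖ ≤ C * ‖u‖ := by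
  obtain ⟨r, hr0, hr⟩ : ∃ r : ℝ, 0 < r ∧ Ω ⊆ Metric.ball 0 r := by
    obtain ⟨r, hr⟩ := hΩ.subset_ball 0
    exact ⟨max r 1, by positivity, hr.trans (Metric.ball_subset_ball (le_max_left _ _))⟩
  have : Nonempty (Fin N) := ⟨⟨0, Nat.pos_of_ne_zero (NeZero.ne N)⟩⟩
  obtain ⟨x₀, hx₀⟩ := exists_norm_eq (Sp N) (show 0 ≤ r + 1 by positivity)
  -- A unit ball outside the ball of radius r that contains Ω. Every u vanishes on B, so for y ∈ B
  -- and ‖x‖ < r the kernel is u(x)²/|x-y|^e, with |x-y| ≤ 2r + 2. Integrating over this part alone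
  -- already controls the L² norm.
  set B := Metric.ball x₀ 1 with hB
  set e : ℝ := (N : ℝ) + 2 * s with he
  have he0 : 0 < e := by have := s.2.1; positivity
  set D := (2 * r + 2) ^ e with hD
  have hD0 : 0 < D := Real.rpow_pos_of_pos (by positivity) _
  have hBv : 0 < (volume : Measure (Sp N)).real B :=
    ENNReal.toReal_pos (Metric.measure_ball_pos _ _ one_pos).ne' measure_ball_lt_top.ne
  have hBr : ∀ y ∈ B, r < ‖y‖ ∧ ‖y‖ < r + 2 := by
    intro y hy
    rw [hB, mem_ball_iff_norm] at hy
    have h1 := norm_sub_norm_le x₀ y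
    have h2 := norm_sub_norm_le y x₀
    rw [norm_sub_rev] at h1
    constructor <;> linarith
  have hC := fracConst_pos (N := N) s
  set k := fracConst N s / 2 * (volume.real B / D) with hk
  have hk0 : 0 < k := by positivity
  have key : ∀ u : HZero s Ω, k * ‖toL2 u‖ ^ 2 ≤ ‖u‖ ^ 2 := by
    intro u
    rw [norm_sq_eq_integral_sq, norm_sq_eq, hk, mul_assoc]
    refine mul_le_mul_of_nonneg_left ?_ (by positivity)
    have hprod : ∫ p : Sp N × Sp N, toL2 u p.1 ^ 2 * B.indicator (fun _ => 1 / D) p.2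
        ∂((volume : Measure (Sp N)).prod volume) = (∫ x, toL2 u x ^ 2) * (volume.real B / D) := by
      rw [integral_prod_mul (fun x => toL2 u x ^ 2) (B.indicator fun _ => 1 / D),
        integral_indicator measurableSet_ball, setIntegral_const, smul_eq_mul, mul_one_div]
    rw [mul_comm, ← hprod]
    have i1 : Integrable (fun x => toL2 u x ^ 2) := (Lp.memLp (toL2 u)).integrable_sq
    have i2 : Integrable (B.indicator fun _ : Sp N => 1 / D) := by
      rw [integrable_indicator_iff measurableSet_ball]
      exact integrableOn_const measure_ball_lt_top.ne
    refine integral_mono_ae (i1.mul_prod i2) u.integrable_self ?_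
    have q1 := Measure.quasiMeasurePreserving_fst
      (μ := (volume : Measure (Sp N))) (ν := (volume : Measure (Sp N)))
    have q2 := Measure.quasiMeasurePreserving_snd
      (μ := (volume : Measure (Sp N))) (ν := (volume : Measure (Sp N)))
    filter_upwards [q1.ae u.ae_eq_zero, q2.ae u.ae_eq_zero] with p h1 h2
    by_cases hp1 : p.1 ∈ Metric.ball (0 : Sp N) r
    · by_cases hp2 : p.2 ∈ B
      · have h3 := hBr _ hp2
        rw [mem_ball_zero_iff] at hp1
        have h4 : toL2 u p.2 = 0 := h2 fun hmem => by
          have := hr hmem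
          rw [mem_ball_zero_iff] at this
          linarith
        have h5 : ‖p.1 - p.2‖ ≤ 2 * r + 2 := (norm_sub_le _ _).trans (by linarith)
        have h6 : 0 < ‖p.1 - p.2‖ := by
          rw [norm_pos_iff, sub_ne_zero]
          intro h
          rw [h] at hp1
          linarith
        rw [indicator_of_mem hp2, gagliardoKernel, h4, sub_zero, ← pow_two, mul_one_div]
        exact div_le_div_of_nonneg_left (sq_nonneg _) (Real.rpow_pos_of_pos h6 _)
          (Real.rpow_le_rpow h6.le h5 he0.le)
      · rw [indicator_of_notMem hp2, mul_zero]
        exact gagliardoKernel_self_nonneg _ _ _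
    · rw [h1 fun hmem => hp1 (hr hmem)]
      simp only [ne_eq, OfNat.ofNat_ne_zero, not_false_eq_true, zero_pow, zero_mul]
      exact gagliardoKernel_self_nonneg _ _ _
  refine ⟨√(1 / k), fun u => ?_⟩
  rw [← Real.sqrt_sq (norm_nonneg u), ← Real.sqrt_mul (by positivity)]
  refine Real.le_sqrt_of_sq_le ?_
  rw [one_div, ← div_eq_inv_mul, le_div_iff₀ hk0, mul_comm]
  exact key u

/-- The difference quotients of order `s`, whose square is the Gagliardo kernel. -/
def diffQuot (s : ℝ) (u : Sp N → ℝ) (p : Sp N × Sp N) : ℝ :=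
  (u p.1 - u p.2) / ‖p.1 - p.2‖ ^ (((N : ℝ) + 2 * s) / 2)

theorem diffQuot_sq (s : ℝ) (u : Sp N → ℝ) (p : Sp N × Sp N) :
    diffQuot s u p ^ 2 = gagliardoKernel s u u p := by
  have : (‖p.1 - p.2‖ ^ (((N : ℝ) + 2 * s) / 2)) ^ 2 = ‖p.1 - p.2‖ ^ ((N : ℝ) + 2 * s) := by
    rw [← Real.rpow_natCast, ← Real.rpow_mul (norm_nonneg _)]
    congr 1
    push_cast
    ring
  rw [diffQuot, div_pow, this, gagliardoKernel, pow_two]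

theorem aestronglyMeasurable_diffQuot (s : ℝ) {u : Sp N → ℝ}
    (hu : AEStronglyMeasurable u volume) :
    AEStronglyMeasurable (diffQuot s u) ((volume : Measure (Sp N)).prod volume) := by
  have m : AEStronglyMeasurable
      (fun p : Sp N × Sp N => (‖p.1 - p.2‖ ^ (((N : ℝ) + 2 * s) / 2))⁻¹)
      ((volume : Measure (Sp N)).prod volume) := by
    apply Measurable.aestronglyMeasurable
    fun_prop
  exact (((hu.comp_fst (ν := volume)).sub (hu.comp_snd (μ := volume))).mul m).congr
    (Filter.Eventually.of_forall fun p => by simp [diffQuot, div_eq_mul_inv])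

theorem memLp_diffQuot (u : HZero s Ω) :
    MemLp (diffQuot s (toL2 u)) 2 ((volume : Measure (Sp N)).prod volume) := by
  rw [memLp_two_iff_integrable_sq (aestronglyMeasurable_diffQuot _ u.aesm)]
  simpa only [diffQuot_sq] using u.integrable_self

/-- Up to a constant factor, the difference quotient embeds V isometrically in L²(ℝ^N × ℝ^N);
completeness becomes closedness of the range. -/
theorem norm_toLp_diffQuot_sub_sq [NeZero N] (u w : HZero s Ω) :
    ‖u - w‖ ^ 2 = fracConst N s / 2 *
      ‖u.memLp_diffQuot.toLp - w.memLp_diffQuot.toLp‖ ^ 2 := by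
  rw [norm_sq_eq, ← MemLp.toLp_sub, ← integral_norm_sq_eq_norm_toLp_sq]
  congr 1
  refine integral_congr_ae ?_
  have h : (toL2 (u - w) : Sp N → ℝ) =ᵐ[volume] toL2 u - toL2 w := by
    rw [map_sub]; exact Lp.coeFn_sub _ _
  filter_upwards [gagliardoKernel_congr s h h] with p hp
  rw [hp, ← diffQuot_sq, Real.norm_eq_abs, sq_abs]
  simp only [diffQuot, Pi.sub_apply]
  ring

/-- A Cauchy sequence converges in L² to some f by the Poincaré inequality, and its difference
quotients converge in L² to some g. Almost everywhere convergence along a subsequence identifies g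
as the difference quotient of f, so f belongs to the space and is the limit in its norm. -/
theorem completeSpace [NeZero N] (hΩ : Bornology.IsBounded Ω) : CompleteSpace (HZero s Ω) := by
  obtain ⟨C, hC⟩ := exists_poincare (s := s) hΩ
  have hc := fracConst_pos (N := N) s
  refine Metric.complete_of_cauchySeq_tendsto fun u hu => ?_
  have h1 : CauchySeq fun n => toL2 (u n) := by
    rw [Metric.cauchySeq_iff'] at hu ⊢
    intro ε hε
    obtain ⟨n₀, hn₀⟩ := hu (ε / (|C| + 1)) (by positivity)
    refine ⟨n₀, fun n hn => ?_⟩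
    have := hn₀ n hn
    rw [dist_eq_norm, lt_div_iff₀ (by positivity)] at this
    rw [dist_eq_norm, ← map_sub]
    refine (hC _).trans_lt (lt_of_le_of_lt ?_ this)
    nlinarith [le_abs_self C, norm_nonneg (u n - u n₀)]
  have h2 : CauchySeq fun n => (u n).memLp_diffQuot.toLp := by
    rw [Metric.cauchySeq_iff'] at hu ⊢
    intro ε hε
    obtain ⟨n₀, hn₀⟩ := hu (ε * √(fracConst N s / 2)) (by positivity)
    refine ⟨n₀, fun n hn => ?_⟩
    have := hn₀ n hn
    rw [dist_eq_norm, ← Real.sqrt_sq (norm_nonneg (u n - u n₀)), norm_toLp_diffQuot_sub_sq,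
      Real.sqrt_mul (by positivity), mul_comm, Real.sqrt_sq (norm_nonneg _)] at this
    rw [dist_eq_norm]
    exact lt_of_mul_lt_mul_right this (Real.sqrt_nonneg _)
  obtain ⟨f, hf⟩ := cauchySeq_tendsto_of_complete h1
  obtain ⟨g, hg⟩ := cauchySeq_tendsto_of_complete h2
  obtain ⟨ns, hns, hns'⟩ := (tendstoInMeasure_of_tendsto_Lp hf).exists_seq_tendsto_ae
  -- The second subsequence is extracted from the first, so both almost everywhere limits hold along
  -- it.
  have hg' : Tendsto (fun n => (u (ns n)).memLp_diffQuot.toLp) atTop (𝓝 g) :=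
    hg.comp hns.tendsto_atTop
  obtain ⟨ms, hms, hms'⟩ := (tendstoInMeasure_of_tendsto_Lp hg').exists_seq_tendsto_ae
  have q1 := Measure.quasiMeasurePreserving_fst
    (μ := (volume : Measure (Sp N))) (ν := (volume : Measure (Sp N)))
  have q2 := Measure.quasiMeasurePreserving_snd
    (μ := (volume : Measure (Sp N))) (ν := (volume : Measure (Sp N)))
  have hgf : (g : Sp N × Sp N → ℝ) =ᵐ[(volume : Measure (Sp N)).prod volume] diffQuot s f := by
    have hall : ∀ᵐ p ∂((volume : Measure (Sp N)).prod volume), ∀ n,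
        (u (ns (ms n))).memLp_diffQuot.toLp _ p = diffQuot s (toL2 (u (ns (ms n)))) p :=
      ae_all_iff.2 fun n => (u (ns (ms n))).memLp_diffQuot.coeFn_toLp
    filter_upwards [hms', q1.ae hns', q2.ae hns', hall] with p hp p1 p2 pa
    have hl : Tendsto (fun n => diffQuot s (toL2 (u (ns (ms n)))) p) atTop (𝓝 (diffQuot s f p)) :=
      ((p1.comp hms.tendsto_atTop).sub (p2.comp hms.tendsto_atTop)).div_const _
    simp only [pa] at hp
    exact tendsto_nhds_unique hp hl
  have hf0 : ∀ᵐ x, x ∉ Ω → f x = 0 := by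
    have hall : ∀ᵐ x, ∀ n, x ∉ Ω → toL2 (u (ns n)) x = 0 :=
      ae_all_iff.2 fun n => (u (ns n)).ae_eq_zero
    filter_upwards [hns', hall] with x hx hx' hmem
    have : Tendsto (fun _ : ℕ => (0 : ℝ)) atTop (𝓝 (f x)) := by
      simpa only [hx' _ hmem] using hx
    exact (tendsto_nhds_unique this tendsto_const_nhds)
  have hfk : Integrable (gagliardoKernel s f f) ((volume : Measure (Sp N)).prod volume) := by
    refine (Lp.memLp g).integrable_sq.congr ?_
    filter_upwards [hgf] with p hp
    rw [hp, diffQuot_sq]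
  obtain ⟨a, ha⟩ := exists_of_memLp (s := s) (Ω := Ω) (Lp.memLp f) hfk hf0
  have hga : a.memLp_diffQuot.toLp = g := by
    apply Lp.ext
    filter_upwards [a.memLp_diffQuot.coeFn_toLp, hgf, q1.ae ha, q2.ae ha] with p h h' h1 h2
    rw [h, h', diffQuot, diffQuot, h1, h2]
  refine ⟨a, ?_⟩
  rw [tendsto_iff_norm_sub_tendsto_zero]
  have h3 : ∀ n, ‖u n - a‖ = √(fracConst N s / 2) * ‖(u n).memLp_diffQuot.toLp - g‖ := fun n => by
    rw [← Real.sqrt_sq (norm_nonneg (u n - a)), norm_toLp_diffQuot_sub_sq,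
      Real.sqrt_mul (by positivity), Real.sqrt_sq (norm_nonneg _), hga]
  simp only [h3]
  simpa using (tendsto_iff_norm_sub_tendsto_zero.1 hg).const_mul (√(fracConst N s / 2))

/-- The inclusion `H_0^s(Ω) → L²(ℝ^N)` as a bounded operator. -/
def toL2L [NeZero N] (hΩ : Bornology.IsBounded Ω) :
    HZero s Ω →L[ℝ] Lp ℝ 2 (volume : Measure (Sp N)) :=
  LinearMap.mkContinuousOfExistsBound
    { toFun := fun u => toL2 u
      map_add' := fun u w => map_add toL2 u w
      map_smul' := fun c u => map_smul toL2 c u } (exists_poincare hΩ)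

@[simp]
theorem toL2L_apply [NeZero N] (hΩ : Bornology.IsBounded Ω) (u : HZero s Ω) :
    toL2L hΩ u = toL2 u := rfl

end HZero

/-! ### Truncation and the weak maximum principle -/

section Truncation

/-- The excess of `x` over the interval `[-r, r]`. -/
def excess (r x : ℝ) : ℝ := x - max (-r) (min x r)

theorem excess_mono {r x y : ℝ} (hxy : x ≤ y) : excess r x ≤ excess r y := by
  unfold excess
  grind

theorem excess_sub_le {r x y : ℝ} (hr : 0 ≤ r) (hxy : x ≤ y) :
    excess r y - excess r x ≤ y - x := by
  unfold excess
  grind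

/-- A 1-Lipschitz function vanishing at 0 preserves `HZero s Ω`, which makes the excess of a
solution an admissible test function. -/
theorem lipschitzWith_excess {r : ℝ} (hr : 0 ≤ r) : LipschitzWith 1 (excess r) := by
  refine LipschitzWith.of_dist_le_mul fun x y => ?_
  rw [NNReal.coe_one, one_mul, Real.dist_eq, Real.dist_eq]
  rcases le_total x y with h | h
  · rw [abs_of_nonpos (by linarith [excess_mono (r := r) h]), abs_of_nonpos (by linarith)]
    linarith [excess_sub_le hr h]
  · rw [abs_of_nonneg (by linarith [excess_mono (r := r) h]), abs_of_nonneg (by linarith)]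
    linarith [excess_sub_le hr h]

theorem excess_zero {r : ℝ} (hr : 0 ≤ r) : excess r 0 = 0 := by
  unfold excess
  grind

theorem excess_eq_zero_iff {r x : ℝ} (hr : 0 ≤ r) : excess r x = 0 ↔ |x| ≤ r := by
  unfold excess
  grind

/-- Where the excess is nonzero, it has the sign of x and |x| = r + |excess r x|. Compared with a
function bounded by r, testing against the excess therefore leaves its square as surplus. -/
theorem mul_excess {r x : ℝ} (hr : 0 ≤ r) :
    x * excess r x = r * |excess r x| + excess r x ^ 2 := by
  unfold excess
  rcases le_total x r with h | h
  · rcases le_total (-r) x with h' | h'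
    · simp [min_eq_left h, max_eq_right h']
    · rw [min_eq_left h, max_eq_left h', abs_of_nonpos (by linarith)]
      ring
  · rw [min_eq_right h, max_eq_right (by linarith), abs_of_nonneg (by linarith)]
    ring

variable {N : ℕ} {s : Ioo (0 : ℝ) 1} {Ω : Set (Sp N)}

/-- The elements of `L²` that vanish outside `Ω` and are bounded by `r`. -/
def boundedBy (Ω : Set (Sp N)) (r : ℝ) : Set (Lp ℝ 2 (volume : Measure (Sp N))) :=
  {f | (∀ᵐ x, |f x| ≤ r) ∧ ∀ᵐ x, x ∉ Ω → f x = 0}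

/-- The weak maximum principle for `u + h (-Δ)^s u = f`. -/
theorem toL2_mem_boundedBy [NeZero N] {h r : ℝ} (hh : 0 < h) (hr : 0 ≤ r)
    {f : Lp ℝ 2 (volume : Measure (Sp N))} (hf : f ∈ boundedBy Ω r) {u : HZero s Ω}
    (hu : ∀ w : HZero s Ω,
      inner ℝ (HZero.toL2 u) (HZero.toL2 w) + h * inner ℝ u w = inner ℝ f (HZero.toL2 w)) :
    HZero.toL2 u ∈ boundedBy Ω r := by
  refine ⟨?_, u.ae_eq_zero⟩
  have hL := lipschitzWith_excess hr
  have hm : AEStronglyMeasurable (fun x => excess r (HZero.toL2 u x)) volume :=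
    hL.continuous.comp_aestronglyMeasurable u.aesm
  have habs : ∀ x y, |excess r x - excess r y| ≤ |x - y| := fun x y => by
    have := hL.dist_le_mul x y
    rwa [NNReal.coe_one, one_mul, Real.dist_eq, Real.dist_eq] at this
  have hm2 : MemLp (fun x => excess r (HZero.toL2 u x)) 2 volume :=
    (Lp.memLp (HZero.toL2 u)).of_le hm (Eventually.of_forall fun x => by
      have := habs (HZero.toL2 u x) 0
      rwa [excess_zero hr, sub_zero, sub_zero] at this)
  obtain ⟨w, hw⟩ := HZero.exists_of_memLp (s := s) (Ω := Ω) hm2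
    (by
      refine u.integrable_self.mono' (gagliardoKernel_aesm _ hm hm) (Eventually.of_forall fun p => ?_)
      rw [Real.norm_of_nonneg (gagliardoKernel_self_nonneg _ _ _)]
      refine div_le_div_of_nonneg_right ?_ (Real.rpow_nonneg (norm_nonneg _) _)
      rw [← abs_mul_abs_self, ← abs_mul_abs_self (HZero.toL2 u p.1 - _)]
      exact mul_self_le_mul_self (abs_nonneg _) (habs _ _))
    (by
      filter_upwards [u.ae_eq_zero] with x hx hmem
      rw [hx hmem, excess_zero hr])
  -- Since `excess r` is monotone, the differences of u and of its excess have the same sign at each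
  -- pair of points.
  have hF : 0 ≤ inner ℝ u w := by
    rw [HZero.inner_eq, fracForm]
    refine mul_nonneg (by have := fracConst_pos (N := N) s; positivity) (integral_nonneg_of_ae ?_)
    filter_upwards [gagliardoKernel_congr s (EventuallyEq.refl _ (HZero.toL2 u : Sp N → ℝ)) hw]
      with p hp
    rw [hp]
    refine div_nonneg ?_ (Real.rpow_nonneg (norm_nonneg _) _)
    rcases le_total (HZero.toL2 u p.1) (HZero.toL2 u p.2) with h | h
    · exact mul_nonneg_of_nonpos_of_nonpos (by linarith) (by linarith [excess_mono (r := r) h])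
    · exact mul_nonneg (by linarith) (by linarith [excess_mono (r := r) h])
  have h1 : inner ℝ (HZero.toL2 u - f) (HZero.toL2 w) ≤ 0 := by
    rw [inner_sub_left]
    nlinarith [hu w]
  -- Pointwise, u w = r|w| + w² and f w ≤ r|w|. With `h1` this forces the excess to vanish.
  have h2 : ‖HZero.toL2 w‖ ^ 2 ≤ inner ℝ (HZero.toL2 u - f) (HZero.toL2 w) := by
    rw [← real_inner_self_eq_norm_sq, L2.inner_def, L2.inner_def]
    refine integral_mono_ae (L2.integrable_inner _ _) (L2.integrable_inner _ _) ?_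
    filter_upwards [hw, hf.1, Lp.coeFn_sub (HZero.toL2 u) f] with x hx hfx hsub
    simp only [hsub, hx, Pi.sub_apply, RCLike.inner_apply, conj_trivial]
    have h3 := mul_excess (x := HZero.toL2 u x) hr
    have h4 : f x * excess r (HZero.toL2 u x) ≤ r * |excess r (HZero.toL2 u x)| :=
      (le_abs_self _).trans (by rw [abs_mul]; exact mul_le_mul_of_nonneg_right hfx (abs_nonneg _))
    nlinarith
  have h5 : HZero.toL2 w = 0 := by
    rw [← norm_eq_zero, ← sq_eq_zero_iff]
    exact le_antisymm (h2.trans h1) (sq_nonneg _)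
  rw [h5] at hw
  filter_upwards [hw, Lp.coeFn_zero ℝ 2 (volume : Measure (Sp N))] with x hx hx0
  rw [← excess_eq_zero_iff hr, ← hx, hx0]
  rfl

theorem boundedBy_mono {r r' : ℝ} (h : r ≤ r') : boundedBy Ω r ⊆ boundedBy Ω r' := fun _ hf =>
  ⟨hf.1.mono fun _ hx => hx.trans h, hf.2⟩

/-- The closure replaces Ω because it is measurable without further assumption and still has finite
measure. -/
theorem norm_le_of_mem_boundedBy (hΩ : Bornology.IsBounded Ω) {r : ℝ}
    {f : Lp ℝ 2 (volume : Measure (Sp N))} (hf : f ∈ boundedBy Ω r) :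
    ‖f‖ ≤ √(volume.real (closure Ω)) * r := by
  have hr : 0 ≤ r := by
    obtain ⟨x, hx⟩ := hf.1.exists
    exact (abs_nonneg _).trans hx
  have hfin : volume (closure Ω) ≠ ⊤ := hΩ.closure.measure_lt_top.ne
  rw [← Real.sqrt_sq hr, ← Real.sqrt_mul measureReal_nonneg]
  refine Real.le_sqrt_of_sq_le ?_
  have h1 : ∫ x in closure Ω, r ^ 2 = volume.real (closure Ω) * r ^ 2 := by simp
  rw [← h1, ← integral_indicator isClosed_closure.measurableSet, ← real_inner_self_eq_norm_sq,
    L2.inner_def]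
  refine integral_mono_ae (L2.integrable_inner _ _) ?_ ?_
  · rw [integrable_indicator_iff isClosed_closure.measurableSet]
    exact integrableOn_const hfin
  · filter_upwards [hf.1, hf.2] with x h1 h2
    by_cases hx : x ∈ closure Ω
    · rw [indicator_of_mem hx, real_inner_self_eq_norm_sq, Real.norm_eq_abs]
      exact pow_le_pow_left₀ (abs_nonneg _) h1 2
    · rw [indicator_of_notMem hx, h2 fun h => hx (subset_closure h), inner_zero_left]

end Truncation

instance secondCountableTopology_Lp_two {N : ℕ} :
    SecondCountableTopology (Lp ℝ 2 (volume : Measure (Sp N))) :=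
  haveI : Fact ((2 : ENNReal) ≠ ⊤) := ⟨by norm_num⟩
  inferInstance

/-! ### Functions on the cylinder and paths in L² -/

section Slices

variable {N : ℕ} {T : ℝ}

theorem cylMeasure_univ : cylMeasure (univ : Set (Sp N)) T = volume.prod (timeMeasure T) := by
  rw [cylMeasure, Measure.restrict_univ]

/-- `F t` is the slice `G(·,t)` of the function `G` on the cylinder, for almost every `t`. -/
def IsSlice (T : ℝ) (G : Sp N × ℝ → ℝ) (F : ℝ → Lp ℝ 2 (volume : Measure (Sp N))) : Prop :=
  ∀ᵐ t ∂(timeMeasure T), (fun x => G (x, t)) =ᵐ[volume] F t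

theorem ae_ae_of_ae_cylMeasure {p : Sp N × ℝ → Prop} (h : ∀ᵐ q ∂(cylMeasure univ T), p q) :
    ∀ᵐ t ∂(timeMeasure T), ∀ᵐ x, p (x, t) := by
  rw [cylMeasure_univ] at h
  exact Measure.ae_ae_of_ae_prod (Measure.measurePreserving_swap.quasiMeasurePreserving.ae h)

/-- The converse of slicing requires a measurable set of coincidence, hence the passage to
measurable representatives. -/
theorem ae_eq_cylMeasure_of_ae_ae {G G' : Sp N × ℝ → ℝ}
    (hG : AEStronglyMeasurable G (cylMeasure univ T))
    (hG' : AEStronglyMeasurable G' (cylMeasure univ T))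
    (h : ∀ᵐ t ∂(timeMeasure T), ∀ᵐ x, G (x, t) = G' (x, t)) : G =ᵐ[cylMeasure univ T] G' := by
  have h1 : hG.mk G =ᵐ[cylMeasure univ T] hG'.mk G' := by
    have hms : MeasurableSet {q | hG.mk G q = hG'.mk G' q} :=
      measurableSet_eq_fun hG.stronglyMeasurable_mk.measurable hG'.stronglyMeasurable_mk.measurable
    have h2 : ∀ᵐ t ∂(timeMeasure T), ∀ᵐ x, hG.mk G (x, t) = hG'.mk G' (x, t) := by
      filter_upwards [h, ae_ae_of_ae_cylMeasure hG.ae_eq_mk, ae_ae_of_ae_cylMeasure hG'.ae_eq_mk]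
        with t h1 h2 h3
      filter_upwards [h1, h2, h3] with x a b c
      rw [← b, ← c, a]
    have h3 : ∀ᵐ q ∂((timeMeasure T).prod (volume : Measure (Sp N))),
        hG.mk G q.swap = hG'.mk G' q.swap :=
      (Measure.ae_prod_iff_ae_ae (measurable_swap hms)).2 h2
    exact ae_mono cylMeasure_univ.le
      (Measure.measurePreserving_swap.quasiMeasurePreserving.ae h3)
  exact hG.ae_eq_mk.trans (h1.trans hG'.ae_eq_mk.symm)

variable {G G' : Sp N × ℝ → ℝ} {F F' : ℝ → Lp ℝ 2 (volume : Measure (Sp N))}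

/-- Pairings of the slices with a fixed w are measurable in t by Fubini, and L² is separable, so
weak measurability suffices. -/
theorem IsSlice.aestronglyMeasurable (h : IsSlice T G F)
    (hG : AEStronglyMeasurable G (cylMeasure univ T)) :
    AEStronglyMeasurable F (timeMeasure T) := by
  rw [cylMeasure_univ] at hG
  refine aestronglyMeasurable_of_inner fun w => ?_
  have h1 : AEStronglyMeasurable (fun q : Sp N × ℝ => w q.1 * G q)
      (volume.prod (timeMeasure T)) := ((Lp.aestronglyMeasurable w).comp_fst).mul hG
  refine h1.prod_swap.integral_prod_right'.congr ?_
  filter_upwards [h] with t ht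
  rw [L2.inner_def]
  refine integral_congr_ae ?_
  filter_upwards [ht] with x hx
  simp only [Prod.swap_prod_mk, RCLike.inner_apply, conj_trivial, hx]
  ring

theorem IsSlice.memLp_iff (h : IsSlice T G F) (hG : AEStronglyMeasurable G (cylMeasure univ T)) :
    MemLp F 2 (timeMeasure T) ↔ MemLp G 2 (cylMeasure univ T) := by
  have hF := h.aestronglyMeasurable hG
  rw [memLp_two_iff_integrable_sq hG, memLp_two_iff_integrable_sq_norm hF]
  rw [cylMeasure_univ] at hG ⊢
  rw [integrable_prod_iff' (f := fun q => G q ^ 2) (hG.pow 2)]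
  have h1 : ∀ᵐ t ∂(timeMeasure T), Integrable (fun x => G (x, t) ^ 2) := by
    filter_upwards [h] with t ht
    refine (Lp.memLp (F t)).integrable_sq.congr ?_
    filter_upwards [ht] with x hx
    rw [hx]
  have h2 : (fun t => ‖F t‖ ^ 2) =ᵐ[timeMeasure T] fun t => ∫ x, ‖G (x, t) ^ 2‖ := by
    filter_upwards [h] with t ht
    rw [norm_sq_eq_integral_sq]
    refine integral_congr_ae ?_
    filter_upwards [ht] with x hx
    rw [hx, Real.norm_of_nonneg (sq_nonneg _)]
  rw [integrable_congr h2]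
  exact ⟨fun h => ⟨h1, h⟩, fun h => h.2⟩

theorem IsSlice.integral_mul (h : IsSlice T G F) (h' : IsSlice T G' F')
    (hG : MemLp G 2 (cylMeasure univ T)) (hG' : MemLp G' 2 (cylMeasure univ T)) :
    ∫ q, G q * G' q ∂(cylMeasure univ T) = ∫ t, inner ℝ (F t) (F' t) ∂(timeMeasure T) := by
  have hi : Integrable (fun q => G q * G' q) (cylMeasure univ T) := hG.integrable_mul hG'
  rw [cylMeasure_univ] at hi ⊢
  rw [integral_prod_symm _ hi]
  refine integral_congr_ae ?_
  filter_upwards [h, h'] with t ht ht'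
  rw [L2.inner_def]
  refine integral_congr_ae ?_
  filter_upwards [ht, ht'] with x hx hx'
  rw [← hx, ← hx']
  simp only [RCLike.inner_apply, conj_trivial]
  ring

theorem IsSlice.ae_eq (h : IsSlice T G F) (h' : IsSlice T G F') : F =ᵐ[timeMeasure T] F' := by
  filter_upwards [h, h'] with t ht ht'
  exact Lp.ext (ht.symm.trans ht')

theorem exists_isSlice (hG : MemLp G 2 (cylMeasure univ T)) : ∃ F, IsSlice T G F := by
  have h2 := hG.integrable_sq
  have hm := hG.aestronglyMeasurable
  rw [cylMeasure_univ] at h2 hm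
  have h3 : ∀ᵐ t ∂(timeMeasure T), AEStronglyMeasurable (fun x => G (x, t)) volume :=
    hm.prod_swap.prodMk_left
  have h1 : ∀ᵐ t ∂(timeMeasure T), MemLp (fun x => G (x, t)) 2 volume := by
    filter_upwards [h2.prod_left_ae, h3] with t ht ht'
    exact (memLp_two_iff_integrable_sq ht').2 ht
  classical
  refine ⟨fun t => if ht : MemLp (fun x => G (x, t)) 2 volume then ht.toLp else 0, ?_⟩
  filter_upwards [h1] with t ht
  rw [dif_pos ht]
  exact ht.coeFn_toLp.symm

/-- Square integrable paths in `L²(ℝ^N)` are given by functions on the cylinder. -/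
theorem exists_function_of_path (hF : MemLp F 2 (timeMeasure T)) :
    ∃ G : Sp N × ℝ → ℝ, MemLp G 2 (cylMeasure univ T) ∧ IsSlice T G F := by
  let E := Lp ℝ 2 (cylMeasure (univ : Set (Sp N)) T)
  choose σ hσ using fun g : E => exists_isSlice (Lp.memLp g)
  have hσ2 : ∀ g, MemLp (σ g) 2 (timeMeasure T) := fun g =>
    ((hσ g).memLp_iff (Lp.aestronglyMeasurable g)).2 (Lp.memLp g)
  have hσadd : ∀ a b, σ (a + b) =ᵐ[timeMeasure T] fun t => σ a t + σ b t := by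
    intro a b
    refine (hσ (a + b)).ae_eq ?_
    filter_upwards [hσ a, hσ b, ae_ae_of_ae_cylMeasure (Lp.coeFn_add a b)] with t ha hb hab
    filter_upwards [ha, hb, hab, Lp.coeFn_add (σ a t) (σ b t)] with x h1 h2 h3 h4
    rw [h4, h3, Pi.add_apply, Pi.add_apply, h1, h2]
  have hσsmul : ∀ (c : ℝ) a, σ (c • a) =ᵐ[timeMeasure T] fun t => c • σ a t := by
    intro c a
    refine (hσ (c • a)).ae_eq ?_
    filter_upwards [hσ a, ae_ae_of_ae_cylMeasure (Lp.coeFn_smul c a)] with t ha hab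
    filter_upwards [ha, hab, Lp.coeFn_smul c (σ a t)] with x h1 h3 h4
    rw [h4, h3, Pi.smul_apply, Pi.smul_apply, h1]
  have hσnorm : ∀ g, ∫ t, ‖σ g t‖ ^ 2 ∂(timeMeasure T) = ‖g‖ ^ 2 := by
    intro g
    have h1 := (hσ g).integral_mul (hσ g) (Lp.memLp g) (Lp.memLp g)
    simp only [real_inner_self_eq_norm_sq] at h1
    rw [← h1, ← real_inner_self_eq_norm_sq, L2.inner_def]
    simp [pow_two]
  -- Pairing the path with the slices of g is a bounded functional on L² of the cylinder; its Riesz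
  -- representative is the function sought.
  let ℓ : E →ₗ[ℝ] ℝ :=
    { toFun := fun g => ∫ t, inner ℝ (F t) (σ g t) ∂(timeMeasure T)
      map_add' := fun a b => by
        rw [← integral_add (integrable_inner_of_memLp_two hF (hσ2 a))
          (integrable_inner_of_memLp_two hF (hσ2 b))]
        refine integral_congr_ae ?_
        filter_upwards [hσadd a b] with t ht
        rw [ht, inner_add_right]
      map_smul' := fun c a => by
        rw [RingHom.id_apply, smul_eq_mul, ← integral_const_mul]
        refine integral_congr_ae ?_
        filter_upwards [hσsmul c a] with t ht
        rw [ht, inner_smul_right] }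
  have hℓ : ∀ g, ‖ℓ g‖ ≤ √(∫ t, ‖F t‖ ^ 2 ∂(timeMeasure T)) * ‖g‖ := fun g => by
    refine (abs_integral_inner_le hF (hσ2 g)).trans ?_
    rw [hσnorm, Real.sqrt_sq (norm_nonneg _)]
  let g : E := (InnerProductSpace.toDual ℝ E).symm (ℓ.mkContinuous _ hℓ)
  have hg : ∀ a : E, inner ℝ g a = ∫ t, inner ℝ (F t) (σ a t) ∂(timeMeasure T) := fun a =>
    InnerProductSpace.toDual_symm_apply
  refine ⟨g, Lp.memLp g, ?_⟩
  have heq : σ g =ᵐ[timeMeasure T] F := by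
    refine ae_eq_of_forall_inner fun w => ?_
    refine Integrable.ae_eq_of_forall_setIntegral_eq _ _
      (((hσ2 g).integrable (by norm_num)).const_inner w)
      ((hF.integrable (by norm_num)).const_inner w) fun B hB _ => ?_
    -- Testing with the products w(x) 1_B(t) identifies the slices of the representative for almost
    -- every t.
    let P : Sp N × ℝ → ℝ := fun q => w q.1 * B.indicator (fun _ => (1 : ℝ)) q.2
    let p : ℝ → Lp ℝ 2 (volume : Measure (Sp N)) := B.indicator fun _ => w
    have hPp : IsSlice T P p := by
      refine Eventually.of_forall fun t => ?_
      by_cases ht : t ∈ B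
      · simp [P, p, ht]
      · simp only [P, p, indicator_of_notMem ht, mul_zero]
        exact (Lp.coeFn_zero ℝ 2 (volume : Measure (Sp N))).symm
    have hPm : AEStronglyMeasurable P (cylMeasure univ T) := by
      rw [cylMeasure_univ]
      exact ((Lp.aestronglyMeasurable w).comp_fst).mul
        ((measurable_const.indicator hB).comp measurable_snd).aestronglyMeasurable
    have hp2 : MemLp p 2 (timeMeasure T) := (memLp_const w).indicator hB
    have hP2 : MemLp P 2 (cylMeasure univ T) := (hPp.memLp_iff hPm).1 hp2
    have h1 := hg (hP2.toLp P)
    have hPae : IsSlice T (hP2.toLp P) p := by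
      filter_upwards [hPp, ae_ae_of_ae_cylMeasure hP2.coeFn_toLp] with t ht ht'
      exact EventuallyEq.trans ht' ht
    have h2 : inner ℝ g (hP2.toLp P) = ∫ t, inner ℝ (σ g t) (p t) ∂(timeMeasure T) := by
      rw [L2.inner_def, ← (hσ g).integral_mul hPae (Lp.memLp g) (Lp.memLp _)]
      refine integral_congr_ae (Eventually.of_forall fun q => ?_)
      simp only [RCLike.inner_apply, conj_trivial]
      ring
    have h3 : ∫ t, inner ℝ (F t) (σ (hP2.toLp P) t) ∂(timeMeasure T) =
        ∫ t, inner ℝ (F t) (p t) ∂(timeMeasure T) := by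
      refine integral_congr_ae ?_
      filter_upwards [(hσ _).ae_eq hPae] with t ht
      rw [ht]
    have h4 : ∀ x : ℝ → Lp ℝ 2 (volume : Measure (Sp N)),
        ∫ t, inner ℝ (x t) (p t) ∂(timeMeasure T) =
          ∫ t in B, inner ℝ w (x t) ∂(timeMeasure T) := by
      intro x
      rw [← integral_indicator hB]
      refine integral_congr_ae (Eventually.of_forall fun t => ?_)
      by_cases ht : t ∈ B
      · simp [p, ht, real_inner_comm]
      · simp [p, ht]
    rw [← h4, ← h4, ← h2, h1, h3]
  filter_upwards [hσ g, heq] with t ht ht'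
  rwa [ht'] at ht

end Slices

/-! ### Multiplication operators -/

section Multiplication

variable {X : Type*} [MeasurableSpace X] {μ : Measure X}

theorem memLp_mul_of_bound {a : X → ℝ} (ha : Measurable a) {L : ℝ} (hL : ∀ x, |a x| ≤ L)
    (f : Lp ℝ 2 μ) : MemLp (fun x => a x * f x) 2 μ :=
  (Lp.memLp f).of_le_mul (ha.aestronglyMeasurable.mul (Lp.aestronglyMeasurable f))
    (Eventually.of_forall fun x => by
      rw [norm_mul]
      exact mul_le_mul_of_nonneg_right (hL x) (norm_nonneg _))

/-- Multiplication by the bounded measurable function `a` on `L²`. -/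
def mulOp (a : X → ℝ) (ha : Measurable a) (L : ℝ) (hL : ∀ x, |a x| ≤ L) :
    Lp ℝ 2 μ →L[ℝ] Lp ℝ 2 μ :=
  LinearMap.mkContinuous
    { toFun := fun f => (memLp_mul_of_bound ha hL f).toLp
      map_add' := fun f g => by
        rw [← MemLp.toLp_add]
        refine MemLp.toLp_congr _ _ ?_
        filter_upwards [Lp.coeFn_add f g] with x hx
        rw [hx, Pi.add_apply, Pi.add_apply, mul_add]
      map_smul' := fun c f => by
        rw [RingHom.id_apply, ← MemLp.toLp_const_smul]
        refine MemLp.toLp_congr _ _ ?_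
        filter_upwards [Lp.coeFn_smul c f] with x hx
        rw [hx, Pi.smul_apply, Pi.smul_apply, smul_eq_mul, smul_eq_mul, mul_left_comm] }
    L fun f => by
      refine Lp.norm_le_mul_norm_of_ae_le_mul ?_
      filter_upwards [(memLp_mul_of_bound ha hL f).coeFn_toLp] with x hx
      refine (congrArg norm hx).trans_le ?_
      rw [norm_mul]
      exact mul_le_mul_of_nonneg_right (hL x) (norm_nonneg _)

theorem coeFn_mulOp {a : X → ℝ} (ha : Measurable a) {L : ℝ} (hL : ∀ x, |a x| ≤ L)
    (f : Lp ℝ 2 μ) : mulOp a ha L hL f =ᵐ[μ] fun x => a x * f x :=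
  (memLp_mul_of_bound ha hL f).coeFn_toLp

theorem norm_mulOp_le {a : X → ℝ} (ha : Measurable a) {L : ℝ} (hL0 : 0 ≤ L)
    (hL : ∀ x, |a x| ≤ L) : ‖(mulOp a ha L hL : Lp ℝ 2 μ →L[ℝ] Lp ℝ 2 μ)‖ ≤ L :=
  LinearMap.mkContinuous_norm_le _ hL0 _

theorem inner_mulOp {a : X → ℝ} (ha : Measurable a) {L : ℝ} (hL : ∀ x, |a x| ≤ L)
    (f g : Lp ℝ 2 μ) : inner ℝ (mulOp a ha L hL f) g = inner ℝ f (mulOp a ha L hL g) := by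
  rw [L2.inner_def, L2.inner_def]
  refine integral_congr_ae ?_
  filter_upwards [coeFn_mulOp ha hL f, coeFn_mulOp ha hL g] with x hf hg
  rw [hf, hg]
  simp only [RCLike.inner_apply, conj_trivial]
  ring

/-- Multiplication by a jointly measurable function depends measurably on the parameter. -/
theorem stronglyMeasurable_mulOp {N : ℕ} {a : Sp N × ℝ → ℝ} (ha : Measurable a) {L : ℝ}
    (hL : ∀ q, |a q| ≤ L) (f : Lp ℝ 2 (volume : Measure (Sp N))) :
    StronglyMeasurable fun t : ℝ => mulOp (μ := (volume : Measure (Sp N))) (fun x => a (x, t))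
      (ha.comp measurable_prodMk_right) L (fun x => hL (x, t)) f := by
  refine stronglyMeasurable_of_inner fun w => ?_
  have h1 : ∀ t : ℝ, inner ℝ w (mulOp (fun x => a (x, t)) (ha.comp measurable_prodMk_right) L
      (fun x => hL (x, t)) f) = ∫ x, w x * (a (x, t) * f x) := by
    intro t
    rw [L2.inner_def]
    refine integral_congr_ae ?_
    filter_upwards [coeFn_mulOp (a := fun x => a (x, t)) (ha.comp measurable_prodMk_right)
      (fun x => hL (x, t)) f] with x hx
    rw [hx]
    simp only [RCLike.inner_apply, conj_trivial]
    ring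
  simp only [h1]
  have h2 : StronglyMeasurable fun q : ℝ × Sp N => w q.2 * (a (q.2, q.1) * f q.2) := by
    have := (Lp.stronglyMeasurable w).measurable
    have := (Lp.stronglyMeasurable f).measurable
    have := ha.comp measurable_swap (α := ℝ × Sp N)
    exact Measurable.stronglyMeasurable (by fun_prop)
  exact h2.integral_prod_right'

end Multiplication

/-! ### Weak solutions as paths -/

section Paths

variable {V H : Type*} [NormedAddCommGroup V] [InnerProductSpace ℝ V]
  [NormedAddCommGroup H] [InnerProductSpace ℝ H]

theorem integrable_dual_apply {α : Type*} [MeasurableSpace α] {μ : Measure α}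
    {F : α → StrongDual ℝ V} {f : α → V} (hF : MemLp F 2 μ) (hf : MemLp f 2 μ) :
    Integrable (fun a => F a (f a)) μ := by
  have h1 : Integrable (fun a => ‖F a‖ * ‖f a‖) μ := hF.norm.integrable_mul hf.norm
  exact h1.mono' ((ContinuousLinearMap.id ℝ (StrongDual ℝ V)).aestronglyMeasurable_comp₂
    hF.aestronglyMeasurable hf.aestronglyMeasurable)
    (Eventually.of_forall fun a => (F a).le_opNorm _)

theorem aestronglyMeasurable_operator_apply [SecondCountableTopology H]
    {M : ℝ → H →L[ℝ] H} (hM : ∀ x, StronglyMeasurable fun t => M t x) {f : ℝ → H} {μ : Measure ℝ}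
    (hf : AEStronglyMeasurable f μ) : AEStronglyMeasurable (fun t => M t (f t)) μ := by
  refine (stronglyMeasurable_operator_apply hM hf.stronglyMeasurable_mk).aestronglyMeasurable.congr ?_
  filter_upwards [hf.ae_eq_mk] with t ht
  rw [← ht]

/-- Smooth scalar functions with compact support in `(0,T)`, times a fixed vector, are test
paths. -/
theorem isTestPath_smul_const (ι : V →L[ℝ] H) {T : ℝ} (hT : 0 < T) {η : ℝ → ℝ}
    (hη : ContDiff ℝ (⊤ : ℕ∞) η) (hs : tsupport η ⊆ Ioo 0 T) (w : V) :
    IsTestPath ι T (fun t => η t • w) (fun t => deriv η t • pivot ι (ι w))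
      (fun t => η t • ι w) := by
  have hηT : η T = 0 :=
    image_eq_zero_of_notMem_tsupport fun hmem => absurd (hs hmem).2 (lt_irrefl _)
  have hη0 : η 0 = 0 :=
    image_eq_zero_of_notMem_tsupport fun hmem => absurd (hs hmem).1 (lt_irrefl _)
  have hd : Continuous (deriv η) := hη.continuous_deriv (by simp)
  have hc := hη.continuous
  refine ⟨memLp_timeMeasure_of_continuousOn (by fun_prop) 2,
    memLp_timeMeasure_of_continuousOn (by fun_prop) 2, ?_, by fun_prop,
    Eventually.of_forall fun t => by simp, by simp [hηT]⟩
  intro θ hθ _ _ z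
  have h1 := ((hθ.of_le (by simp)).contDiffOn.absolutelyContinuousOnInterval
    (a := 0) (b := T)).integral_mul_deriv_eq_deriv_mul
    ((hη.of_le (by simp)).contDiffOn.absolutelyContinuousOnInterval)
  rw [hηT, hη0, ← integral_timeMeasure hT.le, ← integral_timeMeasure hT.le] at h1
  have e1 : ∀ t, deriv θ t * inner ℝ (ι (η t • w)) (ι z) =
      deriv θ t * η t * inner ℝ (ι w) (ι z) := fun t => by
    rw [map_smul, real_inner_smul_left]; ring
  have e2 : ∀ t, θ t * (deriv η t • pivot ι (ι w)) z =
      θ t * deriv η t * inner ℝ (ι w) (ι z) := fun t => by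
    simp; ring
  simp only [e1, e2]
  rw [integral_mul_const, integral_mul_const, h1]
  ring

/-- The path `R` solves the weak formulation of `R' + A R = M R`, `R(0) = u₀`. -/
def SolvesWeakly (ι : V →L[ℝ] H) (T : ℝ) (M : ℝ → H →L[ℝ] H) (u₀ : H) (R : ℝ → V) : Prop :=
  ∀ (Φ : ℝ → V) (Φ' : ℝ → StrongDual ℝ V) (c : ℝ → H), IsTestPath ι T Φ Φ' c →
    - ∫ t, Φ' t (R t) ∂(timeMeasure T) + ∫ t, inner ℝ (R t) (Φ t) ∂(timeMeasure T)
      - ∫ t, inner ℝ (M t (ι (R t))) (ι (Φ t)) ∂(timeMeasure T) = inner ℝ u₀ (c 0)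

theorem memLp_operator_apply [SecondCountableTopology H] {T : ℝ}
    {M : ℝ → H →L[ℝ] H} (hM : ∀ x, StronglyMeasurable fun t => M t x) {L : ℝ}
    (hML : ∀ t, ‖M t‖ ≤ L) {f : ℝ → H} (hf : MemLp f 2 (timeMeasure T)) :
    MemLp (fun t => M t (f t)) 2 (timeMeasure T) :=
  hf.of_le_mul (aestronglyMeasurable_operator_apply hM hf.aestronglyMeasurable)
    (Eventually.of_forall fun t => (M t).le_of_opNorm_le (hML t) _)

/-- By linearity the difference solves the equation with zero datum and right-hand side y = M ι(R -
R'), whose norm is at most L‖ι(R - R')‖. -/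
theorem SolvesWeakly.ae_eq [SecondCountableTopology H] [CompleteSpace V] {ι : V →L[ℝ] H} {T : ℝ}
    (hT : 0 < T) {M : ℝ → H →L[ℝ] H} (hM : ∀ x, StronglyMeasurable fun t => M t x) {L : ℝ}
    (hL : 0 ≤ L) (hML : ∀ t, ‖M t‖ ≤ L) {u₀ : H} {R R' : ℝ → V} (hR : MemLp R 2 (timeMeasure T))
    (hR' : MemLp R' 2 (timeMeasure T)) (h : SolvesWeakly ι T M u₀ R)
    (h' : SolvesWeakly ι T M u₀ R') : ∀ᵐ t ∂(timeMeasure T), ι (R t) = ι (R' t) := by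
  have hιR : MemLp (fun t => M t (ι (R t))) 2 (timeMeasure T) :=
    memLp_operator_apply hM hML (ι.comp_memLp' hR)
  have hιR' : MemLp (fun t => M t (ι (R' t))) 2 (timeMeasure T) :=
    memLp_operator_apply hM hML (ι.comp_memLp' hR')
  have hd : MemLp (fun t => R t - R' t) 2 (timeMeasure T) := hR.sub hR'
  have key := ae_eq_zero_of_isTestPath_identity ι hT hL (R := fun t => R t - R' t)
    (y := fun t => M t (ι (R t - R' t))) hd
    (memLp_operator_apply hM hML (ι.comp_memLp' hd)).aestronglyMeasurable
    (Eventually.of_forall fun t => (M t).le_of_opNorm_le (hML t) _) ?_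
  · filter_upwards [key] with t ht
    rwa [map_sub, sub_eq_zero] at ht
  · intro Φ Φ' c hΦ
    have hιΦ : MemLp (fun t => ι (Φ t)) 2 (timeMeasure T) := ι.comp_memLp' hΦ.memLp
    have e := h Φ Φ' c hΦ
    have e' := h' Φ Φ' c hΦ
    simp only [map_sub, inner_sub_left]
    rw [integral_sub (integrable_dual_apply hΦ.deriv_memLp hR)
        (integrable_dual_apply hΦ.deriv_memLp hR'),
      integral_sub (integrable_inner_of_memLp_two hR hΦ.memLp)
        (integrable_inner_of_memLp_two hR' hΦ.memLp),
      integral_sub (integrable_inner_of_memLp_two hιR hιΦ)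
        (integrable_inner_of_memLp_two hιR' hιΦ)]
    linarith

/-- A weak solution has a distributional time derivative in `L²((0,T); V*)`. -/
theorem SolvesWeakly.exists_deriv [SecondCountableTopology H] {ι : V →L[ℝ] H} {T : ℝ}
    (hT : 0 < T) {M : ℝ → H →L[ℝ] H} (hM : ∀ x, StronglyMeasurable fun t => M t x) {L : ℝ}
    (hML : ∀ t, ‖M t‖ ≤ L) {u₀ : H} {R : ℝ → V} (hR : MemLp R 2 (timeMeasure T))
    (h : SolvesWeakly ι T M u₀ R) :
    ∃ R' : ℝ → StrongDual ℝ V, MemLp R' 2 (timeMeasure T) ∧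
      ∀ η : ℝ → ℝ, ContDiff ℝ (⊤ : ℕ∞) η → HasCompactSupport η → tsupport η ⊆ Ioo 0 T →
        ∀ w : V, ∫ t, deriv η t * inner ℝ (ι (R t)) (ι w) ∂(timeMeasure T)
          = - ∫ t, η t * R' t w ∂(timeMeasure T) := by
  have hιR : MemLp (fun t => ι (R t)) 2 (timeMeasure T) := ι.comp_memLp' hR
  have hMR := memLp_operator_apply hM hML hιR
  -- The equation dictates the derivative M R - A R, where A is the Riesz map of V.
  refine ⟨fun t => pivot ι (M t (ι (R t))) - pivot (ContinuousLinearMap.id ℝ V) (R t),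
    ((pivot ι).comp_memLp' hMR).sub ((pivot (ContinuousLinearMap.id ℝ V)).comp_memLp' hR), ?_⟩
  intro η hη _ hs w
  have hP := isTestPath_smul_const ι hT hη hs w
  have e := h _ _ _ hP
  have hη0 : η 0 = 0 :=
    image_eq_zero_of_notMem_tsupport fun hmem => absurd (hs hmem).1 (lt_irrefl _)
  have i1 := integrable_inner_of_memLp_two hR hP.memLp
  have i2 : Integrable (fun t => inner ℝ (M t (ι (R t))) (ι (η t • w))) (timeMeasure T) :=
    integrable_inner_of_memLp_two hMR (ι.comp_memLp' hP.memLp)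
  have e1 : ∀ t, deriv η t * inner ℝ (ι (R t)) (ι w) =
      (deriv η t • pivot ι (ι w)) (R t) := fun t => by
    simp [real_inner_comm]
  have e2 : ∀ t, η t * (pivot ι (M t (ι (R t))) - pivot (ContinuousLinearMap.id ℝ V) (R t)) w =
      inner ℝ (M t (ι (R t))) (ι (η t • w)) - inner ℝ (R t) (η t • w) := fun t => by
    simp [inner_smul_right, mul_sub]
  simp only [e1, e2]
  rw [integral_sub i2 i1]
  rw [hη0, zero_smul, inner_zero_right] at e
  linarith

end Paths

/-! ### Translation between functions on the cylinder and paths -/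

section Bridge

variable {N : ℕ} {s : Ioo (0 : ℝ) 1} {Ω ω : Set (Sp N)} {T : ℝ}

theorem IsL2V.isSlice [NeZero N] {ψ : Sp N × ℝ → ℝ} {Ψ : ℝ → HZero s Ω} (h : IsL2V T ψ Ψ) :
    IsSlice T ψ fun t => HZero.toL2 (Ψ t) := h.slice

theorem IsL2V.memLp_two [NeZero N] (hΩ : Bornology.IsBounded Ω) {ψ : Sp N × ℝ → ℝ} {Ψ : ℝ → HZero s Ω}
    (h : IsL2V T ψ Ψ) : MemLp ψ 2 (cylMeasure univ T) :=
  (h.isSlice.memLp_iff h.aestronglyMeasurable).1 ((HZero.toL2L hΩ).comp_memLp' h.memLp)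

theorem exists_isL2V [NeZero N] (hΩ : Bornology.IsBounded Ω) {Ψ : ℝ → HZero s Ω}
    (h : MemLp Ψ 2 (timeMeasure T)) : ∃ ψ, IsL2V T ψ Ψ := by
  obtain ⟨ψ, hψ, hs⟩ := exists_function_of_path ((HZero.toL2L hΩ).comp_memLp' h)
  exact ⟨ψ, hψ.aestronglyMeasurable, h, hs⟩

theorem integral_toL2_mul (u w : HZero s Ω) :
    ∫ x, HZero.toL2 u x * HZero.toL2 w x = inner ℝ (HZero.toL2 u) (HZero.toL2 w) := by
  rw [L2.inner_def]
  refine integral_congr_ae (Eventually.of_forall fun x => ?_)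
  simp only [RCLike.inner_apply, conj_trivial]
  ring

theorem IsTest.isTestPath [NeZero N] (hΩ : Bornology.IsBounded Ω) {φ : Sp N × ℝ → ℝ} {Φ : ℝ → HZero s Ω}
    {Φ' : ℝ → StrongDual ℝ (HZero s Ω)} {c : ℝ → Lp ℝ 2 (volume : Measure (Sp N))}
    (h : IsTest T φ Φ Φ' c) : IsTestPath (HZero.toL2L hΩ) T Φ Φ' c where
  memLp := h.isW.isL2V.memLp
  deriv_memLp := h.isW.deriv_memLp
  deriv_eq := fun η h1 h2 h3 w => by
    have := h.isW.deriv_eq η h1 h2 h3 w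
    simp only [integral_toL2_mul] at this
    exact this
  continuousOn := h.continuousOn
  ae_eq := h.ae_eq
  final := h.final

theorem IsTestPath.isTest [NeZero N] (hΩ : Bornology.IsBounded Ω) {φ : Sp N × ℝ → ℝ} {Φ : ℝ → HZero s Ω}
    {Φ' : ℝ → StrongDual ℝ (HZero s Ω)} {c : ℝ → Lp ℝ 2 (volume : Measure (Sp N))}
    (h : IsTestPath (HZero.toL2L hΩ) T Φ Φ' c) (hφ : IsL2V T φ Φ) : IsTest T φ Φ Φ' c where
  isW := ⟨hφ, h.deriv_memLp, fun η h1 h2 h3 w => by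
    simp only [integral_toL2_mul]
    exact h.deriv_eq η h1 h2 h3 w⟩
  continuousOn := h.continuousOn
  ae_eq := h.ae_eq
  final := h.final

/-- The multiplication operators `w ↦ a(·,t) w`. -/
def potentialOp {a : Sp N × ℝ → ℝ} (ha : Measurable a) {L : ℝ} (hL : ∀ q, |a q| ≤ L) (t : ℝ) :
    Lp ℝ 2 (volume : Measure (Sp N)) →L[ℝ] Lp ℝ 2 (volume : Measure (Sp N)) :=
  mulOp (fun x => a (x, t)) (ha.comp measurable_prodMk_right) L (fun x => hL (x, t))

theorem coeFn_potentialOp {a : Sp N × ℝ → ℝ} (ha : Measurable a) {L : ℝ} (hL : ∀ q, |a q| ≤ L)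
    (t : ℝ) (f : Lp ℝ 2 (volume : Measure (Sp N))) :
    potentialOp ha hL t f =ᵐ[volume] fun x => a (x, t) * f x :=
  coeFn_mulOp (a := fun x => a (x, t)) (ha.comp measurable_prodMk_right) (fun x => hL (x, t)) f

theorem cylMeasure_eq_restrict : cylMeasure ω T = (cylMeasure univ T).restrict (ω ×ˢ univ) := by
  rw [cylMeasure_univ, ← Measure.prod_restrict, Measure.restrict_univ]

/-- The representative a vanishes off ω, so the integral over ω × (0,T) extends to the whole
cylinder and can be sliced in time. -/
theorem integral_potential [NeZero N] (hΩ : Bornology.IsBounded Ω)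
    {v : Sp N × ℝ → ℝ} {a : Sp N × ℝ → ℝ} (ha : Measurable a) {L : ℝ} (hL : ∀ q, |a q| ≤ L)
    (hav : a =ᵐ[cylMeasure ω T] v) (ha0 : ∀ q, q.1 ∉ ω → a q = 0)
    {ρ φ : Sp N × ℝ → ℝ} {R Φ : ℝ → HZero s Ω} (hρ : IsL2V T ρ R) (hφ : IsL2V T φ Φ) :
    ∫ p, v p * ρ p * φ p ∂(cylMeasure ω T) =
      ∫ t, inner ℝ (potentialOp ha hL t (HZero.toL2L hΩ (R t))) (HZero.toL2L hΩ (Φ t))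
        ∂(timeMeasure T) := by
  have hs : IsSlice T (fun q => a q * ρ q)
      fun t => potentialOp ha hL t (HZero.toL2L hΩ (R t)) := by
    filter_upwards [hρ.isSlice] with t ht
    filter_upwards [ht, coeFn_potentialOp ha hL t (HZero.toL2L hΩ (R t))] with x hx hx'
    rw [hx', hx, HZero.toL2L_apply]
  have hm : MemLp (fun q => a q * ρ q) 2 (cylMeasure univ T) :=
    (hρ.memLp_two hΩ).of_le_mul (ha.aestronglyMeasurable.mul hρ.aestronglyMeasurable)
      (Eventually.of_forall fun q => by
        rw [norm_mul]
        exact mul_le_mul_of_nonneg_right (hL q) (norm_nonneg _))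
  have h1 := hs.integral_mul hφ.isSlice hm (hφ.memLp_two hΩ)
  refine Eq.trans ?_ h1
  have h2 : ∫ p, v p * ρ p * φ p ∂(cylMeasure ω T) = ∫ p, a p * ρ p * φ p ∂(cylMeasure ω T) := by
    refine integral_congr_ae ?_
    filter_upwards [hav] with p hp
    rw [hp]
  rw [h2, cylMeasure_eq_restrict]
  refine setIntegral_eq_integral_of_forall_compl_eq_zero fun q hq => ?_
  rw [ha0 q fun h => hq ⟨h, mem_univ _⟩, zero_mul, zero_mul]

theorem setIntegral_mul_eq_inner (hΩ : MeasurableSet Ω) {ρ₀ : Sp N → ℝ}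
    {u₀ f : Lp ℝ 2 (volume : Measure (Sp N))} (hu₀ : u₀ =ᵐ[volume] Ω.indicator ρ₀) :
    ∫ x in Ω, ρ₀ x * f x = inner ℝ u₀ f := by
  rw [← integral_indicator hΩ, L2.inner_def]
  refine integral_congr_ae ?_
  filter_upwards [hu₀] with x hx
  rw [hx]
  by_cases h : x ∈ Ω
  · simp [h, mul_comm]
  · simp [h]

/-- The weak formulation in terms of paths. -/
theorem isWeakSolution_iff [NeZero N] (hΩ : Bornology.IsBounded Ω) (hΩm : MeasurableSet Ω)
    {v : Sp N × ℝ → ℝ} {a : Sp N × ℝ → ℝ} (ha : Measurable a) {L : ℝ}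
    (hL : ∀ q, |a q| ≤ L) (hav : a =ᵐ[cylMeasure ω T] v) (ha0 : ∀ q, q.1 ∉ ω → a q = 0)
    {ρ₀ : Sp N → ℝ} {u₀ : Lp ℝ 2 (volume : Measure (Sp N))} (hu₀ : u₀ =ᵐ[volume] Ω.indicator ρ₀)
    {ρ : Sp N × ℝ → ℝ} :
    IsWeakSolution s Ω ω T v ρ₀ ρ ↔ ∃ R : ℝ → HZero s Ω, IsL2V T ρ R ∧
      SolvesWeakly (HZero.toL2L hΩ) T (potentialOp ha hL) u₀ R := by
  refine exists_congr fun R => and_congr_right fun hρ => ⟨fun h Φ Φ' c hP => ?_,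
    fun h φ Φ Φ' c hP => ?_⟩
  -- The concrete formulation only tests with functions of (x,t), so an abstract test path must
  -- first be realised as one.
  · obtain ⟨φ, hφ⟩ := exists_isL2V hΩ hP.memLp
    have := h φ Φ Φ' c (hP.isTest hΩ hφ)
    rw [integral_potential hΩ ha hL hav ha0 hρ hφ, setIntegral_mul_eq_inner hΩm hu₀] at this
    exact this
  · rw [integral_potential hΩ ha hL hav ha0 hρ hP.isW.isL2V, setIntegral_mul_eq_inner hΩm hu₀]
    exact h Φ Φ' c (hP.isTestPath hΩ)

/-- If a path of functions satisfies the linear inequalities valid for all paths of functions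
bounded by `r`, then it is bounded by `r`. -/
theorem ae_abs_le_of_forall_integral_inner_le (hΩ : Bornology.IsBounded Ω) {r : ℝ} (hr : 0 ≤ r)
    {ρ : Sp N × ℝ → ℝ} {F : ℝ → Lp ℝ 2 (volume : Measure (Sp N))}
    (hρ : MemLp ρ 2 (cylMeasure univ T)) (hF : IsSlice T ρ F)
    (h : ∀ (G : ℝ → Lp ℝ 2 (volume : Measure (Sp N))) (κ : ℝ), MemLp G 2 (timeMeasure T) →
        (∀ f : ℝ → Lp ℝ 2 (volume : Measure (Sp N)), AEStronglyMeasurable f (timeMeasure T) →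
          (∀ᵐ t ∂(timeMeasure T), f t ∈ boundedBy Ω r) →
          ∫ t, inner ℝ (f t) (G t) ∂(timeMeasure T) ≤ κ) →
        ∫ t, inner ℝ (F t) (G t) ∂(timeMeasure T) ≤ κ) :
    ∀ᵐ q ∂(cylMeasure univ T), |ρ q| ≤ r := by
  -- Tested with the slices of g, the admissible constant is ∫ r|g|, whereas ρ g = r|g| + g²; hence
  -- ∫ g² ≤ 0.
  set g : Sp N × ℝ → ℝ := fun q => excess r (ρ q) with hg
  have hgm : AEStronglyMeasurable g (cylMeasure univ T) :=
    (lipschitzWith_excess hr).continuous.comp_aestronglyMeasurable hρ.aestronglyMeasurable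
  have hg2 : MemLp g 2 (cylMeasure univ T) := hρ.of_le hgm (Eventually.of_forall fun q => by
    have := (lipschitzWith_excess hr).dist_le_mul (ρ q) 0
    rwa [NNReal.coe_one, one_mul, Real.dist_eq, Real.dist_eq, excess_zero hr, sub_zero,
      sub_zero] at this)
  have i1 : Integrable (fun q => ρ q * g q) (cylMeasure univ T) := hρ.integrable_mul hg2
  have i2 : Integrable (fun q => g q ^ 2) (cylMeasure univ T) := hg2.integrable_sq
  -- The cylinder has infinite measure, so square integrability of g does not suffice; r|g| is the
  -- difference of the integrable functions ρ g and g².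
  have i3 : Integrable (fun q => r * |g q|) (cylMeasure univ T) := by
    refine (i1.sub i2).congr (Eventually.of_forall fun q => ?_)
    simp only [Pi.sub_apply, hg, mul_excess hr]
    ring
  obtain ⟨G, hG⟩ := exists_isSlice hg2
  have hGm : MemLp G 2 (timeMeasure T) := (hG.memLp_iff hgm).2 hg2
  have key := h G (∫ q, r * |g q| ∂(cylMeasure univ T)) hGm ?_
  · rw [← hF.integral_mul hG hρ hg2] at key
    have e1 : ∫ q, ρ q * g q ∂(cylMeasure univ T) = ∫ q, r * |g q| ∂(cylMeasure univ T) +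
        ∫ q, g q ^ 2 ∂(cylMeasure univ T) := by
      rw [← integral_add i3 i2]
      simp only [hg, mul_excess hr]
    have e2 : ∫ q, g q ^ 2 ∂(cylMeasure univ T) = 0 :=
      le_antisymm (by linarith) (integral_nonneg fun _ => sq_nonneg _)
    rw [integral_eq_zero_iff_of_nonneg (fun _ => sq_nonneg _) i2] at e2
    filter_upwards [e2] with q hq
    rw [← excess_eq_zero_iff hr]
    simpa using hq
  · intro f hfm hf
    have hf2 : MemLp f 2 (timeMeasure T) := MemLp.of_bound hfm (√(volume.real (closure Ω)) * r) (by
      filter_upwards [hf] with t ht using norm_le_of_mem_boundedBy hΩ ht)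
    rw [cylMeasure_univ] at i3 ⊢
    rw [integral_prod_symm _ i3]
    refine integral_mono_ae (integrable_inner_of_memLp_two hf2 hGm) i3.integral_prod_right ?_
    filter_upwards [hf, hG, i3.prod_left_ae] with t h1 h2 h3
    rw [L2.inner_def]
    refine integral_mono_ae (L2.integrable_inner _ _) h3 ?_
    filter_upwards [h1.1, h2] with x h4 h5
    rw [← h5]
    simp only [RCLike.inner_apply, conj_trivial]
    refine (le_abs_self _).trans ?_
    rw [abs_mul, mul_comm]
    exact mul_le_mul_of_nonneg_right h4 (abs_nonneg _)

/-- A measurable everywhere bounded representative of `v`, extended by zero. -/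
theorem exists_bounded_representative (hω : MeasurableSet ω) {v : Sp N × ℝ → ℝ}
    (hv : MemLp v ⊤ (cylMeasure ω T)) :
    ∃ a : Sp N × ℝ → ℝ, Measurable a ∧ (∀ q, |a q| ≤ (eLpNorm v ⊤ (cylMeasure ω T)).toReal) ∧
      a =ᵐ[cylMeasure ω T] v ∧ ∀ q, q.1 ∉ ω → a q = 0 := by
  set L := (eLpNorm v ⊤ (cylMeasure ω T)).toReal with hL
  have hL0 : 0 ≤ L := ENNReal.toReal_nonneg
  have hle : ∀ᵐ q ∂(cylMeasure ω T), |v q| ≤ L := by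
    filter_upwards [ae_le_eLpNormEssSup (f := v) (μ := cylMeasure ω T)] with q hq
    rw [hL, eLpNorm_exponent_top, ← Real.norm_eq_abs, ← toReal_enorm]
    exact ENNReal.toReal_mono (by simpa using hv.2.ne) hq
  set m := hv.1.mk v
  have hm : Measurable m := hv.1.stronglyMeasurable_mk.measurable
  -- Clipping does not change the almost everywhere class and yields a bound at every point, so that
  -- every M(t) is a bounded operator.
  refine ⟨(ω ×ˢ univ).indicator fun q => max (-L) (min (m q) L),
    ((measurable_const.max (hm.min measurable_const)).indicator (hω.prod MeasurableSet.univ)),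
    fun q => ?_, ?_, fun q hq => indicator_of_notMem (fun h => hq h.1) _⟩
  · by_cases hq : q ∈ ω ×ˢ (univ : Set ℝ)
    · rw [indicator_of_mem hq, abs_le]
      exact ⟨le_max_left _ _, max_le (by linarith) (min_le_right _ _)⟩
    · rw [indicator_of_notMem hq, abs_zero]
      exact hL0
  · have hmem : ∀ᵐ q ∂(cylMeasure ω T), q ∈ ω ×ˢ (univ : Set ℝ) := by
      rw [cylMeasure_eq_restrict]
      exact ae_restrict_mem (hω.prod MeasurableSet.univ)
    filter_upwards [hmem, hle, hv.1.ae_eq_mk] with q h1 h2 h3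
    rw [abs_le] at h2
    rw [indicator_of_mem h1]
    change max (-L) (min (hv.1.mk v q) L) = v q
    rw [← h3, min_eq_left h2.2, max_eq_right h2.1]

end Bridge

/-! ### The explicit half step and the initial datum -/

section Main

variable {N : ℕ} {s : Ioo (0 : ℝ) 1} {Ω ω : Set (Sp N)} {T : ℝ}

/-- The half step is pointwise multiplication by 1 + h a(x,t), of modulus at most 1 + hL, so it also
preserves vanishing outside Ω. -/
theorem add_smul_potentialOp_mem_boundedBy {a : Sp N × ℝ → ℝ} (ha : Measurable a) {L : ℝ}
    (hL : ∀ q, |a q| ≤ L) {h r : ℝ} (hh : 0 ≤ h)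
    {f : Lp ℝ 2 (volume : Measure (Sp N))} (hf : f ∈ boundedBy Ω r) (t : ℝ) :
    f + h • potentialOp ha hL t f ∈ boundedBy Ω ((1 + h * L) * r) := by
  have hval : ∀ᵐ x, (f + h • potentialOp ha hL t f) x = (1 + h * a (x, t)) * f x := by
    filter_upwards [Lp.coeFn_add f (h • potentialOp ha hL t f),
      Lp.coeFn_smul h (potentialOp ha hL t f), coeFn_potentialOp ha hL t f] with x h1 h2 h3
    rw [h1, Pi.add_apply, h2, Pi.smul_apply, h3, smul_eq_mul]
    ring
  constructor
  · filter_upwards [hval, hf.1] with x h1 h2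
    rw [h1, abs_mul]
    have h3 : |1 + h * a (x, t)| ≤ 1 + h * L := by
      refine (abs_add_le _ _).trans ?_
      rw [abs_one, abs_mul, abs_of_nonneg hh]
      gcongr
      exact hL _
    exact mul_le_mul h3 h2 (abs_nonneg _) ((abs_nonneg _).trans h3)
  · filter_upwards [hval, hf.2] with x h1 h2 h3
    rw [h1, h2 h3, mul_zero]

theorem exists_initial_datum (hΩm : MeasurableSet Ω) (hΩ : Bornology.IsBounded Ω)
    {ρ₀ : Sp N → ℝ} (hρ₀ : MemLp ρ₀ ⊤ (volume.restrict Ω)) :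
    ∃ u₀ : Lp ℝ 2 (volume : Measure (Sp N)), u₀ =ᵐ[volume] Ω.indicator ρ₀ ∧
      u₀ ∈ boundedBy Ω (eLpNorm ρ₀ ⊤ (volume.restrict Ω)).toReal := by
  set r := (eLpNorm ρ₀ ⊤ (volume.restrict Ω)).toReal with hr
  have : IsFiniteMeasure (volume.restrict Ω) := ⟨by
    rw [Measure.restrict_apply_univ]; exact hΩ.measure_lt_top⟩
  have h2 : MemLp (Ω.indicator ρ₀) 2 volume :=
    (memLp_indicator_iff_restrict hΩm).2 (hρ₀.mono_exponent le_top)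
  refine ⟨h2.toLp, h2.coeFn_toLp, ?_, ?_⟩
  · have hle : ∀ᵐ x ∂(volume.restrict Ω), |ρ₀ x| ≤ r := by
      filter_upwards [ae_le_eLpNormEssSup (f := ρ₀) (μ := volume.restrict Ω)] with x hx
      rw [hr, eLpNorm_exponent_top, ← Real.norm_eq_abs, ← toReal_enorm]
      exact ENNReal.toReal_mono (by simpa using hρ₀.2.ne) hx
    rw [ae_restrict_iff' hΩm] at hle
    filter_upwards [hle, h2.coeFn_toLp] with x h3 h4
    rw [h4]
    by_cases hx : x ∈ Ω
    · rw [indicator_of_mem hx]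
      exact h3 hx
    · rw [indicator_of_notMem hx, abs_zero]
      exact ENNReal.toReal_nonneg
  · filter_upwards [h2.coeFn_toLp] with x h4 hx
    rw [h4, indicator_of_notMem hx]

end Main

end FracDiff

end

/-! ### Assembly of the theorem -/

theorem theorem3p6 {N : ℕ} [NeZero N] (s : Set.Ioo (0 : ℝ) 1)
    (Ω ω : Set (FracDiff.Sp N)) (hΩ_open : IsOpen Ω) (hΩ_conn : IsConnected Ω)
    (hΩ_bdd : Bornology.IsBounded Ω) (hω_open : IsOpen ω) (hωΩ : ω ⊆ Ω)
    (T : ℝ) (hT : 0 < T)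
    (v : FracDiff.Sp N × ℝ → ℝ) (hv : MemLp v ⊤ (FracDiff.cylMeasure ω T))
    (ρ₀ : FracDiff.Sp N → ℝ) (hρ₀ : MemLp ρ₀ ⊤ (volume.restrict Ω)) :
    (∃ ρ, FracDiff.IsWeakSolution s Ω ω T v ρ₀ ρ) ∧
    ∀ ρ, FracDiff.IsWeakSolution s Ω ω T v ρ₀ ρ →
      (∀ ρ', FracDiff.IsWeakSolution s Ω ω T v ρ₀ ρ' →
        ρ' =ᵐ[FracDiff.cylMeasure Set.univ T] ρ) ∧
      FracDiff.MemW s Ω T ρ ∧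
      MemLp ρ ⊤ (FracDiff.cylMeasure Set.univ T) ∧
      (eLpNorm ρ ⊤ (FracDiff.cylMeasure Set.univ T)).toReal ≤
        Real.exp ((eLpNorm v ⊤ (FracDiff.cylMeasure ω T)).toReal * T) *
          (eLpNorm ρ₀ ⊤ (volume.restrict Ω)).toReal := by
  open FracDiff in
  obtain ⟨a, ha, haL, hav, ha0⟩ := exists_bounded_representative hω_open.measurableSet hv
  obtain ⟨u₀, hu₀, hu₀r⟩ := exists_initial_datum hΩ_open.measurableSet hΩ_bdd hρ₀
  set L := (eLpNorm v ⊤ (cylMeasure ω T)).toReal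
  set r := (eLpNorm ρ₀ ⊤ (volume.restrict Ω)).toReal
  have hL0 : 0 ≤ L := ENNReal.toReal_nonneg
  have hr0 : 0 ≤ r := ENNReal.toReal_nonneg
  have : CompleteSpace (HZero s Ω) := HZero.completeSpace hΩ_bdd
  set ι : HZero s Ω →L[ℝ] Lp ℝ 2 (volume : Measure (Sp N)) := HZero.toL2L hΩ_bdd
  set M := potentialOp ha haL
  have hM : ∀ f, StronglyMeasurable fun t => M t f := stronglyMeasurable_mulOp ha haL
  have hML : ∀ t, ‖M t‖ ≤ L := fun t =>
    norm_mulOp_le (ha.comp measurable_prodMk_right) hL0 fun x => haL (x, t)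
  have hiff : ∀ ρ, IsWeakSolution s Ω ω T v ρ₀ ρ ↔
      ∃ R : ℝ → HZero s Ω, IsL2V T ρ R ∧ SolvesWeakly ι T M u₀ R := fun ρ =>
    isWeakSolution_iff hΩ_bdd hΩ_open.measurableSet ha haL hav ha0 hu₀
  obtain ⟨R, hR, hRsol, hRle⟩ := exists_solution_isTestPath_identity ι hT hM
    (fun t f g => inner_mulOp (ha.comp measurable_prodMk_right) (fun x => haL (x, t)) f g)
    hL0 hML (S := boundedBy Ω)
    (fun h r f t hh hf => add_smul_potentialOp_mem_boundedBy ha haL hh.le hf t)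
    (fun r r' f _ hrr' hf => boundedBy_mono hrr' hf)
    (fun h r f u hh hr hf hu => toL2_mem_boundedBy hh hr hf hu)
    (fun r f hf => norm_le_of_mem_boundedBy hΩ_bdd hf) hr0 hu₀r
  obtain ⟨ρ₁, hρ₁⟩ := exists_isL2V hΩ_bdd hR
  have huniq : ∀ ρ ρ', IsWeakSolution s Ω ω T v ρ₀ ρ → IsWeakSolution s Ω ω T v ρ₀ ρ' →
      ρ =ᵐ[cylMeasure univ T] ρ' := by
    intro ρ ρ' h h'
    obtain ⟨R, hR, hs⟩ := (hiff ρ).1 h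
    obtain ⟨R', hR', hs'⟩ := (hiff ρ').1 h'
    refine ae_eq_cylMeasure_of_ae_ae hR.aestronglyMeasurable hR'.aestronglyMeasurable ?_
    filter_upwards [hs.ae_eq hT hM hL0 hML hR.memLp hR'.memLp hs', hR.slice, hR'.slice]
      with t h1 h2 h3
    have h4 : HZero.toL2 (R t) = HZero.toL2 (R' t) := h1
    rw [← h4] at h3
    exact h2.trans h3.symm
  have hsol₁ : IsWeakSolution s Ω ω T v ρ₀ ρ₁ := (hiff ρ₁).2 ⟨R, hρ₁, hRsol⟩
  have hbound := ae_abs_le_of_forall_integral_inner_le hΩ_bdd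
    (mul_nonneg (Real.exp_pos (L * T)).le hr0) (hρ₁.memLp_two hΩ_bdd) hρ₁.isSlice hRle
  refine ⟨⟨ρ₁, hsol₁⟩, fun ρ hρ => ?_⟩
  -- The bound is known for the solution built by the scheme; uniqueness carries it to an arbitrary
  -- weak solution.
  have hbρ : ∀ᵐ q ∂(cylMeasure univ T), ‖ρ q‖ ≤ Real.exp (L * T) * r := by
    filter_upwards [hbound, huniq ρ ρ₁ hρ hsol₁] with q h1 h2
    rwa [h2, Real.norm_eq_abs]
  obtain ⟨R₂, hR₂, hs₂⟩ := (hiff ρ).1 hρ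
  refine ⟨fun ρ' hρ' => huniq ρ' ρ hρ' hρ, ?_,
    memLp_top_of_bound hR₂.aestronglyMeasurable _ hbρ, ?_⟩
  · obtain ⟨R', hR', hd⟩ := hs₂.exists_deriv hT hM hML hR₂.memLp
    refine ⟨R₂, R', hR₂, hR', fun η h1 h2 h3 w => ?_⟩
    simp only [integral_toL2_mul]
    exact hd η h1 h2 h3 w
  · refine ENNReal.toReal_le_of_le_ofReal (mul_nonneg (Real.exp_pos _).le hr0) ?_
    rw [eLpNorm_exponent_top]
    exact eLpNormEssSup_le_of_ae_bound hbρ
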